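/- All graphs are finite and simple, and $|G|$ denotes the number of vertices of $G$. The congestion of a graph $H$ is $0$ if $H$ has no edges, and otherwise it is the maximum of $1-\frac{|J|-1}{|E(J)|}$ over all (not necessarily induced) subgraphs $J$ of $H$ with at least one edge. A graph $G$ is $\varepsilon$-sparse if every vertex of $G$ has degree less than $\varepsilon|G|$. An anticomplete pair in $G$ is a pair $A,B$ of disjoint subsets of $V(G)$ such that no vertex of $A$ has a neighbour in $B$; and for $\gamma,\delta\ge 0$, $G$ is $(\gamma,\delta)$-coherent if there is no anticomplete pair $A,B$ in $G$ with $|A|\ge\gamma$ and $|B|\ge\delta$. Theorem. Let $c>0$, and let $H$ be a graph with congestion at most $\frac{c}{9+15c}$. Then there exists $\varepsilon>0$ such that every $\varepsilon$-sparse, $(\varepsilon|G|^{1-c},\varepsilon|G|^{1-c})$-coherent graph $G$ with $|G|>1$ has an induced subgraph isomorphic to $H$. -/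

import Mathlib

namespace PurePairs

/-- The set of the numbers `1 - (|J| - 1) / |E(J)|`, where `J` ranges over the subgraphs
(not necessarily induced) of `H` with at least one edge. -/
def congestionValues {W : Type*} (H : SimpleGraph W) : Set ℝ :=
  {x | ∃ J : H.Subgraph, J.edgeSet.Nonempty ∧
    x = 1 - ((J.verts.ncard : ℝ) - 1) / (J.edgeSet.ncard : ℝ)}

open Classical in
/-- The congestion of a finite graph `H`: the maximum of `1 - (|J| - 1) / |E(J)|` over all
subgraphs `J` of `H` with at least one edge, or zero if `H` has no edge. (The supremum is a
maximum: see `isGreatest_congestion`.) -/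
noncomputable def congestion {W : Type*} (H : SimpleGraph W) : ℝ :=
  if H.edgeSet.Nonempty then sSup (congestionValues H) else 0

theorem isGreatest_congestion {W : Type*} [Finite W] (H : SimpleGraph W)
    (hH : H.edgeSet.Nonempty) : IsGreatest (congestionValues H) (congestion H) := by
  have hfin : (congestionValues H).Finite := by
    have : Finite H.Subgraph :=
      Finite.of_injective (fun J : H.Subgraph => (J.verts, J.Adj)) (by
        intro J K h
        simp only [Prod.mk.injEq] at h
        exact SimpleGraph.Subgraph.ext h.1 h.2)
    refine (Set.finite_range (fun J : H.Subgraph =>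
      1 - ((J.verts.ncard : ℝ) - 1) / (J.edgeSet.ncard : ℝ))).subset ?_
    rintro x ⟨J, -, rfl⟩
    exact ⟨J, rfl⟩
  have hne : (congestionValues H).Nonempty :=
    ⟨_, ⊤, by simpa using hH, rfl⟩
  rw [congestion, if_pos hH]
  exact ⟨hne.csSup_mem hfin, fun x hx => le_csSup hfin.bddAbove hx⟩

/-- `G` is `ε`-sparse: every vertex has degree less than `ε |G|`. -/
def IsSparse {V : Type*} [Fintype V] (G : SimpleGraph V) (ε : ℝ) : Prop :=
  ∀ v : V, ((G.neighborSet v).ncard : ℝ) < ε * (Fintype.card V : ℝ)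

/-- `A, B` is an anticomplete pair: `A` and `B` are disjoint and no vertex of `A` has a
neighbour in `B`. -/
def IsAnticompletePair {V : Type*} (G : SimpleGraph V) (A B : Finset V) : Prop :=
  Disjoint A B ∧ ∀ a ∈ A, ∀ b ∈ B, ¬ G.Adj a b

/-- `G` is `(γ, δ)`-coherent: there is no anticomplete pair `A, B` with `|A| ≥ γ` and
`|B| ≥ δ`. -/
def IsCoherent {V : Type*} (G : SimpleGraph V) (γ δ : ℝ) : Prop :=
  ¬ ∃ A B : Finset V, IsAnticompletePair G A B ∧ γ ≤ (A.card : ℝ) ∧ δ ≤ (B.card : ℝ)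

end PurePairs

/-!
A large sparse graph contains arbitrarily many disjoint wide sets of vertices that are sparse to
each other (a *blockade*), and we embed `H` with at most one vertex in each member of such a
blockade, by induction on `|H|`. A vertex of degree at most one is added by shrinking the blockade
until each remaining vertex has a neighbour, in a member set aside, that sees no other member. If
all degrees are at least two then, the congestion being small, a nonbacktracking walk cannot branch
often, which yields a path of length `3 k + 5` in `H` whose interior vertices have degree two, where
`k` is about `1 / c`. To add it, shrink the blockade until any two vertices of distinct members are
joined by an induced path of this length through other members that avoids what is left. Such paths
come from *hubs*: by coherence, for most vertices of a sequence of disjoint sets the reachable part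
grows by a polynomial factor at each step, and so exceeds `|G| ^ (1 - c)` after about `1 / c` steps;
two sets of this size are not anticomplete.
-/
namespace PurePairs

open Finset
open Filter hiding mem_sdiff

universe u

section Neighbors

variable {V : Type*} {G : SimpleGraph V} {X Y S T : Finset V} {v w : V}

open Classical in
/-- The neighbours of the vertex `v` in `S`. -/
noncomputable def neighborsIn (G : SimpleGraph V) (v : V) (S : Finset V) : Finset V :=
  {w ∈ S | G.Adj v w}

open Classical in
/-- The part of `S` covered by `X`: the vertices of `S` with a neighbour in `X`. -/
noncomputable def covered (G : SimpleGraph V) (X S : Finset V) : Finset V :=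
  {w ∈ S | ∃ x ∈ X, G.Adj x w}

theorem mem_neighborsIn : w ∈ neighborsIn G v S ↔ w ∈ S ∧ G.Adj v w := by simp [neighborsIn]

theorem mem_covered : w ∈ covered G X S ↔ w ∈ S ∧ ∃ x ∈ X, G.Adj x w := by simp [covered]

theorem neighborsIn_subset (G : SimpleGraph V) (v : V) (S : Finset V) : neighborsIn G v S ⊆ S :=
  fun _ hw => (mem_neighborsIn.1 hw).1

theorem covered_subset (G : SimpleGraph V) (X S : Finset V) : covered G X S ⊆ S :=
  fun _ hw => (mem_covered.1 hw).1

theorem neighborsIn_mono (G : SimpleGraph V) (v : V) (h : S ⊆ T) :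
    neighborsIn G v S ⊆ neighborsIn G v T := fun _ hw =>
  mem_neighborsIn.2 ⟨h (mem_neighborsIn.1 hw).1, (mem_neighborsIn.1 hw).2⟩

theorem covered_mono (G : SimpleGraph V) (h : X ⊆ Y) (S : Finset V) :
    covered G X S ⊆ covered G Y S := fun _ hw =>
  have ⟨hwS, x, hx, hxw⟩ := mem_covered.1 hw
  mem_covered.2 ⟨hwS, x, h hx, hxw⟩

theorem covered_empty (G : SimpleGraph V) (S : Finset V) : covered G ∅ S = ∅ := by
  ext
  simp [mem_covered]

theorem covered_singleton (G : SimpleGraph V) (v : V) (S : Finset V) :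
    covered G {v} S = neighborsIn G v S := by
  ext
  simp [mem_covered, mem_neighborsIn]

theorem covered_union [DecidableEq V] (G : SimpleGraph V) (X Y S : Finset V) :
    covered G (X ∪ Y) S = covered G X S ∪ covered G Y S := by
  ext
  simp only [mem_covered, mem_union]
  grind

theorem covered_insert [DecidableEq V] (G : SimpleGraph V) (v : V) (X S : Finset V) :
    covered G (insert v X) S = neighborsIn G v S ∪ covered G X S := by
  rw [insert_eq, covered_union, covered_singleton]

theorem card_covered_insert_le [DecidableEq V] (G : SimpleGraph V) (v : V) (X S : Finset V) :
    #(covered G (insert v X) S) ≤ #(neighborsIn G v S) + #(covered G X S) :=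
  (covered_insert G v X S).symm ▸ card_union_le _ _

theorem sum_card_neighborsIn_comm (G : SimpleGraph V) (X Y : Finset V) :
    ∑ v ∈ X, #(neighborsIn G v Y) = ∑ w ∈ Y, #(neighborsIn G w X) := by
  classical
  simpa only [bipartiteAbove, bipartiteBelow, neighborsIn, G.adj_comm] using
    sum_card_bipartiteAbove_eq_sum_card_bipartiteBelow (s := X) (t := Y) G.Adj

theorem IsCoherent.mono {γ γ' δ δ' : ℝ} (h : IsCoherent G γ δ) (hγ : γ ≤ γ') (hδ : δ ≤ δ') :
    IsCoherent G γ' δ' := fun ⟨A, B, hAB, hA, hB⟩ => h ⟨A, B, hAB, hγ.trans hA, hδ.trans hB⟩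

theorem IsCoherent.exists_adj {γ δ : ℝ} (h : IsCoherent G γ δ) (hXY : Disjoint X Y)
    (hX : γ ≤ #X) (hY : δ ≤ #Y) : ∃ x ∈ X, ∃ y ∈ Y, G.Adj x y := by
  by_contra! hno
  exact h ⟨X, Y, ⟨hXY, hno⟩, hX, hY⟩

theorem IsCoherent.card_lt_card_covered_add {γ δ : ℝ} (h : IsCoherent G γ δ)
    (hXS : Disjoint X S) (hX : γ ≤ #X) : (#S : ℝ) < #(covered G X S) + δ := by
  classical
  by_contra! hle
  have hsplit : (#(S \ covered G X S) : ℝ) + #(covered G X S) = #S := by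
    exact_mod_cast card_sdiff_add_card_eq_card (covered_subset G X S)
  obtain ⟨x, hx, y, hy, hxy⟩ :=
    h.exists_adj (hXS.mono_right sdiff_subset) hX (by linarith : δ ≤ #(S \ covered G X S))
  rw [mem_sdiff, mem_covered] at hy
  exact hy.2 ⟨hy.1, x, hx, hxy⟩

end Neighbors

section InducedPath

variable {V : Type*} {G : SimpleGraph V}

/-- `p 0, …, p ℓ` are the vertices of an induced path, in order. -/
def IsInducedPath (G : SimpleGraph V) (p : ℕ → V) (ℓ : ℕ) : Prop :=
  ∀ a b, a < b → b ≤ ℓ → p a ≠ p b ∧ (G.Adj (p a) (p b) ↔ b = a + 1)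

theorem exists_isInducedPath_subsequence (q : ℕ → V) (L : ℕ) (hinj : Set.InjOn q (Set.Iic L))
    (hadj : ∀ a < L, G.Adj (q a) (q (a + 1))) :
    ∃ (r : ℕ) (s : ℕ → ℕ), r ≤ L ∧ s 0 = 0 ∧ s r = L ∧ StrictMono s ∧
      IsInducedPath G (q ∘ s) r := by
  induction L using Nat.strong_induction_on generalizing q with
  | _ L ih =>
  by_cases hchord : ∃ a b, a + 1 < b ∧ b ≤ L ∧ G.Adj (q a) (q b)
  · obtain ⟨a, b, hab, hbL, hqab⟩ := hchord
    let shortcut : ℕ → ℕ := fun i => if i ≤ a then i else i + (b - a - 1)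
    have hmono : StrictMono shortcut := fun i j hij => by
      simp only [shortcut]; split_ifs <;> omega
    have hle {i : ℕ} (hi : i ≤ L - (b - a - 1)) : shortcut i ≤ L := by
      simp only [shortcut]; split_ifs <;> omega
    obtain ⟨r, s, hr, hs0, hsr, hs, hpath⟩ := ih (L - (b - a - 1)) (by omega) (q ∘ shortcut)
      (fun i hi j hj hij => hmono.injective (hinj (hle hi) (hle hj) hij)) (fun i hi => by
        rcases lt_trichotomy i a with h | rfl | h
        · simpa [shortcut, h.le, Nat.succ_le_of_lt h] using hadj i (by omega)
        · simpa [shortcut, show i + 1 + (b - i - 1) = b by omega] using hqab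
        · have := hadj (i + (b - a - 1)) (by omega)
          simpa [shortcut, h.not_ge, (h.trans (Nat.lt_succ_self i)).not_ge,
            Nat.add_right_comm] using this)
    refine ⟨r, shortcut ∘ s, by omega, ?_, ?_, hmono.comp hs, hpath⟩
    · simp [hs0, shortcut]
    · simp only [Function.comp_apply, hsr, shortcut]; split_ifs <;> omega
  · push Not at hchord
    refine ⟨L, id, le_rfl, rfl, rfl, strictMono_id, fun a b hab hb =>
      ⟨fun h => ?_, fun h => ?_, ?_⟩⟩
    · exact hab.ne (hinj (hab.le.trans hb) hb h)
    · by_contra hne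
      exact hchord a b (by omega) hb h
    · rintro rfl
      exact hadj a hb

end InducedPath

section Reach

variable {V : Type*} {G : SimpleGraph V} {C : ℕ → Finset V} {X Y : Finset V} {i j k : ℕ} {z u : V}

open Classical in
/-- The vertices that can be reached from `X` by a walk whose further vertices lie in sets of
increasing index among `C 0, …, C (i - 1)`. -/
noncomputable def reach (G : SimpleGraph V) (C : ℕ → Finset V) (X : Finset V) : ℕ → Finset V
  | 0 => X
  | i + 1 => reach G C X i ∪ covered G (reach G C X i) (C i)

/-- The vertices reached from `X` in the `i`-th step of `reach`. -/
noncomputable def layer (G : SimpleGraph V) (C : ℕ → Finset V) (X : Finset V) : ℕ → Finset V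
  | 0 => X
  | i + 1 => covered G (reach G C X i) (C i)

theorem mem_reach_succ : u ∈ reach G C X (i + 1) ↔ u ∈ reach G C X i ∨ u ∈ layer G C X (i + 1) := by
  simp only [reach, layer, mem_union]

theorem reach_succ [DecidableEq V] (G : SimpleGraph V) (C : ℕ → Finset V) (X : Finset V) (i : ℕ) :
    reach G C X (i + 1) = reach G C X i ∪ layer G C X (i + 1) := by
  ext
  rw [mem_union, mem_reach_succ]

theorem layer_subset_reach (G : SimpleGraph V) (C : ℕ → Finset V) (X : Finset V) :
    ∀ i, layer G C X i ⊆ reach G C X i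
  | 0 => Subset.rfl
  | _ + 1 => fun _ hu => mem_reach_succ.2 (Or.inr hu)

theorem reach_union [DecidableEq V] (G : SimpleGraph V) (C : ℕ → Finset V) (X Y : Finset V)
    (i : ℕ) : reach G C (X ∪ Y) i = reach G C X i ∪ reach G C Y i := by
  induction i with
  | zero => rfl
  | succ i ih =>
    ext
    simp only [reach, ih, covered_union, mem_union]
    tauto

theorem layer_union [DecidableEq V] (G : SimpleGraph V) (C : ℕ → Finset V) (X Y : Finset V) :
    ∀ i, layer G C (X ∪ Y) i = layer G C X i ∪ layer G C Y i
  | 0 => rfl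
  | i + 1 => by simp only [layer, reach_union, covered_union]

theorem reach_empty (G : SimpleGraph V) (C : ℕ → Finset V) (i : ℕ) : reach G C ∅ i = ∅ := by
  induction i with
  | zero => rfl
  | succ i ih => simp [reach, ih, covered_empty]

theorem layer_empty (G : SimpleGraph V) (C : ℕ → Finset V) (i : ℕ) : layer G C ∅ i = ∅ :=
  subset_empty.1 ((layer_subset_reach G C ∅ i).trans (reach_empty G C i).subset)

theorem mem_reach_singleton (hu : u ∈ reach G C {z} i) : u = z ∨ ∃ j < i, u ∈ C j := by
  induction i with
  | zero => exact Or.inl (mem_singleton.1 hu)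
  | succ i ih =>
    rcases mem_reach_succ.1 hu with hu | hu
    · exact (ih hu).imp_right fun ⟨j, hj, huC⟩ => ⟨j, hj.trans i.lt_succ_self, huC⟩
    · exact Or.inr ⟨i, i.lt_succ_self, covered_subset _ _ _ hu⟩

theorem exists_subset_card_le_of_subadditive [DecidableEq V] {f : Finset V → ℕ}
    (hf : ∀ X Y, f (X ∪ Y) ≤ f X + f Y) {s g t : ℕ} (hX : #X ≤ (t + 1) * s)
    (hfX : (t + 1) * g ≤ f X) : ∃ Y ⊆ X, #Y ≤ s ∧ g ≤ f Y := by
  induction t generalizing X with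
  | zero => exact ⟨X, Subset.rfl, by simpa using hX, by simpa using hfX⟩
  | succ t ih =>
    obtain ⟨Z, hZX, hZ⟩ := exists_subset_card_eq (min_le_right s #X)
    by_cases hg : g ≤ f Z
    · exact ⟨Z, hZX, hZ.trans_le (min_le_left _ _), hg⟩
    have hsub : f X ≤ f Z + f (X \ Z) := by
      simpa only [union_sdiff_of_subset hZX] using hf Z (X \ Z)
    have hcard : #(X \ Z) ≤ (t + 1) * s := by
      rw [card_sdiff_of_subset hZX, hZ]
      rw [add_one_mul (t + 1)] at hX
      have := Nat.zero_le ((t + 1) * s)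
      omega
    obtain ⟨Y, hY, hYs, hYg⟩ := ih hcard (by rw [add_one_mul (t + 1)] at hfX; omega)
    exact ⟨Y, hY.trans sdiff_subset, hYs, hYg⟩

theorem exists_subset_le_card_layer_succ {γ : ℝ} (hG : IsCoherent G γ γ) {s t : ℕ}
    (hX : #X ≤ (t + 1) * s) (hlayer : γ ≤ #(layer G C X j)) (hC : (t + 2) * ⌈γ⌉₊ ≤ #(C j))
    (hdisj : Disjoint (layer G C X j) (C j)) :
    ∃ Y ⊆ X, #Y ≤ s ∧ γ ≤ #(layer G C Y (j + 1)) := by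
  classical
  have hcovered : (t + 1) * ⌈γ⌉₊ ≤ #(layer G C X (j + 1)) := by
    have hlt := hG.card_lt_card_covered_add hdisj hlayer
    have hle : (#(covered G (layer G C X j) (C j)) : ℝ) ≤ #(layer G C X (j + 1)) := by
      exact_mod_cast card_le_card (covered_mono G (layer_subset_reach G C X j) _)
    have hC' : ((t + 2) * ⌈γ⌉₊ : ℝ) ≤ #(C j) := by exact_mod_cast hC
    have : ((t + 1) * ⌈γ⌉₊ : ℝ) ≤ #(layer G C X (j + 1)) := by linarith [Nat.le_ceil γ]
    exact_mod_cast this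
  obtain ⟨Y, hYX, hYs, hY⟩ := exists_subset_card_le_of_subadditive
    (f := fun X => #(layer G C X (j + 1)))
    (fun X Y => (layer_union G C X Y (j + 1)).symm ▸ card_union_le _ _) hX hcovered
  exact ⟨Y, hYX, hYs, (Nat.le_ceil γ).trans (by exact_mod_cast hY)⟩

theorem exists_le_card_layer_singleton {γ : ℝ} (hγ : 0 < γ) (hG : IsCoherent G γ γ) {t : ℕ}
    (ht : ⌈γ⌉₊ ≤ (t + 1) ^ k) {D : Finset V} (hD : γ ≤ #D)
    (hC : ∀ i < k, (t + 2) * ⌈γ⌉₊ ≤ #(C i)) (hDC : ∀ i < k, Disjoint D (C i))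
    (hCC : (Set.Iio k).PairwiseDisjoint C) : ∃ z ∈ D, γ ≤ #(layer G C {z} k) := by
  have key : ∀ j ≤ k, ∃ X ⊆ D, #X ≤ (t + 1) ^ (k - j) ∧ γ ≤ #(layer G C X j) := by
    intro j
    induction j with
    | zero =>
      intro _
      obtain ⟨X, hXD, hX⟩ := exists_subset_card_eq (Nat.ceil_le.2 hD)
      exact ⟨X, hXD, hX.trans_le ht, (Nat.le_ceil γ).trans_eq (congrArg Nat.cast hX.symm)⟩
    | succ j ih =>
      intro hj
      obtain ⟨X, hXD, hX, hlayer⟩ := ih (by omega)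
      have hdisj : Disjoint (layer G C X j) (C j) := by
        cases j with
        | zero => exact (hDC 0 hj).mono_left hXD
        | succ i => exact (hCC (Set.mem_Iio.2 (by omega)) (Set.mem_Iio.2 hj)
            i.lt_succ_self.ne).mono_left (covered_subset _ _ _)
      rw [show k - j = k - (j + 1) + 1 by omega, pow_succ'] at hX
      obtain ⟨Y, hYX, hY⟩ := exists_subset_le_card_layer_succ hG hX hlayer (hC j hj) hdisj
      exact ⟨Y, hYX.trans hXD, hY⟩
  obtain ⟨X, hXD, hX, hlayer⟩ := key k le_rfl
  rw [Nat.sub_self, pow_zero] at hX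
  rcases X.eq_empty_or_nonempty with rfl | hne
  · rw [layer_empty, card_empty, Nat.cast_zero] at hlayer
    exact absurd hlayer hγ.not_ge
  · obtain ⟨z, rfl⟩ := card_eq_one.1 (hX.antisymm hne.card_pos)
    exact ⟨z, hXD (mem_singleton_self z), hlayer⟩

end Reach

section ChainWalk

variable {V : Type*} {G : SimpleGraph V} {C C' : ℕ → Finset V} {X : Finset V} {i j k L : ℕ}
  {z u v : V} {q p : ℕ → V} {c : ℕ → ℕ}

/-- `q 0, …, q L` is a walk from `z` to `u` whose vertices after the first lie in sets `C (c a)` of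
increasing index less than `k`. -/
structure IsChainWalk (G : SimpleGraph V) (C : ℕ → Finset V) (k : ℕ) (z u : V) (L : ℕ)
    (q : ℕ → V) (c : ℕ → ℕ) : Prop where
  start : q 0 = z
  finish : q L = u
  adj : ∀ a < L, G.Adj (q a) (q (a + 1))
  mem_block : ∀ a ∈ Set.Ioc 0 L, q a ∈ C (c a)
  block_lt : ∀ a ∈ Set.Ioc 0 L, c a < k
  block_strictMonoOn : StrictMonoOn c (Set.Ioc 0 L)

namespace IsChainWalk

theorem length_le (h : IsChainWalk G C k z u L q c) : L ≤ k := by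
  simpa using card_le_card_of_injOn (s := Ioc 0 L) (t := range k) c
    (fun a ha => mem_range.2 (h.block_lt a (mem_Ioc.1 ha)))
    (by simpa only [coe_Ioc] using h.block_strictMonoOn.injOn)

theorem mono (h : IsChainWalk G C i z u L q c) (hij : i ≤ j) (hC : ∀ l < i, C l ⊆ C' l) :
    IsChainWalk G C' j z u L q c where
  start := h.start
  finish := h.finish
  adj := h.adj
  mem_block a ha := hC _ (h.block_lt a ha) (h.mem_block a ha)
  block_lt a ha := (h.block_lt a ha).trans_le hij
  block_strictMonoOn := h.block_strictMonoOn

theorem snoc (h : IsChainWalk G C i z u L q c) (hv : v ∈ C i) (huv : G.Adj u v) :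
    IsChainWalk G C (i + 1) z v (L + 1) (Function.update q (L + 1) v)
      (Function.update c (L + 1) i) := by
  have hsplit {a : ℕ} (ha : a ∈ Set.Ioc 0 (L + 1)) : a = L + 1 ∨ a ≠ L + 1 ∧ a ∈ Set.Ioc 0 L := by
    grind
  refine ⟨by simpa using h.start, by simp, fun a ha => ?_, fun a ha => ?_, fun a ha => ?_,
    fun a ha b hb hab => ?_⟩
  · rcases Nat.lt_succ_iff_lt_or_eq.1 ha with ha | rfl
    · simpa [ha.ne, (ha.trans L.lt_succ_self).ne] using h.adj a ha
    · simpa [h.finish] using huv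
  · rcases hsplit ha with rfl | ⟨hne, ha⟩
    · simpa using hv
    · simpa [hne] using h.mem_block a ha
  · rcases hsplit ha with rfl | ⟨hne, ha⟩
    · simp
    · simpa [hne] using (h.block_lt a ha).trans i.lt_succ_self
  · rcases hsplit ha with rfl | ⟨hane, ha⟩
    · exact absurd hb.2 hab.not_ge
    rcases hsplit hb with rfl | ⟨hbne, hb⟩
    · simpa [hane] using h.block_lt a ha
    · simpa [hane, hbne] using h.block_strictMonoOn ha hb hab

theorem injOn (h : IsChainWalk G C k z u L q c) (hC : (Set.Iio k).PairwiseDisjoint C)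
    (hz : ∀ i < k, z ∉ C i) : Set.InjOn q (Set.Iic L) := by
  have hne {a b : ℕ} (hab : a < b) (hb : b ≤ L) : q a ≠ q b := by
    intro he
    have hbL : b ∈ Set.Ioc 0 L := ⟨by omega, hb⟩
    have hqb := h.mem_block b hbL
    rcases a.eq_zero_or_pos with rfl | ha
    · exact hz _ (h.block_lt b hbL) (h.start ▸ he ▸ hqb)
    · have haL : a ∈ Set.Ioc 0 L := ⟨ha, by omega⟩
      exact disjoint_left.1 (hC (h.block_lt a haL) (h.block_lt b hbL)
        (h.block_strictMonoOn haL hbL hab).ne) (h.mem_block a haL) (he ▸ hqb)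
  intro a ha b hb he
  by_contra hab
  rcases lt_or_gt_of_ne hab with hab | hab
  · exact hne hab hb he
  · exact hne hab ha he.symm

theorem comp_strictMono (h : IsChainWalk G C k z u L q c) {r : ℕ} {s : ℕ → ℕ} (hs : StrictMono s)
    (hs0 : s 0 = 0) (hsr : s r = L) (hadj : ∀ a < r, G.Adj (q (s a)) (q (s (a + 1)))) :
    IsChainWalk G C k z u r (q ∘ s) (c ∘ s) := by
  have hmem {a : ℕ} (ha : a ∈ Set.Ioc 0 r) : s a ∈ Set.Ioc 0 L :=
    ⟨hs0 ▸ hs ha.1, hsr ▸ hs.monotone ha.2⟩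
  exact ⟨by simp [hs0, h.start], by simp [hsr, h.finish], hadj,
    fun a ha => h.mem_block _ (hmem ha), fun a ha => h.block_lt _ (hmem ha),
    fun a ha b hb hab => h.block_strictMonoOn (hmem ha) (hmem hb) (hs hab)⟩

end IsChainWalk

theorem exists_isChainWalk_of_mem_reach (hu : u ∈ reach G C {z} i) :
    ∃ L q c, IsChainWalk G C i z u L q c ∧ ∀ a ≤ L, q a ∈ reach G C {z} i := by
  induction i generalizing u with
  | zero =>
    obtain rfl := mem_singleton.1 hu
    exact ⟨0, fun _ => u, id, ⟨rfl, rfl, by simp, by simp, by simp,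
      fun _ ha => absurd ha.2 ha.1.not_ge⟩, fun _ _ => hu⟩
  | succ i ih =>
    rcases mem_reach_succ.1 hu with hu' | hu'
    · obtain ⟨L, q, c, h, hq⟩ := ih hu'
      exact ⟨L, q, c, h.mono i.le_succ fun _ _ => Subset.rfl,
        fun a ha => mem_reach_succ.2 (Or.inl (hq a ha))⟩
    · obtain ⟨huC, w, hw, hwu⟩ := mem_covered.1 hu'
      obtain ⟨L, q, c, h, hq⟩ := ih hw
      refine ⟨L + 1, _, _, h.snoc huC hwu, fun a ha => ?_⟩
      rcases ha.eq_or_lt with rfl | ha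
      · simpa using hu
      · simpa [ha.ne] using mem_reach_succ.2 (Or.inl (hq a (Nat.le_of_lt_succ ha)))

/-- `p 0, …, p r` is an induced path from `z` to `v` whose interior vertices lie in sets `C (c a)`
of increasing index less than `k`. -/
structure IsInducedChain (G : SimpleGraph V) (C : ℕ → Finset V) (k : ℕ) (z v : V) (r : ℕ)
    (p : ℕ → V) (c : ℕ → ℕ) : Prop where
  induced : IsInducedPath G p r
  start : p 0 = z
  finish : p r = v
  mem_block : ∀ a ∈ Set.Ioo 0 r, p a ∈ C (c a)
  block_lt : ∀ a ∈ Set.Ioo 0 r, c a < k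
  block_strictMonoOn : StrictMonoOn c (Set.Ioo 0 r)

theorem IsChainWalk.exists_isInducedChain (h : IsChainWalk G C k z u L q c)
    (hC : (Set.Iio k).PairwiseDisjoint C) (hz : ∀ i < k, z ∉ C i) (hvz : v ≠ z)
    (hv : ∀ i < k, v ∉ C i) (huv : G.Adj u v) :
    ∃ r p c, 0 < r ∧ r ≤ k + 1 ∧ IsInducedChain G C k z v r p c ∧
      ∀ a < r, ∃ b ≤ L, p a = q b := by
  let C' := Function.update C k {v}
  have hC'lt {i : ℕ} (hi : i < k) : C' i = C i := Function.update_of_ne hi.ne _ _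
  have hC'k : C' k = {v} := Function.update_self ..
  have hC' : (Set.Iio (k + 1)).PairwiseDisjoint C' := by
    rw [← Order.succ_eq_add_one, Order.Iio_succ_eq_insert, Set.pairwiseDisjoint_insert_of_notMem
      (by simp)]
    refine ⟨fun i hi j hj hij => ?_, fun i hi => ?_⟩
    · simpa only [Function.onFun, hC'lt hi, hC'lt hj] using hC hi hj hij
    · rw [hC'k, hC'lt hi, disjoint_singleton_left]
      exact hv i hi
  have hz' : ∀ i < k + 1, z ∉ C' i := by
    intro i hi
    rcases Nat.lt_succ_iff_lt_or_eq.1 hi with hi | rfl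
    · exact hC'lt hi ▸ hz i hi
    · simpa [hC'k] using hvz.symm
  have hwalk := (h.mono (C' := C') le_rfl fun i hi => (hC'lt hi).superset).snoc
    (hC'k ▸ mem_singleton_self v) huv
  obtain ⟨r, s, hr, hs0, hsr, hs, hpath⟩ :=
    exists_isInducedPath_subsequence _ _ (hwalk.injOn hC' hz') hwalk.adj
  have hp := hwalk.comp_strictMono hs hs0 hsr fun a ha => (hpath a (a + 1) (by omega) ha).2.2 rfl
  have hrpos : 0 < r := Nat.pos_of_ne_zero fun hr0 => by simp [hr0, hs0] at hsr
  have hlt {a : ℕ} (ha : a ∈ Set.Ioo 0 r) : (Function.update c (L + 1) k ∘ s) a < k :=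
    (hp.block_strictMonoOn (Set.Ioo_subset_Ioc_self ha) ⟨hrpos, le_rfl⟩ ha.2).trans_le
      (Nat.le_of_lt_succ (hp.block_lt r ⟨hrpos, le_rfl⟩))
  refine ⟨r, _, _, hrpos, hr.trans (Nat.succ_le_succ h.length_le),
    ⟨hpath, hp.start, hp.finish, fun a ha => hC'lt (hlt ha) ▸
      hp.mem_block a (Set.Ioo_subset_Ioc_self ha), fun a ha => hlt ha,
      hp.block_strictMonoOn.mono Set.Ioo_subset_Ioc_self⟩, fun a ha => ⟨s a, ?_, ?_⟩⟩
  · exact Nat.le_of_lt_succ ((hs ha).trans_eq hsr)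
  · exact Function.update_of_ne ((hs ha).trans_eq hsr).ne _ _

theorem exists_isInducedChain_of_mem_covered [DecidableEq V] (hj : j < k)
    (hz : ∀ i < k, z ∉ C i) (hC : (Set.Iio k).PairwiseDisjoint C) {T A : Finset V}
    (hT : T ⊆ layer G C {z} (j + 1)) (hv : v ∈ covered G (reach G C {z} j ∪ T) A) (hvz : v ≠ z)
    (hvC : ∀ i < k, v ∉ C i) :
    ∃ r p c, 0 < r ∧ r ≤ k + 1 ∧ IsInducedChain G C k z v r p c ∧
      ∀ a < r, p a ∈ reach G C {z} j ∪ T := by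
  obtain ⟨-, u, hu, huv⟩ := mem_covered.1 hv
  have hwalk : ∃ L q c, IsChainWalk G C k z u L q c ∧ ∀ b ≤ L, q b ∈ reach G C {z} j ∪ T := by
    rcases mem_union.1 hu with hu' | huT
    · obtain ⟨L, q, c, h, hq⟩ := exists_isChainWalk_of_mem_reach hu'
      exact ⟨L, q, c, h.mono hj.le fun _ _ => Subset.rfl, fun b hb => mem_union_left _ (hq b hb)⟩
    · obtain ⟨huC, w, hw, hwu⟩ := mem_covered.1 (hT huT)
      obtain ⟨L, q, c, h, hq⟩ := exists_isChainWalk_of_mem_reach hw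
      refine ⟨L + 1, _, _, (h.snoc huC hwu).mono hj fun _ _ => Subset.rfl, fun b hb => ?_⟩
      rcases hb.eq_or_lt with rfl | hb
      · simpa using hu
      · simpa [hb.ne] using Or.inl (hq b (Nat.le_of_lt_succ hb))
  obtain ⟨L, q, c, h, hq⟩ := hwalk
  obtain ⟨r, p, c, hr, hrk, hp, hpq⟩ := h.exists_isInducedChain hC hz hvz hvC huv
  refine ⟨r, p, c, hr, hrk, hp, fun a ha => ?_⟩
  obtain ⟨b, hb, hab⟩ := hpq a ha
  exact hab ▸ hq b hb

end ChainWalk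

section Hub

variable {V : Type*} {G : SimpleGraph V} {C : ℕ → Finset V} {z : V} {k : ℕ} {ι : Type*}
  {A : ι → Finset V}

theorem exists_card_le_mul_card_fiber {α β : Type*} [DecidableEq β] {s : Finset α} {t : Finset β}
    {f : α → β} (hf : ∀ a ∈ s, f a ∈ t) (ht : t.Nonempty) :
    ∃ y ∈ t, #s ≤ #t * #{x ∈ s | f x = y} := by
  by_contra! h
  have hsum := sum_lt_sum_of_nonempty ht h
  rw [← mul_sum, ← card_eq_sum_card_fiberwise hf, sum_const, smul_eq_mul] at hsum
  exact hsum.false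

theorem exists_subset_covered_quarter_half [DecidableEq V] {S L : Finset V}
    (hS : ∀ i, 4 * #(covered G S (A i)) < #(A i))
    (hSL : ∃ m, #(A m) ≤ 4 * #(covered G (S ∪ L) (A m)))
    (hL : ∀ t ∈ L, ∀ i, 8 * #(neighborsIn G t (A i)) ≤ #(A i)) :
    ∃ T ⊆ L, (∃ m, #(A m) ≤ 4 * #(covered G (S ∪ T) (A m))) ∧
      ∀ i, 2 * #(covered G (S ∪ T) (A i)) ≤ #(A i) := by
  induction L using Finset.induction with
  | empty =>
    obtain ⟨m, hm⟩ := hSL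
    rw [union_empty] at hm
    exact absurd (hS m) hm.not_gt
  | insert t L _ ih =>
    by_cases hhit : ∃ m, #(A m) ≤ 4 * #(covered G (S ∪ L) (A m))
    · obtain ⟨T, hTL, hT⟩ := ih hhit fun t ht => hL t (mem_insert_of_mem ht)
      exact ⟨T, hTL.trans (subset_insert t L), hT⟩
    · push Not at hhit
      refine ⟨insert t L, Subset.rfl, hSL, fun i => ?_⟩
      have hlt := hhit i
      have ht := hL t (mem_insert_self t L) i
      have hle := card_covered_insert_le G t (S ∪ L) (A i)
      rw [union_insert]
      omega

theorem exists_reach_union_covered [DecidableEq V] {γ : ℝ} (hγ : 0 < γ) (hG : IsCoherent G γ γ)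
    (hlayer : γ ≤ #(layer G C {z} k)) [Nonempty ι] (hA : ∀ i, 2 * γ ≤ #(A i))
    (hzA : ∀ i, z ∉ A i) (hCA : ∀ i, ∀ j < k, Disjoint (C j) (A i))
    (hlz : ∀ i, 8 * #(neighborsIn G z (A i)) ≤ #(A i))
    (hlC : ∀ j < k, ∀ u ∈ C j, ∀ i, 8 * #(neighborsIn G u (A i)) ≤ #(A i)) :
    ∃ j < k, ∃ T ⊆ layer G C {z} (j + 1),
      (∃ m, #(A m) ≤ 4 * #(covered G (reach G C {z} j ∪ T) (A m))) ∧
      ∀ i, 2 * #(covered G (reach G C {z} j ∪ T) (A i)) ≤ #(A i) := by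
  have hhitk : ∃ m, #(A m) ≤ 4 * #(covered G (reach G C {z} k) (A m)) := by
    obtain ⟨m⟩ := ‹Nonempty ι›
    have hdisj : Disjoint (reach G C {z} k) (A m) := by
      rw [disjoint_left]
      intro u hu
      obtain rfl | ⟨j, hj, huC⟩ := mem_reach_singleton hu
      · exact hzA m
      · exact disjoint_left.1 (hCA m j hj) huC
    have hlt := hG.card_lt_card_covered_add hdisj
      (hlayer.trans (mod_cast card_le_card (layer_subset_reach G C {z} k)))
    have hAm := hA m
    refine ⟨m, ?_⟩
    rify
    linarith
  have hnothit : ∀ i, 4 * #(covered G (reach G C {z} 0) (A i)) < #(A i) := by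
    intro i
    have hpos : 0 < #(A i) := by
      rify
      linarith [hA i]
    have hzi := hlz i
    rw [reach, covered_singleton]
    omega
  have hex : ∃ j, ∃ m, #(A m) ≤ 4 * #(covered G (reach G C {z} j) (A m)) := ⟨k, hhitk⟩
  classical
  obtain ⟨j, hj⟩ : ∃ j, Nat.find hex = j + 1 := Nat.exists_eq_add_one_of_ne_zero fun h0 => by
    obtain ⟨m, hm⟩ := h0 ▸ Nat.find_spec hex
    exact (hnothit m).not_ge hm
  have hjk : j + 1 ≤ k := hj ▸ Nat.find_min' hex hhitk
  obtain ⟨T, hT, hcov⟩ := exists_subset_covered_quarter_half (S := reach G C {z} j)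
    (L := layer G C {z} (j + 1)) (A := A)
    (by simpa only [not_exists, not_le] using Nat.find_min hex (m := j) (by omega))
    (by simpa only [hj, reach_succ] using Nat.find_spec hex)
    fun t ht => hlC j hjk t (covered_subset _ _ _ ht)
  exact ⟨j, hjk, T, hT, hcov⟩

theorem exists_hub {γ : ℝ} (hγ : 0 < γ) (hG : IsCoherent G γ γ) (hz : ∀ i < k, z ∉ C i)
    (hCC : (Set.Iio k).PairwiseDisjoint C) (hlayer : γ ≤ #(layer G C {z} k)) [Nonempty ι]
    (hA : ∀ i, 2 * γ ≤ #(A i)) (hzA : ∀ i, z ∉ A i) (hCA : ∀ i, ∀ j < k, Disjoint (C j) (A i))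
    (hlz : ∀ i, 8 * #(neighborsIn G z (A i)) ≤ #(A i))
    (hlC : ∀ j < k, ∀ u ∈ C j, ∀ i, 8 * #(neighborsIn G u (A i)) ≤ #(A i)) :
    ∃ (m : ι) (r : ℕ) (A' : ι → Finset V), 0 < r ∧ r ≤ k + 1 ∧ (∀ i, A' i ⊆ A i) ∧
      (∀ i ≠ m, #(A i) ≤ 2 * #(A' i)) ∧ #(A m) ≤ 4 * (k + 1) * #(A' m) ∧
      ∀ v ∈ A' m, ∃ p c, IsInducedChain G C k z v r p c ∧
        ∀ a < r, ∀ i ≠ m, ∀ u ∈ A' i, ¬ G.Adj (p a) u := by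
  classical
  obtain ⟨j, hjk, T, hT, ⟨m, hm⟩, hhalf⟩ :=
    exists_reach_union_covered hγ hG hlayer hA hzA hCA hlz hlC
  set X := reach G C {z} j ∪ T
  have hpath : ∀ v ∈ covered G X (A m), ∃ r p c, 0 < r ∧ r ≤ k + 1 ∧
      IsInducedChain G C k z v r p c ∧ ∀ a < r, p a ∈ X := fun v hv =>
    have hvA := covered_subset _ _ _ hv
    exists_isInducedChain_of_mem_covered hjk hz hCC hT hv (fun h => hzA m (h ▸ hvA))
      fun i hi hvC => disjoint_left.1 (hCA m i hi) hvC hvA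
  choose! len p c hlen_pos hlen_le hp hpX using hpath
  obtain ⟨r, hr, hfiber⟩ := exists_card_le_mul_card_fiber (s := covered G X (A m))
    (t := Icc 1 (k + 1)) (fun v hv => mem_Icc.2 ⟨hlen_pos v hv, hlen_le v hv⟩) ⟨1, by simp⟩
  rw [Nat.card_Icc, Nat.add_sub_cancel] at hfiber
  rw [mem_Icc] at hr
  refine ⟨m, r, Function.update (fun i => A i \ covered G X (A i)) m
    {v ∈ covered G X (A m) | len v = r}, hr.1, hr.2, fun i => ?_, fun i hi => ?_, ?_, ?_⟩
  · rcases eq_or_ne i m with rfl | hi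
    · simpa using (filter_subset _ _).trans (covered_subset G X (A i))
    · simp [hi]
  · have hsplit := card_sdiff_add_card_eq_card (covered_subset G X (A i))
    have hi2 := hhalf i
    rw [Function.update_of_ne hi]
    omega
  · rw [Function.update_self]
    calc #(A m) ≤ 4 * #(covered G X (A m)) := hm
      _ ≤ 4 * ((k + 1) * #{v ∈ covered G X (A m) | len v = r}) := Nat.mul_le_mul_left _ hfiber
      _ = 4 * (k + 1) * #{v ∈ covered G X (A m) | len v = r} := (mul_assoc ..).symm
  · intro v hv
    rw [Function.update_self, mem_filter] at hv
    obtain ⟨hv, rfl⟩ := hv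
    refine ⟨p v, c v, hp v hv, fun a ha i hi u hu hau => ?_⟩
    rw [Function.update_of_ne hi, mem_sdiff] at hu
    exact hu.2 (mem_covered.2 ⟨hu.1, p v a, hpX v hv a ha, hau⟩)

end Hub

section Cover

variable {V ι : Type*} {G : SimpleGraph V} {P : Finset ι} {Y : ι → Finset V} {A M : Finset V}

/-- The sum over `k ∈ P` of the proportion of `Y k` that `W` covers. -/
noncomputable def coverCost (G : SimpleGraph V) (P : Finset ι) (Y : ι → Finset V) (W : Finset V) :
    ℝ :=
  ∑ k ∈ P, (#(covered G W (Y k)) : ℝ) / #(Y k)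

theorem coverCost_nonneg (G : SimpleGraph V) (P : Finset ι) (Y : ι → Finset V) (W : Finset V) :
    0 ≤ coverCost G P Y W :=
  sum_nonneg fun _ _ => by positivity

theorem coverCost_insert_le [DecidableEq V] (G : SimpleGraph V) (P : Finset ι) (Y : ι → Finset V)
    (w : V) (W : Finset V) :
    coverCost G P Y (insert w W) ≤ coverCost G P Y W + coverCost G P Y {w} := by
  simp only [coverCost, ← sum_add_distrib, ← add_div, covered_singleton]
  gcongr
  exact_mod_cast (card_covered_insert_le G w W _).trans_eq (add_comm _ _)

theorem sum_coverCost_singleton_le {E : ℝ} (hE : 0 ≤ E)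
    (hup : ∀ k ∈ P, ∀ v ∈ Y k, (#(neighborsIn G v M) : ℝ) ≤ E) :
    ∑ w ∈ M, coverCost G P Y {w} ≤ #P * E := by
  simp only [coverCost, covered_singleton]
  rw [sum_comm, ← nsmul_eq_mul]
  refine sum_le_card_nsmul _ _ _ fun k hk => ?_
  rw [← sum_div]
  refine div_le_of_le_mul₀ (by positivity) hE ?_
  calc ∑ w ∈ M, (#(neighborsIn G w (Y k)) : ℝ) = ∑ v ∈ Y k, (#(neighborsIn G v M) : ℝ) := by
        exact_mod_cast sum_card_neighborsIn_comm G M (Y k)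
    _ ≤ E * #(Y k) := by
        simpa only [nsmul_eq_mul, mul_comm] using sum_le_card_nsmul _ _ _ (hup k hk)

theorem exists_mul_coverCost_lt_card_neighborsIn {U : Finset V} {β E : ℝ} (hβ : 0 ≤ β) (hE : 0 ≤ E)
    (hup : ∀ k ∈ P, ∀ v ∈ Y k, (#(neighborsIn G v M) : ℝ) ≤ E)
    (hU : β * (#P * E) < ∑ v ∈ U, (#(neighborsIn G v M) : ℝ)) :
    ∃ w ∈ M, β * coverCost G P Y {w} < #(neighborsIn G w U) := by
  refine exists_lt_of_sum_lt ?_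
  calc ∑ w ∈ M, β * coverCost G P Y {w} = β * ∑ w ∈ M, coverCost G P Y {w} := (mul_sum ..).symm
    _ ≤ β * (#P * E) := by gcongr; exact sum_coverCost_singleton_le hE hup
    _ < ∑ v ∈ U, (#(neighborsIn G v M) : ℝ) := hU
    _ = ∑ w ∈ M, (#(neighborsIn G w U) : ℝ) := by exact_mod_cast sum_card_neighborsIn_comm G U M

theorem card_covered_insert [DecidableEq V] (G : SimpleGraph V) (w : V) (W A : Finset V) :
    #(covered G (insert w W) A) = #(covered G W A) + #(neighborsIn G w (A \ covered G W A)) := by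
  rw [← card_union_of_disjoint (disjoint_sdiff.mono_right (neighborsIn_subset ..))]
  congr 1
  ext
  simp only [mem_covered, mem_union, mem_neighborsIn, mem_sdiff, mem_insert]
  grind

theorem exists_maximal_cover [DecidableEq V] {β : ℝ} (hβ : 0 ≤ β)
    (hcost : ∀ w ∈ M, coverCost G P Y {w} ≤ 1 / 8) :
    ∃ W ⊆ M, coverCost G P Y W ≤ 1 / 4 ∧ β * coverCost G P Y W ≤ #(covered G W A) ∧
      (1 / 8 ≤ coverCost G P Y W ∨
        ∀ w ∈ M, (#(neighborsIn G w (A \ covered G W A)) : ℝ) ≤ β * coverCost G P Y {w}) := by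
  classical
  obtain ⟨W, hW, hWmax⟩ := exists_max_image
    {W ∈ M.powerset | coverCost G P Y W ≤ 1 / 4 ∧ β * coverCost G P Y W ≤ #(covered G W A)} card
    ⟨∅, by simp [coverCost, covered_empty]⟩
  simp only [mem_filter, mem_powerset] at hW hWmax
  obtain ⟨hWM, hW4, hWβ⟩ := hW
  refine ⟨W, hWM, hW4, hWβ, or_iff_not_imp_left.2 fun hsmall w hw => ?_⟩
  by_contra! hgain
  have hle := coverCost_insert_le G P Y w W
  have hcard := card_covered_insert G w W A
  have hwW : w ∉ W := fun hwW => by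
    rw [insert_eq_of_mem hwW, left_eq_add] at hcard
    rw [hcard, Nat.cast_zero] at hgain
    exact hgain.not_ge (mul_nonneg hβ (coverCost_nonneg ..))
  have hmax := hWmax (insert w W) ⟨insert_subset hw hWM, by linarith [hcost w hw], by
    rw [hcard, Nat.cast_add]
    linarith [mul_le_mul_of_nonneg_left hle hβ]⟩
  rw [card_insert_of_notMem hwW] at hmax
  omega

/-- Any two subsets that make up at least the proportion `1 / C` of `A` and of `B` have average
degree at least `d` from the first to the second. -/
def IsLowerRegular (G : SimpleGraph V) (C d : ℝ) (A B : Finset V) : Prop :=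
  ∀ X ⊆ A, ∀ Y ⊆ B, (#A : ℝ) ≤ C * #X → (#B : ℝ) ≤ C * #Y →
    d * #X ≤ ∑ v ∈ X, (#(neighborsIn G v Y) : ℝ)

theorem IsLowerRegular.mono {A' B B' : Finset V} {a b C C' d : ℝ} (h : IsLowerRegular G C d A B)
    (hA : A' ⊆ A) (hB : B' ⊆ B) (hAa : (#A : ℝ) ≤ a * #A') (hBb : (#B : ℝ) ≤ b * #B')
    (ha : 0 ≤ a) (hb : 0 ≤ b) (haC : a * C' ≤ C) (hbC : b * C' ≤ C) :
    IsLowerRegular G C' d A' B' := by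
  refine fun X hX Y hY hXC hYC => h X (hX.trans hA) Y (hY.trans hB) ?_ ?_
  · calc (#A : ℝ) ≤ a * (C' * #X) := hAa.trans (by gcongr)
      _ ≤ C * #X := by rw [← mul_assoc]; gcongr
  · calc (#B : ℝ) ≤ b * (C' * #Y) := hBb.trans (by gcongr)
      _ ≤ C * #Y := by rw [← mul_assoc]; gcongr

theorem exists_cover {E ψ : ℝ} (hE : 0 < E) (hψ : 0 < ψ) (hψ1 : ψ ≤ 1) (hA : A.Nonempty)
    (hcost : ∀ w ∈ M, coverCost G P Y {w} ≤ 1 / 8)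
    (hup : ∀ k ∈ P, ∀ v ∈ Y k, (#(neighborsIn G v M) : ℝ) ≤ E)
    (hlow : IsLowerRegular G 2 (ψ * E / 2) A M) :
    ∃ W ⊆ M, coverCost G P Y W ≤ 1 / 4 ∧ ψ * #A ≤ 64 * (#P + 1) * #(covered G W A) := by
  classical
  obtain ⟨β, hβ, hβeq⟩ : ∃ β : ℝ, 0 < β ∧ ψ * #A = 8 * (#P + 1) * β :=
    ⟨ψ * #A / (8 * (#P + 1)), by positivity, by field_simp⟩
  obtain ⟨W, hWM, hW4, hWβ, hlarge | hmax⟩ := exists_maximal_cover (A := A) hβ.le hcost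
  all_goals refine ⟨W, hWM, hW4, ?_⟩
  · calc ψ * #A = 64 * (#P + 1) * (β * (1 / 8)) := by rw [hβeq]; ring
      _ ≤ 64 * (#P + 1) * #(covered G W A) := by gcongr; exact le_trans (by gcongr) hWβ
  have hhalf : (#A : ℝ) ≤ 2 * #(covered G W A) := by
    by_contra! hlt
    have hsplit : (#(A \ covered G W A) : ℝ) + #(covered G W A) = #A := by
      exact_mod_cast card_sdiff_add_card_eq_card (covered_subset G W A)
    have hU := hlow (A \ covered G W A) sdiff_subset M Subset.rfl (by linarith)
      (by linarith [Nat.cast_nonneg (α := ℝ) #M])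
    obtain ⟨w, hwM, hw⟩ := exists_mul_coverCost_lt_card_neighborsIn hβ.le hE.le hup <|
      calc β * (#P * E) < ψ * #A / 8 * E := by rw [hβeq]; nlinarith [mul_pos hβ hE]
        _ ≤ ψ * E / 2 * #(A \ covered G W A) := by nlinarith [mul_pos hψ hE]
        _ ≤ _ := hU
    exact (hmax w hwM).not_gt hw
  calc ψ * #A ≤ 1 * (2 * #(covered G W A)) := by gcongr
    _ ≤ 64 * (#P + 1) * #(covered G W A) := by
      rw [one_mul]
      gcongr
      linarith [Nat.cast_nonneg (α := ℝ) #P]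

end Cover

section Linkage

variable {V ι ι' : Type*} {G : SimpleGraph V} {lam R : ℝ} {B Y : ι → Finset V}

/-- Every vertex of a set `Y k` of the family has at most `lam * |Y l|` neighbours in every other
set `Y l`. -/
def HasLinkage (G : SimpleGraph V) (lam : ℝ) (Y : ι → Finset V) : Prop :=
  ∀ k l, k ≠ l → ∀ v ∈ Y k, (#(neighborsIn G v (Y l)) : ℝ) ≤ lam * #(Y l)

theorem HasLinkage.mono {lam' : ℝ} (h : HasLinkage G lam B) (hl : lam ≤ lam') :
    HasLinkage G lam' B := fun k l hkl v hv => (h k l hkl v hv).trans (by gcongr)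

theorem card_neighborsIn_le_of_subset {v : V} {S T : Finset V} (h : S ⊆ T) {x : ℝ}
    (hx : (#(neighborsIn G v T) : ℝ) ≤ x) : (#(neighborsIn G v S) : ℝ) ≤ x :=
  le_trans (mod_cast card_le_card (neighborsIn_mono G v h)) hx

theorem HasLinkage.shrink (h : HasLinkage G lam B) (φ : ι' ↪ ι) {B' : ι' → Finset V}
    (hsub : ∀ i, B' i ⊆ B (φ i)) (hlam : 0 ≤ lam) (hR : ∀ i, (#(B (φ i)) : ℝ) ≤ R * #(B' i)) :
    HasLinkage G (R * lam) B' := fun k l hkl v hv =>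
  card_neighborsIn_le_of_subset (hsub l) <|
    calc (#(neighborsIn G v (B (φ l))) : ℝ) ≤ lam * #(B (φ l)) :=
          h _ _ (φ.injective.ne hkl) v (hsub k hv)
      _ ≤ lam * (R * #(B' l)) := by gcongr; exact hR l
      _ = R * lam * #(B' l) := by ring

theorem mul_card_filter_lt_card_neighborsIn_le {S Z : Finset V} {μ d : ℝ} (hZ : Z.Nonempty)
    (h : ∀ z ∈ Z, (#(neighborsIn G z S) : ℝ) ≤ d) :
    μ * #{v ∈ S | μ * #Z < #(neighborsIn G v Z)} ≤ d := by
  have hZpos : (0 : ℝ) < #Z := mod_cast hZ.card_pos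
  refine le_of_mul_le_mul_right ?_ hZpos
  calc μ * #{v ∈ S | μ * #Z < #(neighborsIn G v Z)} * #Z
      = #{v ∈ S | μ * #Z < #(neighborsIn G v Z)} • (μ * #Z) := by rw [nsmul_eq_mul]; ring
    _ ≤ ∑ v ∈ S with μ * #Z < #(neighborsIn G v Z), (#(neighborsIn G v Z) : ℝ) :=
        card_nsmul_le_sum _ _ _ fun v hv => (mem_filter.1 hv).2.le
    _ ≤ ∑ v ∈ S, (#(neighborsIn G v Z) : ℝ) :=
        sum_le_sum_of_subset_of_nonneg (filter_subset _ _) fun _ _ _ => Nat.cast_nonneg _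
    _ = ∑ z ∈ Z, (#(neighborsIn G z S) : ℝ) := by exact_mod_cast sum_card_neighborsIn_comm G S Z
    _ ≤ d * #Z := by simpa only [nsmul_eq_mul, mul_comm] using sum_le_card_nsmul _ _ _ h

theorem HasLinkage.exists_subset_card_neighborsIn_le [Fintype ι'] (h : HasLinkage G lam B)
    (hlam : Fintype.card ι' * lam ≤ 1 / 16) {b : ι} {φ : ι' → ι} (hφ : ∀ i, φ i ≠ b)
    {B' : ι' → Finset V} (hB' : ∀ i, B' i ⊆ B (φ i)) (hne : ∀ i, (B' i).Nonempty) :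
    ∃ D ⊆ B b, #(B b) ≤ 2 * #D ∧ ∀ x ∈ D, ∀ i, 8 * #(neighborsIn G x (B' i)) ≤ #(B' i) := by
  classical
  let heavy (i : ι') : Finset V := {x ∈ B b | (1 / 8 : ℝ) * #(B' i) < #(neighborsIn G x (B' i))}
  have hheavy (i : ι') : (#(heavy i) : ℝ) ≤ 8 * (lam * #(B b)) := by
    linarith [mul_card_filter_lt_card_neighborsIn_le (μ := 1 / 8) (hne i)
      fun z hz => h (φ i) b (hφ i) z (hB' i hz)]
  have hsum : (2 * #(univ.biUnion heavy) : ℝ) ≤ #(B b) := by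
    have hbiUnion : (#(univ.biUnion heavy) : ℝ) ≤ ∑ i, (#(heavy i) : ℝ) := mod_cast card_biUnion_le
    have hcard := sum_le_card_nsmul univ (fun i => (#(heavy i) : ℝ)) _ fun i _ => hheavy i
    rw [card_univ, nsmul_eq_mul] at hcard
    have := mul_le_mul_of_nonneg_right hlam (Nat.cast_nonneg (α := ℝ) #(B b))
    linarith
  refine ⟨B b \ univ.biUnion heavy, sdiff_subset, ?_, fun x hx i => ?_⟩
  · have := card_le_card_sdiff_add_card (s := B b) (t := univ.biUnion heavy)
    have : 2 * #(univ.biUnion heavy) ≤ #(B b) := mod_cast hsum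
    omega
  · by_contra! hxi
    rw [mem_sdiff] at hx
    refine hx.2 (mem_biUnion.2 ⟨i, mem_univ _, mem_filter.2 ⟨hx.1, ?_⟩⟩)
    have : (#(B' i) : ℝ) < 8 * #(neighborsIn G x (B' i)) := mod_cast hxi
    linarith

theorem HasLinkage.exists_subset_of_shrink_one (h : HasLinkage G lam B) (hlam : 0 < lam) {i : ι}
    (hYB : ∀ k, Y k ⊆ B k) (hYi : (Y i).Nonempty)
    (hYk : ∀ k ≠ i, 3 * (#(B k) : ℝ) ≤ 4 * #(Y k)) :
    ∃ Y' : ι → Finset V, (∀ k, Y' k ⊆ Y k) ∧ Y' i = Y i ∧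
      (∀ k ≠ i, (#(B k) : ℝ) ≤ 2 * #(Y' k)) ∧ HasLinkage G (8 * lam) Y' := by
  classical
  let heavy (k : ι) : Finset V := {v ∈ B k | 8 * lam * #(Y i) < #(neighborsIn G v (Y i))}
  let Y' := Function.update (fun k => Y k \ heavy k) i (Y i)
  have hYi' : Y' i = Y i := Function.update_self ..
  have hYk' {k : ι} (hk : k ≠ i) : Y' k = Y k \ heavy k := Function.update_of_ne hk ..
  have hsub (k : ι) : Y' k ⊆ Y k := by
    rcases eq_or_ne k i with rfl | hk
    · exact hYi'.subset
    · exact hYk' hk ▸ sdiff_subset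
  have hhalf (k : ι) (hk : k ≠ i) : (#(B k) : ℝ) ≤ 2 * #(Y' k) := by
    have hheavy : 8 * lam * #(heavy k) ≤ lam * #(B k) :=
      mul_card_filter_lt_card_neighborsIn_le hYi fun z hz => h i k hk.symm z (hYB i hz)
    have hheavy' : 8 * (#(heavy k) : ℝ) ≤ #(B k) :=
      le_of_mul_le_mul_left (by linarith) hlam
    have hsplit : (#(Y k) : ℝ) ≤ #(Y k \ heavy k) + #(heavy k) := by
      exact_mod_cast card_le_card_sdiff_add_card
    rw [hYk' hk]
    linarith [hYk k hk]
  refine ⟨Y', hsub, hYi', hhalf, fun k l hkl v hv => ?_⟩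
  have hvB : v ∈ B k := hYB k (hsub k hv)
  rcases eq_or_ne l i with rfl | hl
  · rw [hYk' hkl, mem_sdiff, mem_filter, not_and, not_lt] at hv
    exact hYi'.symm ▸ hv.2 hvB
  · refine card_neighborsIn_le_of_subset ((hsub l).trans (hYB l)) ((h k l hkl v hvB).trans ?_)
    calc lam * #(B l) ≤ lam * (2 * #(Y' l)) := by gcongr; exact hhalf l hl
      _ ≤ 8 * lam * #(Y' l) := by nlinarith [Nat.cast_nonneg (α := ℝ) #(Y' l)]

end Linkage

section Hits

variable {V ι : Type*} [Fintype ι] {G : SimpleGraph V} {A Y : ι → Finset V} {m i : ι}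
  {E ψ lam : ℝ}

theorem HasLinkage.exists_cover (hlink : HasLinkage G lam Y) (hE : 0 < E) (hψ : 0 < ψ)
    (hψ1 : ψ ≤ 1) (hlam : 0 ≤ lam) (hY : ∀ k, (Y k).Nonempty)
    (hsmall : Fintype.card ι * lam ≤ 1 / 8)
    (hup : ∀ k ≠ m, ∀ v ∈ Y k, (#(neighborsIn G v (Y m)) : ℝ) ≤ E)
    (hlow : IsLowerRegular G 2 (ψ * E / 2) (Y i) (Y m)) :
    ∃ W ⊆ Y m, (∀ k ≠ i, k ≠ m → 4 * (#(covered G W (Y k)) : ℝ) ≤ #(Y k)) ∧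
      ψ * #(Y i) ≤ 64 * (Fintype.card ι + 1) * #(covered G W (Y i)) := by
  classical
  have hYpos (k : ι) : (0 : ℝ) < #(Y k) := mod_cast (hY k).card_pos
  let P : Finset ι := (univ.erase m).erase i
  have hmemP {k : ι} : k ∈ P ↔ k ≠ i ∧ k ≠ m := by simp [P]
  have hcost : ∀ w ∈ Y m, coverCost G P Y {w} ≤ 1 / 8 := fun w hw =>
    calc coverCost G P Y {w} ≤ #P • lam := sum_le_card_nsmul _ _ _ fun k hk => by
          rw [covered_singleton, div_le_iff₀ (hYpos k)]
          exact hlink m k (hmemP.1 hk).2.symm w hw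
      _ ≤ Fintype.card ι * lam := by rw [nsmul_eq_mul]; gcongr; exact card_le_univ P
      _ ≤ 1 / 8 := hsmall
  obtain ⟨W, hWM, hW4, hWi⟩ :=
    PurePairs.exists_cover hE hψ hψ1 (hY i) hcost (fun k hk => hup k (hmemP.1 hk).2) hlow
  refine ⟨W, hWM, fun k hki hkm => ?_, hWi.trans (by gcongr; exact card_le_univ P)⟩
  have hk := (single_le_sum (f := fun k => (#(covered G W (Y k)) : ℝ) / #(Y k))
    (fun _ _ => by positivity) (hmemP.2 ⟨hki, hkm⟩)).trans hW4
  rw [div_le_iff₀ (hYpos k)] at hk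
  linarith

theorem exists_hit (him : i ≠ m) (hE : 0 < E) (hψ : 0 < ψ) (hψ1 : ψ ≤ 1) (hlam : 0 < lam)
    (hY : ∀ k, (Y k).Nonempty) (hlink : HasLinkage G lam Y)
    (hsmall : Fintype.card ι * lam ≤ 1 / 8)
    (hup : ∀ k ≠ m, ∀ v ∈ Y k, (#(neighborsIn G v (Y m)) : ℝ) ≤ E)
    (hlow : IsLowerRegular G 2 (ψ * E / 2) (Y i) (Y m)) :
    ∃ Y' : ι → Finset V, (∀ k, Y' k ⊆ Y k) ∧ (∀ k ≠ i, (#(Y k) : ℝ) ≤ 2 * #(Y' k)) ∧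
      ψ * #(Y i) ≤ 64 * (Fintype.card ι + 1) * #(Y' i) ∧ HasLinkage G (8 * lam) Y' ∧
      ∀ v ∈ Y' i, ∃ w ∈ Y m, G.Adj w v ∧ ∀ j ≠ i, j ≠ m → ∀ u ∈ Y' j, ¬ G.Adj w u := by
  classical
  obtain ⟨W, hWM, hW4, hWi⟩ := hlink.exists_cover hE hψ hψ1 hlam.le hY hsmall hup hlow
  let Z : ι → Finset V := fun k =>
    if k = i then covered G W (Y i) else if k = m then Y m else Y k \ covered G W (Y k)
  have hZi : Z i = covered G W (Y i) := if_pos rfl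
  have hZk {k : ι} (hki : k ≠ i) (hkm : k ≠ m) : Z k = Y k \ covered G W (Y k) := by
    simp [Z, hki, hkm]
  have hZsub (k : ι) : Z k ⊆ Y k := by
    simp only [Z]
    split_ifs with hki hkm
    exacts [hki ▸ covered_subset .., hkm ▸ Subset.rfl, sdiff_subset]
  have hZcard (k : ι) (hki : k ≠ i) : 3 * (#(Y k) : ℝ) ≤ 4 * #(Z k) := by
    rcases eq_or_ne k m with rfl | hkm
    · simp only [Z, if_neg hki, if_true]
      gcongr
      norm_num
    · have hsplit : (#(Y k \ covered G W (Y k)) : ℝ) + #(covered G W (Y k)) = #(Y k) := by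
        exact_mod_cast card_sdiff_add_card_eq_card (covered_subset G W (Y k))
      rw [hZk hki hkm]
      linarith [hW4 k hki hkm]
  have hZne : (Z i).Nonempty := by
    rw [hZi, nonempty_iff_ne_empty]
    intro h0
    rw [h0, card_empty, Nat.cast_zero, mul_zero] at hWi
    exact hWi.not_gt (mul_pos hψ (mod_cast (hY i).card_pos))
  obtain ⟨Y', hY'Z, hY'i, hY'card, hY'link⟩ :=
    hlink.exists_subset_of_shrink_one hlam hZsub hZne hZcard
  refine ⟨Y', fun k => (hY'Z k).trans (hZsub k), hY'card, by rwa [hY'i, hZi], hY'link,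
    fun v hv => ?_⟩
  obtain ⟨-, w, hwW, hwv⟩ := mem_covered.1 (hZi ▸ hY'Z i hv)
  refine ⟨w, hWM hwW, hwv, fun j hji hjm u hu hwu => ?_⟩
  have huZ := hY'Z j hu
  rw [hZk hji hjm, mem_sdiff] at huZ
  exact huZ.2 (mem_covered.2 ⟨huZ.1, w, hwW, hwu⟩)

end Hits

section PrivateHits

variable {V ι : Type*} [Fintype ι] {G : SimpleGraph V} {A Y Y' : ι → Finset V}
  {m i : ι} {S : Finset ι} {E ψ lam : ℝ}

/-- The family `Y` arises from `A` by shrinking all sets so that every vertex of a set `Y i` with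
`i ∈ S` has a neighbour in `A m` with no neighbour in the other sets `Y j`. The sets `Y i` with
`i ∈ S` may shrink by a factor of order `1 / ψ`, the others only by a constant factor. -/
structure IsHitFamily (G : SimpleGraph V) (A : ι → Finset V) (m : ι) (ψ lam : ℝ) (S : Finset ι)
    (Y : ι → Finset V) : Prop where
  subset : ∀ k, Y k ⊆ A k
  card_le : ∀ k ∉ S, (#(A k) : ℝ) ≤ 2 ^ #S * #(Y k)
  mul_card_le : ∀ k ∈ S, ψ * #(A k) ≤ 2 ^ #S * (64 * (Fintype.card ι + 1)) * #(Y k)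
  hasLinkage : HasLinkage G (8 ^ #S * lam) Y
  hit : ∀ i ∈ S, ∀ v ∈ Y i, ∃ w ∈ A m, G.Adj w v ∧ ∀ j ≠ i, j ≠ m → ∀ u ∈ Y j, ¬ G.Adj w u

theorem isHitFamily_empty (hlink : HasLinkage G lam A) : IsHitFamily G A m ψ lam ∅ A where
  subset _ := Subset.rfl
  card_le := by simp
  mul_card_le := by simp
  hasLinkage := by simpa using hlink
  hit := by simp

theorem IsHitFamily.nonempty (h : IsHitFamily G A m ψ lam S Y) (hψ : 0 < ψ) {k : ι}
    (hA : (A k).Nonempty) : (Y k).Nonempty := by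
  have hApos : (0 : ℝ) < #(A k) := mod_cast hA.card_pos
  by_contra hk
  rw [not_nonempty_iff_eq_empty] at hk
  by_cases hkS : k ∈ S
  · have hYk := h.mul_card_le k hkS
    rw [hk, card_empty, Nat.cast_zero, mul_zero] at hYk
    exact hYk.not_gt (mul_pos hψ hApos)
  · have hYk := h.card_le k hkS
    rw [hk, card_empty, Nat.cast_zero, mul_zero] at hYk
    exact hYk.not_gt hApos

theorem IsHitFamily.insert [DecidableEq ι] (h : IsHitFamily G A m ψ lam S Y) (hψ : 0 < ψ)
    (hiS : i ∉ S) (hsub : ∀ k, Y' k ⊆ Y k) (hhalf : ∀ k ≠ i, (#(Y k) : ℝ) ≤ 2 * #(Y' k))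
    (hi : ψ * #(Y i) ≤ 64 * (Fintype.card ι + 1) * #(Y' i))
    (hlink : HasLinkage G (8 * (8 ^ #S * lam)) Y')
    (hhit : ∀ v ∈ Y' i, ∃ w ∈ Y m, G.Adj w v ∧ ∀ j ≠ i, j ≠ m → ∀ u ∈ Y' j, ¬ G.Adj w u) :
    IsHitFamily G A m ψ lam (insert i S) Y' where
  subset k := (hsub k).trans (h.subset k)
  card_le k hk := by
    rw [mem_insert, not_or] at hk
    rw [card_insert_of_notMem hiS, pow_succ, mul_assoc]
    exact (h.card_le k hk.2).trans (by gcongr; exact hhalf k hk.1)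
  mul_card_le k hk := by
    rw [card_insert_of_notMem hiS, pow_succ]
    rcases eq_or_ne k i with rfl | hki
    · calc ψ * #(A k) ≤ ψ * (2 ^ #S * #(Y k)) := by gcongr; exact h.card_le k hiS
        _ = 2 ^ #S * (ψ * #(Y k)) := by ring
        _ ≤ 2 ^ #S * (64 * (Fintype.card ι + 1) * #(Y' k)) := by gcongr
        _ ≤ 2 ^ #S * 2 * (64 * (Fintype.card ι + 1)) * #(Y' k) := by
            rw [mul_assoc (2 ^ #S * 2)]
            gcongr
            exact le_mul_of_one_le_right (by positivity) one_le_two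
    · calc ψ * #(A k) ≤ 2 ^ #S * (64 * (Fintype.card ι + 1)) * #(Y k) :=
            h.mul_card_le k (mem_of_mem_insert_of_ne hk hki)
        _ ≤ 2 ^ #S * (64 * (Fintype.card ι + 1)) * (2 * #(Y' k)) := by gcongr; exact hhalf k hki
        _ = 2 ^ #S * 2 * (64 * (Fintype.card ι + 1)) * #(Y' k) := by ring
  hasLinkage := by rwa [card_insert_of_notMem hiS, pow_succ', mul_assoc]
  hit k hk v hv := by
    rcases eq_or_ne k i with rfl | hki
    · obtain ⟨w, hw, hwv, hwn⟩ := hhit v hv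
      exact ⟨w, h.subset m hw, hwv, hwn⟩
    · obtain ⟨w, hw, hwv, hwn⟩ := h.hit k (mem_of_mem_insert_of_ne hk hki) v (hsub k hv)
      exact ⟨w, hw, hwv, fun j hj hjm u hu => hwn j hj hjm u (hsub j hu)⟩

theorem exists_isHitFamily (hE : 0 < E) (hψ : 0 < ψ) (hψ1 : ψ ≤ 1) (hlam : 0 < lam)
    (hA : ∀ k, (A k).Nonempty) (hlink : HasLinkage G lam A)
    (hsmall : Fintype.card ι * (8 ^ Fintype.card ι * lam) ≤ 1 / 8)
    (hup : ∀ k ≠ m, ∀ v ∈ A k, (#(neighborsIn G v (A m)) : ℝ) ≤ E)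
    (hlow : ∀ i ≠ m, IsLowerRegular G (2 ^ (Fintype.card ι + 1)) (ψ * E / 2) (A i) (A m))
    (hS : m ∉ S) : ∃ Y, IsHitFamily G A m ψ lam S Y := by
  classical
  induction S using Finset.induction_on with
  | empty => exact ⟨A, isHitFamily_empty hlink⟩
  | insert i S hiS ih =>
    obtain ⟨hmi, hmS⟩ : m ≠ i ∧ m ∉ S := by simpa using hS
    obtain ⟨Y, hY⟩ := ih hmS
    have hpow : (2 : ℝ) ^ #S * 2 ≤ 2 ^ (Fintype.card ι + 1) := by
      rw [← pow_succ]
      exact pow_le_pow_right₀ one_le_two (by gcongr; exact card_le_univ S)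
    obtain ⟨Y', hY'Y, hhalf, hi, hlink', hhit⟩ := exists_hit hmi.symm hE hψ hψ1 (by positivity)
      (fun k => hY.nonempty hψ (hA k)) hY.hasLinkage
      (hsmall.trans' (by gcongr; exacts [by norm_num, card_le_univ S]))
      (fun k hk v hv => card_neighborsIn_le_of_subset (hY.subset m)
        (hup k hk v (hY.subset k hv)))
      ((hlow i hmi.symm).mono (hY.subset i) (hY.subset m) (hY.card_le i hiS) (hY.card_le m hmS)
        (by positivity) (by positivity) hpow hpow)
    exact ⟨Y', hY.insert hψ hiS hY'Y hhalf hi hlink' hhit⟩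

end PrivateHits

section Regularity

variable {V : Type u} {G : SimpleGraph V}

theorem exists_card_neighborsIn_le_of_not_isLowerRegular {A B : Finset V} {C d : ℝ} (hC : 0 ≤ C)
    (h : ¬ IsLowerRegular G C (d / 2) A B) :
    ∃ A' ⊆ A, ∃ B' ⊆ B, (#A : ℝ) ≤ 2 * C * #A' ∧ (#B : ℝ) ≤ C * #B' ∧
      ∀ v ∈ A', (#(neighborsIn G v B') : ℝ) ≤ d := by
  classical
  simp only [IsLowerRegular, not_forall, not_le] at h
  obtain ⟨X, hXA, Y, hYB, hXC, hYC, hlt⟩ := h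
  have hd : 0 < d := by
    by_contra! hd
    have hsum : (0 : ℝ) ≤ ∑ v ∈ X, (#(neighborsIn G v Y) : ℝ) :=
      sum_nonneg fun _ _ => Nat.cast_nonneg _
    nlinarith [Nat.cast_nonneg (α := ℝ) #X]
  let A' : Finset V := {v ∈ X | (#(neighborsIn G v Y) : ℝ) ≤ d}
  refine ⟨A', (filter_subset _ _).trans hXA, Y, hYB, ?_, hYC, fun v hv => (mem_filter.1 hv).2⟩
  have hmarkov : #(X \ A') * d ≤ ∑ v ∈ X, (#(neighborsIn G v Y) : ℝ) := by
    rw [← nsmul_eq_mul]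
    refine (card_nsmul_le_sum _ (fun v => (#(neighborsIn G v Y) : ℝ)) _ fun v hv => ?_).trans
      (sum_le_sum_of_subset_of_nonneg sdiff_subset fun _ _ _ => Nat.cast_nonneg _)
    simp only [A', mem_sdiff, mem_filter, not_and, not_le] at hv
    exact (hv.2 hv.1).le
  have hsplit : (#(X \ A') : ℝ) + #A' = #X := by
    exact_mod_cast card_sdiff_add_card_eq_card (filter_subset _ _)
  have hhalf : (#X : ℝ) ≤ 2 * #A' := by
    have := lt_of_mul_lt_mul_right (show #(X \ A') * d < #X / 2 * d by linarith) hd.le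
    linarith
  calc (#A : ℝ) ≤ C * #X := hXC
    _ ≤ C * (2 * #A') := by gcongr
    _ = 2 * C * #A' := by ring

theorem exists_regular_pair {γ ψ C : ℝ} (hG : IsCoherent G γ γ) (hC : 1 ≤ C) (T : ℕ) (D : ℝ)
    {A B : Finset V} (hAB : Disjoint A B) (hA : (2 * C) ^ T * γ ≤ #A) (hB : C ^ T * γ ≤ #B)
    (hD : ∀ v ∈ A, (#(neighborsIn G v B) : ℝ) ≤ D) (hT : ψ ^ T * D < 1) :
    ∃ A' ⊆ A, ∃ B' ⊆ B, ∃ j < T, (#A : ℝ) ≤ (2 * C) ^ T * #A' ∧ (#B : ℝ) ≤ C ^ T * #B' ∧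
      (∀ v ∈ A', (#(neighborsIn G v B') : ℝ) ≤ ψ ^ j * D) ∧
      IsLowerRegular G C (ψ * (ψ ^ j * D) / 2) A' B' := by
  induction T generalizing D A B with
  | zero =>
    obtain ⟨a, ha, b, hb, hab⟩ := hG.exists_adj hAB (by simpa using hA) (by simpa using hB)
    have hpos : 0 < #(neighborsIn G a B) := card_pos.2 ⟨b, mem_neighborsIn.2 ⟨hb, hab⟩⟩
    have hone : (1 : ℝ) ≤ #(neighborsIn G a B) := mod_cast hpos
    rw [pow_zero, one_mul] at hT
    linarith [hD a ha]
  | succ T ih =>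
    by_cases hreg : IsLowerRegular G C (ψ * D / 2) A B
    · refine ⟨A, Subset.rfl, B, Subset.rfl, 0, T.succ_pos, ?_, ?_, by simpa using hD,
        by simpa using hreg⟩
      · exact le_mul_of_one_le_left (Nat.cast_nonneg _) (one_le_pow₀ (by linarith))
      · exact le_mul_of_one_le_left (Nat.cast_nonneg _) (one_le_pow₀ hC)
    obtain ⟨A₁, hA₁, B₁, hB₁, hA₁C, hB₁C, hdeg⟩ :=
      exists_card_neighborsIn_le_of_not_isLowerRegular (by linarith) hreg
    rw [pow_succ', mul_assoc] at hA hB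
    obtain ⟨A', hA', B', hB', j, hj, hA'C, hB'C, hdeg', hreg'⟩ := ih (ψ * D) (hAB.mono hA₁ hB₁)
      (le_of_mul_le_mul_left (hA.trans hA₁C) (by linarith))
      (le_of_mul_le_mul_left (hB.trans hB₁C) (by linarith)) hdeg (by rwa [← mul_assoc, ← pow_succ])
    rw [← mul_assoc (ψ ^ j) ψ D, ← pow_succ] at hreg' hdeg'
    refine ⟨A', hA'.trans hA₁, B', hB'.trans hB₁, j + 1, Nat.succ_lt_succ hj, ?_, ?_,
      hdeg', hreg'⟩
    · rw [pow_succ', mul_assoc]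
      exact hA₁C.trans (by gcongr)
    · rw [pow_succ', mul_assoc]
      exact hB₁C.trans (by gcongr)

theorem exists_regular_star {ι : Type*} (T : ℕ) (S : Finset ι) {C : ℝ} (hC : 1 ≤ C) :
    ∃ κ : ℝ, 0 < κ ∧ κ ≤ 1 ∧ ∀ {V : Type u} {G : SimpleGraph V} {γ ψ D : ℝ}, 0 ≤ γ →
      IsCoherent G γ γ → ψ ^ T * D < 1 → ∀ {A : ι → Finset V} {M : Finset V},
      (∀ i ∈ S, Disjoint (A i) M) → (∀ i ∈ S, γ ≤ κ * #(A i)) → γ ≤ κ * #M →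
      (∀ i ∈ S, ∀ v ∈ A i, (#(neighborsIn G v M) : ℝ) ≤ D) →
      ∃ (A' : ι → Finset V) (M' : Finset V) (j : ι → ℕ), (∀ i, A' i ⊆ A i) ∧ M' ⊆ M ∧
        κ * #M ≤ #M' ∧ ∀ i ∈ S, κ * #(A i) ≤ #(A' i) ∧ j i < T ∧
        (∀ v ∈ A' i, (#(neighborsIn G v M') : ℝ) ≤ ψ ^ j i * D) ∧
        IsLowerRegular G C (ψ * (ψ ^ j i * D) / 2) (A' i) M' := by
  classical
  induction S using Finset.induction_on with
  | empty =>
    refine ⟨1, one_pos, le_rfl, fun {V G γ ψ D} _ _ _ {A M} _ _ _ _ =>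
      ⟨A, M, fun _ => 0, fun _ => Subset.rfl, Subset.rfl, by simp, by simp⟩⟩
  | insert s S hs ih =>
    obtain ⟨κ, hκ, hκ1, hκS⟩ := ih
    have hCκ : C ≤ C / κ := le_div_self (by linarith) hκ hκ1
    obtain ⟨c, hc, hc1, hcC⟩ : ∃ c : ℝ, (2 * (C / κ)) ^ T = c ∧ 1 ≤ c ∧ (C / κ) ^ T ≤ c :=
      ⟨_, rfl, one_le_pow₀ (by linarith), by gcongr; linarith⟩
    have hκc : κ / c ≤ κ := div_le_self hκ.le hc1
    have hle {x y : ℝ} (hx : 0 ≤ x) (h : y ≤ κ / c * x) : c * y ≤ x :=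
      calc c * y ≤ c * (κ / c * x) := by gcongr
        _ = κ * x := by field_simp
        _ ≤ x := mul_le_of_le_one_left hx hκ1
    refine ⟨κ / c, by positivity, hκc.trans hκ1, fun {V G γ ψ D} hγ hG hT {A M} hd hA hM hD => ?_⟩
    simp only [forall_mem_insert] at hd hA hD
    obtain ⟨A₁, hA₁, M₁, hM₁, j₁, hj₁, hA₁c, hM₁c, hdeg₁, hreg₁⟩ :=
      exists_regular_pair hG (hC.trans hCκ) T D hd.1 (hc ▸ hle (Nat.cast_nonneg _) hA.1)
        ((by gcongr : _ ≤ c * γ).trans (hle (Nat.cast_nonneg _) hM)) hD.1 hT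
    rw [hc] at hA₁c
    have hMM₁ : κ / c * #M ≤ κ * #M₁ := by
      rw [div_mul_eq_mul_div, div_le_iff₀ (by positivity), mul_assoc, mul_comm _ c]
      gcongr
      exact hM₁c.trans (by gcongr)
    obtain ⟨A', M', j, hA', hM', hM'κ, hS⟩ := hκS hγ hG hT
      (fun i hi => (hd.2 i hi).mono_right hM₁) (fun i hi => (hA.2 i hi).trans (by gcongr))
      (hM.trans hMM₁) (fun i hi v hv => card_neighborsIn_le_of_subset hM₁ (hD.2 i hi v hv))
    refine ⟨Function.update A' s A₁, M', Function.update j s j₁, fun i => ?_, hM'.trans hM₁,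
      hMM₁.trans hM'κ, forall_mem_insert _ _ _ |>.2 ⟨?_, fun i hi => ?_⟩⟩
    · rcases eq_or_ne i s with rfl | his
      · rwa [Function.update_self]
      · exact Function.update_of_ne his A₁ A' ▸ hA' i
    · rw [Function.update_self, Function.update_self]
      refine ⟨?_, hj₁, fun v hv => card_neighborsIn_le_of_subset hM' (hdeg₁ v hv), ?_⟩
      · rw [div_mul_eq_mul_div, div_le_iff₀ (by positivity), mul_comm _ c]
        exact (mul_le_of_le_one_left (Nat.cast_nonneg _) hκ1).trans hA₁c
      · exact hreg₁.mono (a := 1) (b := 1 / κ) Subset.rfl hM' (by rw [one_mul])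
          (by rwa [one_div_mul_eq_div, le_div_iff₀' hκ]) zero_le_one (by positivity)
          (by rwa [one_mul]) (one_div_mul_eq_div κ C).le
    · have his : i ≠ s := ne_of_mem_of_not_mem hi hs
      rw [Function.update_of_ne his, Function.update_of_ne his]
      exact ⟨(by gcongr : κ / c * #(A i) ≤ κ * #(A i)).trans (hS i hi).1, (hS i hi).2⟩

theorem exists_uniform_regular_star {T : ℕ} (hT0 : 0 < T) (ι' : Type*) [Fintype ι'] {C : ℝ}
    (hC : 1 ≤ C) :
    ∃ κ : ℝ, 0 < κ ∧ κ ≤ 1 ∧ ∀ {V : Type u} {G : SimpleGraph V} {γ ψ D : ℝ}, 0 ≤ γ →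
      IsCoherent G γ γ → ψ ^ T * D < 1 →
      ∀ {A : Fin (T * Fintype.card ι') → Finset V} {M : Finset V},
      (∀ i, Disjoint (A i) M) → (∀ i, γ ≤ κ * #(A i)) → γ ≤ κ * #M →
      (∀ i, ∀ v ∈ A i, (#(neighborsIn G v M) : ℝ) ≤ D) →
      ∃ (g : ι' ↪ Fin (T * Fintype.card ι')) (A' : ι' → Finset V) (M' : Finset V) (j : ℕ),
        (∀ i, A' i ⊆ A (g i)) ∧ M' ⊆ M ∧ (∀ i, κ * #(A (g i)) ≤ #(A' i)) ∧ κ * #M ≤ #M' ∧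
        ∀ i, (∀ v ∈ A' i, (#(neighborsIn G v M') : ℝ) ≤ ψ ^ j * D) ∧
          IsLowerRegular G C (ψ * (ψ ^ j * D) / 2) (A' i) M' := by
  obtain ⟨κ, hκ, hκ1, hstar⟩ := exists_regular_star.{u} T
    (univ : Finset (Fin (T * Fintype.card ι'))) hC
  refine ⟨κ, hκ, hκ1, fun {V G γ ψ D} hγ hG hT {A M} hd hA hM hD => ?_⟩
  obtain ⟨A', M', j, hA', hM', hM'κ, hj⟩ := hstar hγ hG hT (fun i _ => hd i) (fun i _ => hA i) hM
    (fun i _ => hD i)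
  obtain ⟨y, -, hy⟩ := exists_card_le_mul_card_fiber (s := univ) (t := range T) (f := j)
    (fun i hi => mem_range.2 (hj i hi).2.1) ⟨0, mem_range.2 hT0⟩
  rw [card_univ, Fintype.card_fin, card_range] at hy
  obtain ⟨g⟩ : Nonempty (ι' ↪ {i // j i = y}) := Function.Embedding.nonempty_of_card_le <| by
    rw [Fintype.card_subtype]
    exact Nat.le_of_mul_le_mul_left hy hT0
  refine ⟨g.trans (.subtype _), fun i => A' (g i), M', y, fun i => hA' _, hM',
    fun i => (hj _ (mem_univ _)).1, hM'κ, fun i => ?_⟩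
  obtain ⟨-, -, hdeg, hreg⟩ := hj (g i) (mem_univ _)
  rw [(g i).2] at hdeg hreg
  exact ⟨hdeg, hreg⟩

end Regularity

section PrivateNeighbors

theorem exists_private_neighbors_of_isLowerRegular {V ι : Type*} [Fintype ι] {G : SimpleGraph V}
    {A : ι → Finset V} {M : Finset V} {E ψ lam : ℝ} (hE : 0 < E) (hψ : 0 < ψ) (hψ1 : ψ ≤ 1)
    (hlam : 0 < lam) (hA : ∀ i, (A i).Nonempty) (hM : M.Nonempty)
    (hlink : HasLinkage G lam fun o : Option ι => o.elim M A)
    (hsmall : (Fintype.card ι + 1) * (8 ^ (Fintype.card ι + 1) * lam) ≤ 1 / 8)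
    (hup : ∀ i, ∀ v ∈ A i, (#(neighborsIn G v M) : ℝ) ≤ E)
    (hlow : ∀ i, IsLowerRegular G (2 ^ (Fintype.card ι + 2)) (ψ * E / 2) (A i) M) :
    ∃ Y : ι → Finset V, (∀ i, Y i ⊆ A i) ∧
      (∀ i, ψ * #(A i) ≤ 2 ^ Fintype.card ι * (64 * (Fintype.card ι + 2)) * #(Y i)) ∧
      HasLinkage G (8 ^ Fintype.card ι * lam) Y ∧
      ∀ i, ∀ v ∈ Y i, ∃ w ∈ M, G.Adj w v ∧ ∀ j ≠ i, ∀ u ∈ Y j, ¬ G.Adj w u := by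
  obtain ⟨Y, hY⟩ := exists_isHitFamily (m := none) (S := univ.map Function.Embedding.some) hE hψ
    hψ1 hlam (Option.forall.2 ⟨hM, hA⟩) hlink (by simpa using hsmall)
    (Option.forall.2 ⟨fun h => absurd rfl h, fun i _ => hup i⟩)
    (Option.forall.2 ⟨fun h => absurd rfl h, fun i _ => by simpa using hlow i⟩) (by simp)
  have hcard : #((univ : Finset ι).map Function.Embedding.some) = Fintype.card ι := by
    rw [card_map, card_univ]
  refine ⟨fun i => Y (some i), fun i => hY.subset (some i), fun i => ?_, fun i j hij v hv => ?_,
    fun i v hv => ?_⟩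
  · have h := hY.mul_card_le (some i) (by simp)
    rw [hcard, Fintype.card_option] at h
    rwa [Nat.cast_add_one, add_assoc, one_add_one_eq_two] at h
  · simpa only [hcard] using hY.hasLinkage (some i) (some j) (by simpa using hij) v hv
  · obtain ⟨w, hw, hwv, hwY⟩ := hY.hit (some i) (by simp) v hv
    exact ⟨w, hw, hwv, fun j hj => hwY (some j) (by simpa using hj) (by simp)⟩

theorem exists_pos_mul_le_and_mul_le {a b x y : ℝ} (ha : 0 < a) (hb : 0 < b) (hx : 0 < x)
    (hy : 0 < y) : ∃ μ, 0 < μ ∧ a * μ ≤ x ∧ b * μ ≤ y :=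
  ⟨min (x / a) (y / b), by positivity, (le_div_iff₀' ha).1 (min_le_left _ _),
    (le_div_iff₀' hb).1 (min_le_right _ _)⟩

theorem exists_private_neighbors_of_hasLinkage {T : ℕ} (hT0 : 0 < T) (ι' : Type*) [Fintype ι']
    {lam' : ℝ} (hlam' : 0 < lam') :
    ∃ κ R lam : ℝ, 0 < κ ∧ 0 < R ∧ 0 < lam ∧
      ∀ {V : Type u} [Fintype V] {G : SimpleGraph V} {γ ψ : ℝ}, 0 < γ → IsCoherent G γ γ →
      0 < ψ → ψ ≤ 1 → ψ ^ T * Fintype.card V < 1 → ∀ {ι : Type} {B : ι → Finset V},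
      Pairwise (Function.onFun Disjoint B) → (∀ i, γ ≤ κ * #(B i)) → HasLinkage G lam B →
      ∀ {m : ι} {e : Fin (T * Fintype.card ι') ↪ ι}, (∀ i, e i ≠ m) →
      ∃ (g : ι' ↪ Fin (T * Fintype.card ι')) (B' : ι' → Finset V), (∀ i, B' i ⊆ B (e (g i))) ∧
        (∀ i, ψ * #(B (e (g i))) ≤ R * #(B' i)) ∧ HasLinkage G lam' B' ∧
        ∀ i, ∀ v ∈ B' i, ∃ w ∈ B m, G.Adj w v ∧ ∀ j ≠ i, ∀ u ∈ B' j, ¬ G.Adj w u := by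
  obtain ⟨κ, hκ, -, hstar⟩ := exists_uniform_regular_star.{u} hT0 ι'
    (C := 2 ^ (Fintype.card ι' + 2)) (one_le_pow₀ one_le_two)
  obtain ⟨q, hq⟩ : ∃ q, Fintype.card ι' = q := ⟨_, rfl⟩
  obtain ⟨μ, hμ, hμsmall, hμlam'⟩ := exists_pos_mul_le_and_mul_le
    (a := (q + 1) * 8 ^ (q + 1)) (b := 8 ^ q) (x := 1 / 8) (by positivity) (by positivity)
    (by positivity) hlam'
  refine ⟨κ, 2 ^ q * (64 * (q + 2)) / κ, κ * μ, hκ, by positivity, by positivity,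
    fun {V _ G γ ψ} hγ hG hψ hψ1 hψT {ι B} hB hwide hlink {m e} hem => ?_⟩
  have : Nonempty V := by
    have hBm : 0 < κ * #(B m) := hγ.trans_le (hwide m)
    obtain ⟨v, -⟩ := card_pos.1 (Nat.cast_pos.1 (pos_of_mul_pos_right hBm hκ.le))
    exact ⟨v⟩
  obtain ⟨g, A, M, j, hAB, hMB, hAcard, hMcard, hreg⟩ := hstar hγ.le hG hψT
    (A := fun i => B (e i)) (fun i => hB (hem i)) (fun i => hwide _) (hwide m)
    fun i v _ => mod_cast card_le_univ _
  let e' : Option ι' ↪ ι := (g.trans e).optionElim m <| by simpa using fun i => hem (g i)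
  have hlink' : HasLinkage G μ fun o : Option ι' => o.elim M A := by
    have := hlink.shrink (R := 1 / κ) e' (B' := fun o => o.elim M A)
      (Option.forall.2 ⟨hMB, hAB⟩) (by positivity)
      (Option.forall.2 ⟨by rwa [one_div_mul_eq_div, le_div_iff₀' hκ],
        fun i => by rw [one_div_mul_eq_div, le_div_iff₀' hκ]; exact hAcard i⟩)
    rwa [one_div, inv_mul_cancel_left₀ hκ.ne'] at this
  obtain ⟨Y, hYA, hYcard, hYlink, hYprivate⟩ := exists_private_neighbors_of_isLowerRegular
    (E := ψ ^ j * Fintype.card V) (by positivity) hψ hψ1 hμ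
    (fun i => card_pos.1 <| Nat.cast_pos.1 <| hγ.trans_le <| (hwide _).trans (hAcard i))
    (card_pos.1 <| Nat.cast_pos.1 <| hγ.trans_le <| (hwide m).trans hMcard) hlink'
    (by rwa [hq, ← mul_assoc]) (fun i => (hreg i).1) (fun i => (hreg i).2)
  rw [hq] at hYlink
  refine ⟨g, Y, fun i => (hYA i).trans (hAB i), fun i => ?_, hYlink.mono hμlam', fun i v hv => ?_⟩
  · have h := hYcard i
    rw [hq] at h
    rw [div_mul_eq_mul_div, le_div_iff₀ hκ]
    nlinarith [hAcard i]
  · obtain ⟨w, hw, hwY⟩ := hYprivate i v hv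
    exact ⟨w, hMB hw, hwY⟩

end PrivateNeighbors

section Blockades

variable {V ι ι' : Type*} [Fintype V] {G : SimpleGraph V} {σ σ' lam lam' : ℝ} {B : ι → Finset V}

/-- The family `B` is a blockade: its members are pairwise disjoint, have at least
`|G| ^ (1 - σ)` vertices, and have small degrees to each other. -/
structure IsBlockade (G : SimpleGraph V) (σ lam : ℝ) (B : ι → Finset V) : Prop where
  disjoint : Pairwise (Function.onFun Disjoint B)
  le_card : ∀ i, (Fintype.card V : ℝ) ^ (1 - σ) ≤ #(B i)
  hasLinkage : HasLinkage G lam B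

theorem IsBlockade.mono [Nonempty V] (h : IsBlockade G σ lam B) (hσ : σ ≤ σ') (hl : lam ≤ lam') :
    IsBlockade G σ' lam' B where
  disjoint := h.disjoint
  le_card i := (h.le_card i).trans' <| Real.rpow_le_rpow_of_exponent_le
    (mod_cast Fintype.card_pos) (by linarith)
  hasLinkage := h.hasLinkage.mono hl

theorem IsBlockade.shrink {R : ℝ} (h : IsBlockade G σ lam B) (φ : ι' ↪ ι)
    {B' : ι' → Finset V} (hsub : ∀ i, B' i ⊆ B (φ i)) (hlam : 0 ≤ lam) (hR0 : 0 < R)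
    (hR : ∀ i, (#(B (φ i)) : ℝ) ≤ R * #(B' i))
    (hσ : R * (Fintype.card V : ℝ) ^ (1 - σ') ≤ (Fintype.card V : ℝ) ^ (1 - σ)) :
    IsBlockade G σ' (R * lam) B' where
  disjoint _ _ hij := (h.disjoint (φ.injective.ne hij)).mono (hsub _) (hsub _)
  le_card i := le_of_mul_le_mul_left ((hσ.trans (h.le_card (φ i))).trans (hR i)) hR0
  hasLinkage := h.hasLinkage.shrink φ hsub hlam hR

/-- A finite graph together with a finite family of sets of vertices. -/
structure GraphWithFamily : Type (u + 1) where
  /-- The type of the vertices of the graph. -/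
  V : Type u
  [fintypeVertices : Fintype V]
  /-- The graph. -/
  G : SimpleGraph V
  /-- The index type of the family. -/
  ι : Type
  [fintypeIndices : Fintype ι]
  /-- The family. -/
  B : ι → Finset V

attribute [instance] GraphWithFamily.fintypeVertices GraphWithFamily.fintypeIndices

/-- The graph of `F` is large and coherent, and its family is a blockade with many, wide and
sparsely linked members; `K` governs all of these quantities. -/
structure IsGoodBlockade (c : ℝ) (K : ℕ) (F : GraphWithFamily.{u}) : Prop where
  lt_card_vertices : K < Fintype.card F.V
  le_card_indices : K ≤ Fintype.card F.ι
  isCoherent : IsCoherent F.G ((Fintype.card F.V : ℝ) ^ (1 - c)) ((Fintype.card F.V : ℝ) ^ (1 - c))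
  isBlockade : IsBlockade F.G (1 / (K + 1)) (1 / (K + 1)) F.B

theorem antitone_setOf_isGoodBlockade (c : ℝ) :
    Antitone fun K => {F : GraphWithFamily.{u} | IsGoodBlockade c K F} := fun K L hKL F h =>
  have hLK : (1 / (L + 1) : ℝ) ≤ 1 / (K + 1) := by gcongr
  have : Nonempty F.V := Fintype.card_pos_iff.1 (Nat.zero_lt_of_lt h.lt_card_vertices)
  ⟨hKL.trans_lt h.lt_card_vertices, hKL.trans h.le_card_indices, h.isCoherent,
    h.isBlockade.mono hLK hLK⟩

/-- The filter of good blockades in coherent graphs: a property holds eventually if it holds for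
all blockades with sufficiently many, sufficiently wide and sufficiently sparsely linked members
in all sufficiently large coherent graphs. -/
def goodBlockades (c : ℝ) : Filter GraphWithFamily.{u} :=
  ⨅ K : ℕ, 𝓟 {F | IsGoodBlockade c K F}

theorem hasAntitoneBasis_goodBlockades (c : ℝ) :
    (goodBlockades.{u} c).HasAntitoneBasis fun K => {F | IsGoodBlockade c K F} :=
  .iInf_principal (antitone_setOf_isGoodBlockade c)

variable {c : ℝ}

theorem eventually_goodBlockades_iff {P : GraphWithFamily.{u} → Prop} :
    (∀ᶠ F in goodBlockades c, P F) ↔ ∃ K, ∀ F, IsGoodBlockade c K F → P F := by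
  simpa using (hasAntitoneBasis_goodBlockades c).toHasBasis.eventually_iff

theorem tendsto_card_goodBlockades :
    Tendsto (fun F : GraphWithFamily.{u} => Fintype.card F.V) (goodBlockades c) atTop :=
  tendsto_atTop.2 fun K => eventually_goodBlockades_iff.2 ⟨K, fun _ h => h.lt_card_vertices.le⟩

theorem eventually_le_card_indices (K : ℕ) :
    ∀ᶠ F : GraphWithFamily.{u} in goodBlockades c, K ≤ Fintype.card F.ι :=
  eventually_goodBlockades_iff.2 ⟨K, fun _ h => h.le_card_indices⟩

theorem eventually_isCoherent : ∀ᶠ F : GraphWithFamily.{u} in goodBlockades c,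
    IsCoherent F.G ((Fintype.card F.V : ℝ) ^ (1 - c)) ((Fintype.card F.V : ℝ) ^ (1 - c)) :=
  eventually_goodBlockades_iff.2 ⟨0, fun _ h => h.isCoherent⟩

theorem eventually_isBlockade (hσ : 0 < σ) (hlam : 0 < lam) :
    ∀ᶠ F : GraphWithFamily.{u} in goodBlockades c, IsBlockade F.G σ lam F.B := by
  obtain ⟨K, hK⟩ := exists_nat_one_div_lt (lt_min hσ hlam)
  refine eventually_goodBlockades_iff.2 ⟨K, fun F h => ?_⟩
  have : Nonempty F.V := Fintype.card_pos_iff.1 (Nat.zero_lt_of_lt h.lt_card_vertices)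
  exact h.isBlockade.mono (hK.le.trans (min_le_left _ _)) (hK.le.trans (min_le_right _ _))

theorem exists_eventually_forall_isBlockade {P : GraphWithFamily.{u} → Prop}
    (h : ∀ᶠ F in goodBlockades c, P F) :
    ∃ (K : ℕ) (σ lam : ℝ), 0 < σ ∧ 0 < lam ∧ ∀ᶠ F : GraphWithFamily.{u} in goodBlockades c,
      ∀ (ι : Type) [Fintype ι] (B : ι → Finset F.V), K ≤ Fintype.card ι →
        IsBlockade F.G σ lam B → P ⟨F.V, F.G, ι, B⟩ := by
  obtain ⟨K, hK⟩ := eventually_goodBlockades_iff.1 h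
  refine ⟨K, 1 / (K + 1), 1 / (K + 1), by positivity, by positivity, ?_⟩
  filter_upwards [eventually_isCoherent, tendsto_card_goodBlockades.eventually_gt_atTop K]
    with F hG hN ι _ B hι hB
  exact hK _ ⟨hN, hι, hG, hB⟩

theorem eventually_mul_rpow_le {a b : ℝ} (hab : a < b) (C : ℝ) :
    ∀ᶠ n : ℕ in atTop, C * (n : ℝ) ^ a ≤ (n : ℝ) ^ b := by
  have hlarge : ∀ᶠ x : ℝ in atTop, C ≤ x ^ (b - a) :=
    (tendsto_rpow_atTop (sub_pos.2 hab)).eventually_ge_atTop C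
  filter_upwards [tendsto_natCast_atTop_atTop.eventually hlarge, eventually_gt_atTop 0]
    with n hn hn0
  calc C * (n : ℝ) ^ a ≤ (n : ℝ) ^ (b - a) * (n : ℝ) ^ a := by gcongr
    _ = (n : ℝ) ^ b := by rw [← Real.rpow_add (mod_cast hn0), sub_add_cancel]

theorem exists_embedding_forall_notMem [Fintype ι] (n : ℕ) (E : Finset ι)
    (h : n + #E ≤ Fintype.card ι) : ∃ e : Fin n ↪ ι, ∀ i, e i ∉ E := by
  classical
  have hcard : Fintype.card (Fin n) ≤ Fintype.card {i // i ∉ E} := by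
    rw [Fintype.card_subtype_compl, Fintype.card_fin, Fintype.card_coe]
    exact Nat.le_sub_of_add_le h
  obtain ⟨e⟩ := Function.Embedding.nonempty_of_card_le hcard
  exact ⟨e.trans (.subtype _), fun i => (e i).2⟩

theorem eventually_exists_private_neighbors (hc : 0 < c) (ι' : Type*) [Finite ι'] (hσ' : 0 < σ')
    (hlam' : 0 < lam') :
    ∀ᶠ F : GraphWithFamily.{u} in goodBlockades c, ∀ m b : F.ι,
      ∃ (φ : ι' ↪ F.ι) (B' : ι' → Finset F.V), (∀ i, B' i ⊆ F.B (φ i)) ∧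
        IsBlockade F.G σ' lam' B' ∧ (∀ i, φ i ≠ m ∧ φ i ≠ b) ∧
        ∀ i, ∀ v ∈ B' i, ∃ w ∈ F.B m, F.G.Adj w v ∧ ∀ j ≠ i, ∀ u ∈ B' j, ¬ F.G.Adj w u := by
  have := Fintype.ofFinite ι'
  obtain ⟨δ, hδ, hδc, hδσ'⟩ : ∃ δ, 0 < δ ∧ δ < c ∧ 2 * δ < σ' :=
    ⟨min (c / 2) (σ' / 4), by positivity, by linarith [min_le_left (c / 2) (σ' / 4)],
      by linarith [min_le_right (c / 2) (σ' / 4)]⟩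
  obtain ⟨T, hT⟩ := exists_nat_gt (1 / δ)
  have hT0 : 0 < T := Nat.cast_pos.1 ((one_div_pos.2 hδ).trans hT)
  rw [div_lt_iff₀ hδ] at hT
  obtain ⟨κ, R, lam, hκ, hR, hlam, hpriv⟩ :=
    exists_private_neighbors_of_hasLinkage.{u} hT0 ι' hlam'
  filter_upwards [eventually_isCoherent, eventually_isBlockade hδ hlam,
    eventually_le_card_indices (T * Fintype.card ι' + 2),
    tendsto_card_goodBlockades.eventually_gt_atTop 1,
    tendsto_card_goodBlockades.eventually
      (eventually_mul_rpow_le (by linarith : 1 - c < 1 - δ) (1 / κ)),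
    tendsto_card_goodBlockades.eventually
      (eventually_mul_rpow_le (by linarith : 1 - σ' < 1 - δ - δ) R)]
    with F hG hB hcard hN hwide hshrink m b
  classical
  have hN1 : (1 : ℝ) < Fintype.card F.V := mod_cast hN
  have hN0 : (0 : ℝ) < Fintype.card F.V := by linarith
  have hψT : ((Fintype.card F.V : ℝ) ^ (-δ)) ^ T * Fintype.card F.V < 1 := by
    rw [← Real.rpow_natCast, ← Real.rpow_mul hN0.le, ← Real.rpow_add_one hN0.ne']
    exact Real.rpow_lt_one_of_one_lt_of_neg hN1 (by linarith)
  obtain ⟨e, he⟩ := exists_embedding_forall_notMem (T * Fintype.card ι') {m, b}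
    (hcard.trans' (by gcongr; exact card_le_two))
  simp only [mem_insert, mem_singleton, not_or] at he
  obtain ⟨g, B', hB', hB'card, hlink, hB'priv⟩ := hpriv (by positivity) hG (by positivity)
    (Real.rpow_le_one_of_one_le_of_nonpos hN1.le (by linarith)) hψT hB.disjoint
    (fun i => (div_le_iff₀' hκ).1 <| by
      rw [← one_div_mul_eq_div]
      exact hwide.trans (hB.le_card i)) hB.hasLinkage (fun i => (he i).1)
  refine ⟨g.trans e, B', hB', ⟨fun i j hij => ?_, fun i => ?_, hlink⟩, fun i => he (g i), hB'priv⟩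
  · exact (hB.disjoint ((g.trans e).injective.ne hij)).mono (hB' i) (hB' j)
  · refine le_of_mul_le_mul_left (hshrink.trans ((hB'card i).trans' ?_)) hR
    calc (Fintype.card F.V : ℝ) ^ (1 - δ - δ)
        = (Fintype.card F.V : ℝ) ^ (-δ) * (Fintype.card F.V : ℝ) ^ (1 - δ) := by
          rw [← Real.rpow_add hN0]
          ring_nf
      _ ≤ _ := by gcongr; exact hB.le_card _

end Blockades

section ChainLength

theorem pos_of_one_lt_succ_mul {c : ℝ} {k : ℕ} (hk : 1 < (k + 1) * c) : 0 < c :=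
  pos_of_mul_pos_right (one_pos.trans hk) (by positivity)

theorem exists_chain_parameter {c : ℝ} (hc1 : c < 1) {k : ℕ} (hk : 1 < (k + 1) * c) :
    ∃ σ, 0 < σ ∧ σ < c ∧ ∀ᶠ n : ℕ in atTop, ∃ t : ℕ,
      ((t + 2) * ⌈(n : ℝ) ^ (1 - c)⌉₊ : ℝ) ≤ (n : ℝ) ^ (1 - σ) ∧
      ⌈(n : ℝ) ^ (1 - c)⌉₊ ≤ (t + 1) ^ k := by
  have hk0 : (0 : ℝ) < k := by
    rcases k.eq_zero_or_pos with rfl | h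
    · simp only [Nat.cast_zero, zero_add, one_mul] at hk
      linarith
    · exact_mod_cast h
  obtain ⟨τ, hτ0, hτc, hτk⟩ : ∃ τ, 0 < τ ∧ τ < c ∧ τ * k = 1 - c :=
    ⟨(1 - c) / k, div_pos (by linarith) hk0, by rw [div_lt_iff₀ hk0]; linarith,
      div_mul_cancel₀ _ hk0.ne'⟩
  refine ⟨(c - τ) / 2, by linarith, by linarith, ?_⟩
  filter_upwards [eventually_ge_atTop 1, eventually_mul_rpow_le
    (by linarith : τ + (1 - c) < 1 - (c - τ) / 2) 6] with n hn h
  have hn1 : (1 : ℝ) ≤ n := mod_cast hn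
  have hn0 : (0 : ℝ) < n := by linarith
  have ceil_le {x : ℝ} (hx : 0 ≤ x) : (⌈(n : ℝ) ^ x⌉₊ : ℝ) ≤ (n : ℝ) ^ x + 1 :=
    (Nat.ceil_lt_add_one (by positivity)).le
  obtain ⟨t, ht⟩ : ∃ t, ⌈(n : ℝ) ^ τ⌉₊ = t + 1 :=
    ⟨_, (Nat.sub_add_cancel (Nat.one_le_ceil_iff.2 (by positivity))).symm⟩
  have htτ : (t : ℝ) ≤ (n : ℝ) ^ τ := by
    have := ceil_le hτ0.le
    rw [ht] at this
    push_cast at this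
    linarith
  refine ⟨t, h.trans' ?_, Nat.ceil_le.2 ?_⟩
  · calc ((t : ℝ) + 2) * ⌈(n : ℝ) ^ (1 - c)⌉₊
        ≤ (3 * (n : ℝ) ^ τ) * (2 * (n : ℝ) ^ (1 - c)) := by
          gcongr
          · linarith [Real.one_le_rpow hn1 hτ0.le]
          · linarith [ceil_le (by linarith : 0 ≤ 1 - c),
              Real.one_le_rpow hn1 (by linarith : 0 ≤ 1 - c)]
      _ = 6 * (n : ℝ) ^ (τ + (1 - c)) := by rw [Real.rpow_add hn0]; ring
  · calc (n : ℝ) ^ (1 - c) = ((n : ℝ) ^ τ) ^ k := by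
          rw [← Real.rpow_natCast, ← Real.rpow_mul hn0.le, hτk]
      _ ≤ (⌈(n : ℝ) ^ τ⌉₊ : ℝ) ^ k := by gcongr; exact Nat.le_ceil _
      _ = ((t + 1) ^ k : ℕ) := by rw [ht]; push_cast; rfl

end ChainLength

section RainbowWalk

variable {V ι : Type*} {G : SimpleGraph V} {B : ι → Finset V} {x y z : V} {i j l : ι} {r s : ℕ}

/-- A walk of length `r` from `x` to `y` whose vertices lie in distinct members of the family `B`,
those of its ends being `B i` and `B j`; the values of `vertex` and `label` beyond `r` are
irrelevant. -/
structure RainbowWalk (G : SimpleGraph V) (B : ι → Finset V) (x y : V) (i j : ι) (r : ℕ) where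
  /-- The vertices of the walk. -/
  vertex : ℕ → V
  /-- The members of the family containing the vertices of the walk. -/
  label : ℕ → ι
  vertex_zero : vertex 0 = x
  vertex_length : vertex r = y
  label_zero : label 0 = i
  label_length : label r = j
  adj : ∀ a < r, G.Adj (vertex a) (vertex (a + 1))
  mem : ∀ a ≤ r, vertex a ∈ B (label a)
  injOn_label : Set.InjOn label (Set.Iic r)

/-- The sequence `p 0, …, p r` is an induced path, except that its ends may be adjacent. -/
def IsInducedUpToEnds (G : SimpleGraph V) (p : ℕ → V) (r : ℕ) : Prop :=
  ∀ a b, a < b → b ≤ r → (a = 0 → b ≠ r) → (G.Adj (p a) (p b) ↔ b = a + 1)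

namespace RainbowWalk

theorem start_mem (P : RainbowWalk G B x y i j r) : x ∈ B i := by
  simpa only [P.vertex_zero, P.label_zero] using P.mem 0 r.zero_le

theorem finish_mem (P : RainbowWalk G B x y i j r) : y ∈ B j := by
  simpa only [P.vertex_length, P.label_length] using P.mem r le_rfl

/-- The vertices of the walk other than its ends, together with their labels. -/
def interior (P : RainbowWalk G B x y i j r) : Set (V × ι) :=
  (fun a => (P.vertex a, P.label a)) '' Set.Ioo 0 r

theorem mem_interior (P : RainbowWalk G B x y i j r) {a : ℕ} (ha : a ∈ Set.Ioo 0 r) :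
    (P.vertex a, P.label a) ∈ P.interior :=
  Set.mem_image_of_mem _ ha

theorem injOn_vertex (P : RainbowWalk G B x y i j r) (hB : Pairwise (Function.onFun Disjoint B)) :
    Set.InjOn P.vertex (Set.Iic r) := fun a ha b hb hab =>
  P.injOn_label ha hb <| hB.eq fun h => disjoint_left.1 h (P.mem a ha) (hab ▸ P.mem b hb)

theorem isInducedPath (P : RainbowWalk G B x y i j r) (hB : Pairwise (Function.onFun Disjoint B))
    (hP : IsInducedUpToEnds G P.vertex r) (hxy : ¬ G.Adj x y) (hr : r ≠ 1) :
    IsInducedPath G P.vertex r := by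
  refine fun a b hab hb => ⟨(P.injOn_vertex hB).ne (hab.le.trans hb) hb hab.ne, ?_⟩
  by_cases hends : a = 0 ∧ b = r
  · obtain ⟨rfl, rfl⟩ := hends
    rw [P.vertex_zero, P.vertex_length]
    exact iff_of_false hxy hr
  · exact hP a b hab hb (not_and.1 hends)

theorem length_pos (P : RainbowWalk G B x y i j r) (hij : i ≠ j) : 0 < r :=
  Nat.pos_of_ne_zero fun h => hij (P.label_zero.symm.trans ((h ▸ P.label_length)))

/-- The inner vertices of the walk lie outside the members `B (φ l)` of the family `B`, and they
have no neighbours in the sets `B' l`, except possibly for the indices `l ∈ S`. -/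
def Avoids {ι' : Type*} (P : RainbowWalk G B x y i j r) (φ : ι' → ι) (B' : ι' → Finset V)
    (S : Set ι') : Prop :=
  ∀ u ∈ P.interior, (∀ l, u.2 ≠ φ l) ∧ ∀ l ∉ S, ∀ y ∈ B' l, ¬ G.Adj u.1 y

/-- The walk traversed backwards. -/
def reverse (P : RainbowWalk G B x y i j r) : RainbowWalk G B y x j i r where
  vertex a := P.vertex (r - a)
  label a := P.label (r - a)
  vertex_zero := P.vertex_length
  vertex_length := by rw [Nat.sub_self, P.vertex_zero]
  label_zero := P.label_length
  label_length := by rw [Nat.sub_self, P.label_zero]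
  adj a ha := by
    have h := P.adj (r - (a + 1)) (by omega)
    rw [show r - (a + 1) + 1 = r - a by omega] at h
    exact h.symm
  mem _ _ := P.mem _ (Nat.sub_le _ _)
  injOn_label a ha b hb hab := by
    have := P.injOn_label (Nat.sub_le r a) (Nat.sub_le r b) hab
    simp only [Set.mem_Iic] at ha hb
    omega

theorem interior_reverse (P : RainbowWalk G B x y i j r) : P.reverse.interior = P.interior := by
  ext u
  constructor <;> rintro ⟨a, ⟨ha, har⟩, rfl⟩
  · exact P.mem_interior ⟨Nat.sub_pos_of_lt har, Nat.sub_lt_self ha har.le⟩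
  · exact ⟨r - a, ⟨Nat.sub_pos_of_lt har, Nat.sub_lt_self ha har.le⟩, by
      simp [reverse, Nat.sub_sub_self har.le]⟩

theorem isInducedPath_reverse (P : RainbowWalk G B x y i j r) (hP : IsInducedPath G P.vertex r) :
    IsInducedPath G P.reverse.vertex r := fun a b hab hb => by
  have h := hP (r - b) (r - a) (by omega) (Nat.sub_le _ _)
  refine ⟨h.1.symm, (G.adj_comm _ _).trans (h.2.trans ?_)⟩
  omega

/-- The walk along an edge. -/
def ofAdj (hx : x ∈ B i) (hy : y ∈ B j) (hij : i ≠ j) (hxy : G.Adj x y) :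
    RainbowWalk G B x y i j 1 where
  vertex a := if a = 0 then x else y
  label a := if a = 0 then i else j
  vertex_zero := rfl
  vertex_length := rfl
  label_zero := rfl
  label_length := rfl
  adj a ha := by simpa [Nat.lt_one_iff.1 ha] using hxy
  mem a _ := by split_ifs <;> assumption
  injOn_label a ha b hb hab := by
    simp only [Set.mem_Iic] at ha hb
    grind

theorem interior_ofAdj (hx : x ∈ B i) (hy : y ∈ B j) (hij : i ≠ j) (hxy : G.Adj x y) :
    (ofAdj hx hy hij hxy).interior = ∅ := by
  simp [interior]

theorem isInducedPath_ofAdj (hx : x ∈ B i) (hy : y ∈ B j) (hij : i ≠ j) (hxy : G.Adj x y) :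
    IsInducedPath G (ofAdj hx hy hij hxy).vertex 1 := fun a b hab hb => by
  obtain ⟨rfl, rfl⟩ : a = 0 ∧ b = 1 := by omega
  exact ⟨hxy.ne, iff_of_true hxy rfl⟩

section Append

/-- Two walks can be concatenated to a rainbow walk if their labels are disjoint, except for that
of the common end. -/
structure Compatible (P : RainbowWalk G B x y i j r) (Q : RainbowWalk G B y z j l s) : Prop where
  ends : i ≠ l
  start : ∀ v ∈ Q.interior, v.2 ≠ i
  finish : ∀ u ∈ P.interior, u.2 ≠ l
  interiors : ∀ u ∈ P.interior, ∀ v ∈ Q.interior, u.2 ≠ v.2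

variable {P : RainbowWalk G B x y i j r} {Q : RainbowWalk G B y z j l s}

theorem Compatible.label_ne (h : Compatible P Q) {a b : ℕ} (ha : a < r) (hb : b ≤ s) :
    P.label a ≠ Q.label b := by
  rcases b.eq_zero_or_pos with rfl | hb0
  · refine fun hab => ha.ne (P.injOn_label ha.le Set.self_mem_Iic ?_)
    rw [hab, Q.label_zero, P.label_length]
  rcases a.eq_zero_or_pos with rfl | ha0 <;> rcases hb.lt_or_eq with hbs | rfl
  · rw [P.label_zero]
    exact (h.start _ (Q.mem_interior ⟨hb0, hbs⟩)).symm
  · rw [P.label_zero, Q.label_length]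
    exact h.ends
  · exact h.interiors _ (P.mem_interior ⟨ha0, ha⟩) _ (Q.mem_interior ⟨hb0, hbs⟩)
  · rw [Q.label_length]
    exact h.finish _ (P.mem_interior ⟨ha0, ha⟩)

variable (P Q) in
/-- The concatenation of two walks. -/
def append (h : Compatible P Q) : RainbowWalk G B x z i l (r + s) where
  vertex a := if a < r then P.vertex a else Q.vertex (a - r)
  label a := if a < r then P.label a else Q.label (a - r)
  vertex_zero := by
    rcases r.eq_zero_or_pos with rfl | hr
    · simp only [lt_irrefl, if_false, Nat.sub_zero, Q.vertex_zero]
      exact P.vertex_length.symm.trans P.vertex_zero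
    · simp only [hr, if_true, P.vertex_zero]
  vertex_length := by simp [Q.vertex_length]
  label_zero := by
    rcases r.eq_zero_or_pos with rfl | hr
    · simp only [lt_irrefl, if_false, Nat.sub_zero, Q.label_zero]
      exact P.label_length.symm.trans P.label_zero
    · simp only [hr, if_true, P.label_zero]
  label_length := by simp [Q.label_length]
  adj a ha := by
    rcases lt_trichotomy (a + 1) r with h | rfl | h
    · simpa [h, (Nat.lt_succ_self a).trans h] using P.adj a (by omega)
    · simpa [Q.vertex_zero, P.vertex_length] using P.adj a (by omega)
    · simpa [show ¬ a < r by omega, h.not_gt, show a + 1 - r = a - r + 1 by omega]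
        using Q.adj (a - r) (by omega)
  mem a ha := by
    split_ifs with h
    · exact P.mem a h.le
    · exact Q.mem (a - r) (by omega)
  injOn_label a ha b hb hab := by
    simp only [Set.mem_Iic] at ha hb
    dsimp only at hab
    split_ifs at hab with har hbr hbr
    · exact P.injOn_label har.le hbr.le hab
    · exact absurd hab (h.label_ne har (by omega))
    · exact absurd hab.symm (h.label_ne hbr (by omega))
    · have := Q.injOn_label (show a - r ≤ s by omega) (show b - r ≤ s by omega) hab
      omega

theorem interior_append_subset (h : Compatible P Q) :
    (P.append Q h).interior ⊆ insert (y, j) (P.interior ∪ Q.interior) := by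
  rintro _ ⟨a, ⟨ha, har⟩, rfl⟩
  rcases lt_trichotomy a r with h | rfl | h
  · simpa [append, h] using .inr (.inl (P.mem_interior ⟨ha, h⟩))
  · simp [append, Q.vertex_zero, Q.label_zero]
  · simpa [append, h.not_gt] using .inr (.inr (Q.mem_interior ⟨by omega, by omega⟩))

theorem exists_append_reverse (P : RainbowWalk G B y x j i r) (Q : RainbowWalk G B y z j l s)
    (hil : i ≠ l) (hQ : ∀ v ∈ Q.interior, v.2 ≠ i) (hP : ∀ u ∈ P.interior, u.2 ≠ l)
    (hPQ : ∀ u ∈ P.interior, ∀ v ∈ Q.interior, u.2 ≠ v.2) :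
    ∃ R : RainbowWalk G B x z i l (r + s),
      R.interior ⊆ insert (y, j) (P.interior ∪ Q.interior) := by
  rw [← P.interior_reverse] at hP hPQ ⊢
  exact ⟨_, interior_append_subset ⟨hil, hQ, hP, hPQ⟩⟩

theorem isInducedUpToEnds_append (h : Compatible P Q) (hP : IsInducedPath G P.vertex r)
    (hQ : IsInducedPath G Q.vertex s) (hstart : ∀ v ∈ Q.interior, ¬ G.Adj x v.1)
    (hfinish : ∀ u ∈ P.interior, ¬ G.Adj u.1 z)
    (hinteriors : ∀ u ∈ P.interior, ∀ v ∈ Q.interior, ¬ G.Adj u.1 v.1) :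
    IsInducedUpToEnds G (P.append Q h).vertex (r + s) := by
  intro a b hab hb hends
  by_cases hbr : b < r
  · simpa [append, hbr, hab.trans hbr] using (hP a b hab hbr.le).2
  by_cases har : a < r
  · rcases (not_lt.1 hbr).eq_or_lt with rfl | hrb
    · simpa [append, har, Q.vertex_zero, P.vertex_length] using (hP a r har le_rfl).2
    · have hcross : ¬ G.Adj (P.vertex a) (Q.vertex (b - r)) := by
        rcases a.eq_zero_or_pos with rfl | ha0 <;> rcases hb.lt_or_eq with hbs | rfl
        · rw [P.vertex_zero]
          exact hstart _ (Q.mem_interior ⟨by omega, by omega⟩)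
        · exact absurd rfl (hends rfl)
        · exact hinteriors _ (P.mem_interior ⟨ha0, har⟩) _ (Q.mem_interior ⟨by omega, by omega⟩)
        · rw [Nat.add_sub_cancel_left, Q.vertex_length]
          exact hfinish _ (P.mem_interior ⟨ha0, har⟩)
      simpa [append, har, hbr, hcross] using (by omega : b ≠ a + 1)
  · have h := (hQ (a - r) (b - r) (by omega) (by omega)).2
    simp only [append, har, hbr, if_false, h]
    omega

end Append

theorem exists_isInducedPath (P : RainbowWalk G B x y i j r)
    (hB : Pairwise (Function.onFun Disjoint B)) :
    ∃ s ≤ r, ∃ Q : RainbowWalk G B x y i j s,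
      IsInducedPath G Q.vertex s ∧ Q.interior ⊆ P.interior := by
  obtain ⟨s, f, hs, hf0, hfs, hf, hind⟩ :=
    exists_isInducedPath_subsequence P.vertex r (P.injOn_vertex hB) P.adj
  have hfr {a : ℕ} (ha : a ≤ s) : f a ≤ r := hfs ▸ hf.monotone ha
  refine ⟨s, hs, ⟨P.vertex ∘ f, P.label ∘ f, by simp [hf0, P.vertex_zero],
    by simp [hfs, P.vertex_length], by simp [hf0, P.label_zero], by simp [hfs, P.label_length],
    fun a ha => (hind a (a + 1) a.lt_succ_self ha).2.2 rfl, fun a ha => P.mem _ (hfr ha),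
    P.injOn_label.comp hf.injective.injOn fun a ha => hfr ha⟩, hind, ?_⟩
  rintro _ ⟨a, ⟨ha0, has⟩, rfl⟩
  exact P.mem_interior ⟨hf0 ▸ hf ha0, hfs ▸ hf has⟩

theorem exists_isInducedPath_of_adj (P : RainbowWalk G B x y i j r)
    (hB : Pairwise (Function.onFun Disjoint B)) (hyz : G.Adj y z) (hz : z ∈ B l) (hil : i ≠ l)
    (hjl : j ≠ l) (hP : ∀ u ∈ P.interior, u.2 ≠ l) :
    ∃ s ≤ r + 1, ∃ Q : RainbowWalk G B x z i l s,
      IsInducedPath G Q.vertex s ∧ Q.interior ⊆ insert (y, j) P.interior := by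
  have hcompat : Compatible P (ofAdj P.finish_mem hz hjl hyz) :=
    ⟨hil, by simp [interior_ofAdj], hP, by simp [interior_ofAdj]⟩
  obtain ⟨s, hs, Q, hQ, hQP⟩ := (P.append _ hcompat).exists_isInducedPath hB
  refine ⟨s, hs, Q, hQ, hQP.trans ((interior_append_subset hcompat).trans ?_)⟩
  simp [interior_ofAdj]

theorem exists_isInducedPath_append_adj (P : RainbowWalk G B x y i j r)
    (hB : Pairwise (Function.onFun Disjoint B)) (hP : IsInducedPath G P.vertex r) (hij : i ≠ j)
    (hz : z ∈ B l) (hil : i ≠ l) (hjl : j ≠ l) (hPl : ∀ u ∈ P.interior, u.2 ≠ l)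
    (hyz : G.Adj y z) (hPz : ∀ u ∈ insert (x, i) P.interior, ¬ G.Adj u.1 z) :
    ∃ Q : RainbowWalk G B x z i l (r + 1),
      IsInducedPath G Q.vertex (r + 1) ∧ Q.interior ⊆ insert (y, j) P.interior := by
  have hcompat : Compatible P (ofAdj P.finish_mem hz hjl hyz) :=
    ⟨hil, by simp [interior_ofAdj], hPl, by simp [interior_ofAdj]⟩
  refine ⟨P.append _ hcompat, isInducedPath _ hB (isInducedUpToEnds_append hcompat hP
    (isInducedPath_ofAdj _ _ _ _) (by simp [interior_ofAdj]) (fun u hu => hPz u (.inr hu))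
    (by simp [interior_ofAdj])) (hPz _ (.inl rfl)) (by simpa using (P.length_pos hij).ne'),
    (interior_append_subset hcompat).trans ?_⟩
  simp [interior_ofAdj]

end RainbowWalk

theorem IsInducedChain.exists_rainbowWalk {k : ℕ} {C : ℕ → Finset V} {ε : ℕ → ι} {p : ℕ → V}
    {c : ℕ → ℕ} (h : IsInducedChain G C k x y r p c) (hr : 0 < r) (hCB : ∀ a < k, C a ⊆ B (ε a))
    (hε : Set.InjOn ε (Set.Iio k)) (hx : x ∈ B i) (hy : y ∈ B j) (hij : i ≠ j)
    (hi : ∀ a < k, ε a ≠ i) (hj : ∀ a < k, ε a ≠ j) :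
    ∃ P : RainbowWalk G B x y i j r, P.vertex = p ∧
      ∀ u ∈ P.interior, ∃ a < k, u.1 ∈ C a ∧ ε a = u.2 := by
  let d : ℕ → ι := fun a => if a = 0 then i else if a = r then j else ε (c a)
  have hd {a : ℕ} (ha : a ∈ Set.Ioo 0 r) : d a = ε (c a) := by
    simp [d, ha.1.ne', ha.2.ne]
  have hd0 : d 0 = i := by simp [d]
  have hdr : d r = j := by simp [d, hr.ne']
  have hcases {a : ℕ} (ha : a ≤ r) : a = 0 ∨ a = r ∨ a ∈ Set.Ioo 0 r := by
    rw [Set.mem_Ioo]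
    omega
  refine ⟨⟨p, d, h.start, h.finish, hd0, hdr, fun a ha => (h.induced a (a + 1) a.lt_succ_self
    ha).2.2 rfl, fun a ha => ?_, fun a ha b hb hab => ?_⟩, rfl, ?_⟩
  · rcases hcases ha with rfl | rfl | ha
    · rwa [hd0, h.start]
    · rwa [hdr, h.finish]
    · rw [hd ha]
      exact hCB _ (h.block_lt a ha) (h.mem_block a ha)
  · have hki {a : ℕ} (ha : a ∈ Set.Ioo 0 r) : d a ≠ i := hd ha ▸ hi _ (h.block_lt a ha)
    have hkj {a : ℕ} (ha : a ∈ Set.Ioo 0 r) : d a ≠ j := hd ha ▸ hj _ (h.block_lt a ha)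
    have hinner {a b : ℕ} (ha : a ∈ Set.Ioo 0 r) (hb : b ∈ Set.Ioo 0 r) (hab : d a = d b) :
        a = b := by
      rw [hd ha, hd hb] at hab
      exact h.block_strictMonoOn.injOn ha hb (hε (h.block_lt a ha) (h.block_lt b hb) hab)
    rcases hcases ha with rfl | rfl | ha <;> rcases hcases hb with rfl | rfl | hb <;> grind
  · rintro _ ⟨a, ha, rfl⟩
    exact ⟨c a, h.block_lt a ha, h.mem_block a ha, (hd ha).symm⟩

end RainbowWalk

section HubWalks

variable {V : Type*} {G : SimpleGraph V} {γ : ℝ} {k t : ℕ} {ι κ : Type*} {B : ι → Finset V}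

theorem exists_hub_walks (hγ : 0 < γ) (hG : IsCoherent G γ γ)
    (hB : Pairwise (Function.onFun Disjoint B)) {ε : ℕ → ι} (hε : Set.InjOn ε (Set.Iio k))
    {C : ℕ → Finset V} (hCB : ∀ a < k, C a ⊆ B (ε a)) {i₀ : ι} (hi₀ : ∀ a < k, ε a ≠ i₀)
    {z : V} (hz : z ∈ B i₀) (hlayer : γ ≤ #(layer G C {z} k)) [Nonempty κ] {g : κ → ι}
    (hgi₀ : ∀ i, i₀ ≠ g i) (hg : ∀ i, ∀ a < k, ε a ≠ g i) {A : κ → Finset V}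
    (hAB : ∀ i, A i ⊆ B (g i)) (hA : ∀ i, 2 * γ ≤ #(A i))
    (hlz : ∀ i, 8 * #(neighborsIn G z (A i)) ≤ #(A i))
    (hlC : ∀ a < k, ∀ u ∈ C a, ∀ i, 8 * #(neighborsIn G u (A i)) ≤ #(A i)) :
    ∃ (m : κ) (r : ℕ) (A' : κ → Finset V), 0 < r ∧ r ≤ k + 1 ∧ (∀ i, A' i ⊆ A i) ∧
      (∀ i ≠ m, #(A i) ≤ 2 * #(A' i)) ∧ #(A m) ≤ 4 * (k + 1) * #(A' m) ∧
      ∀ v ∈ A' m, ∃ P : RainbowWalk G B z v i₀ (g m) r, IsInducedPath G P.vertex r ∧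
        (∀ u ∈ P.interior, ∃ a < k, u.1 ∈ C a ∧ ε a = u.2) ∧
        ∀ u ∈ insert (z, i₀) P.interior, ∀ i ≠ m, ∀ x ∈ A' i, ¬ G.Adj u.1 x := by
  have hdisj {i j : ι} (hij : i ≠ j) {X : Finset V} (hX : X ⊆ B j) : Disjoint (B i) X :=
    (hB hij).mono_right hX
  obtain ⟨m, r, A', hr0, hrk, hA', hhalf, hm, hpath⟩ := exists_hub (C := C) hγ hG
    (fun a ha => disjoint_left.1 (hdisj (hi₀ a ha).symm (hCB a ha)) hz)
    (fun a ha b hb hab => (hB (hε.ne ha hb hab)).mono (hCB a ha) (hCB b hb)) hlayer hA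
    (fun i => disjoint_left.1 (hdisj (hgi₀ i) (hAB i)) hz)
    (fun i a ha => (hdisj (hg i a ha) (hAB i)).mono_left (hCB a ha)) hlz hlC
  refine ⟨m, r, A', hr0, hrk, hA', hhalf, hm, fun v hv => ?_⟩
  obtain ⟨p, c, hp, hpA'⟩ := hpath v hv
  obtain ⟨P, rfl, hP⟩ := hp.exists_rainbowWalk hr0 hCB hε hz (hAB m (hA' m hv)) (hgi₀ m) hi₀ (hg m)
  refine ⟨P, hp.induced, hP, ?_⟩
  rintro _ (rfl | ⟨a, ha, rfl⟩)
  · simpa only [P.vertex_zero] using hpA' 0 hr0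
  · exact hpA' a ha.2

theorem exists_le_card_two_layers (hγ : 0 < γ) (hG : IsCoherent G γ γ)
    (ht : ⌈γ⌉₊ ≤ (t + 1) ^ k) {D : Finset V} (hD : 2 * γ ≤ #D) {C₁ C₂ : ℕ → Finset V}
    (hC₁ : ∀ a < k, (t + 2) * ⌈γ⌉₊ ≤ #(C₁ a)) (hC₂ : ∀ a < k, (t + 2) * ⌈γ⌉₊ ≤ #(C₂ a))
    (hDC₁ : ∀ a < k, Disjoint D (C₁ a)) (hDC₂ : ∀ a < k, Disjoint D (C₂ a))
    (hCC₁ : (Set.Iio k).PairwiseDisjoint C₁) (hCC₂ : (Set.Iio k).PairwiseDisjoint C₂) :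
    ∃ z ∈ D, γ ≤ #(layer G C₁ {z} k) ∧ γ ≤ #(layer G C₂ {z} k) := by
  classical
  set D₁ : Finset V := {z ∈ D | γ ≤ #(layer G C₁ {z} k)}
  have hsmall : (#(D \ D₁) : ℝ) < γ := by
    by_contra! h
    obtain ⟨z, hz, hz'⟩ := exists_le_card_layer_singleton hγ hG ht h hC₁
      (fun a ha => (hDC₁ a ha).mono_left sdiff_subset) hCC₁
    exact (mem_sdiff.1 hz).2 (mem_filter.2 ⟨(mem_sdiff.1 hz).1, hz'⟩)
  have hsplit : (#(D \ D₁) : ℝ) + #D₁ = #D :=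
    mod_cast card_sdiff_add_card_eq_card (filter_subset _ D)
  obtain ⟨z, hz, hz₂⟩ := exists_le_card_layer_singleton hγ hG ht (D := D₁) (by linarith) hC₂
    (fun a ha => (hDC₂ a ha).mono_left (filter_subset _ _)) hCC₂
  exact ⟨z, (mem_filter.1 hz).1, (mem_filter.1 hz).2, hz₂⟩

theorem card_neighborsIn_le_of_card_le_two_mul {A A' : Finset V} {u : V}
    (h : 16 * #(neighborsIn G u A) ≤ #A) (hA' : A' ⊆ A) (hcard : #A ≤ 2 * #A') :
    8 * #(neighborsIn G u A') ≤ #A' := by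
  have := card_le_card (neighborsIn_mono G u hA')
  omega

theorem exists_two_hubs (hγ : 0 < γ) (hG : IsCoherent G γ γ)
    (hB : Pairwise (Function.onFun Disjoint B)) {ε₁ ε₂ : ℕ → ι} (hε₁ : Set.InjOn ε₁ (Set.Iio k))
    (hε₂ : Set.InjOn ε₂ (Set.Iio k)) {i₀ : ι} (hi₁ : ∀ a < k, ε₁ a ≠ i₀) (hi₂ : ∀ a < k, ε₂ a ≠ i₀)
    {z : V} (hz : z ∈ B i₀) (hlayer₁ : γ ≤ #(layer G (B ∘ ε₁) {z} k))
    (hlayer₂ : γ ≤ #(layer G (B ∘ ε₂) {z} k)) [Nontrivial κ] {g : κ → ι} (hg₀ : ∀ i, i₀ ≠ g i)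
    (hg₁ : ∀ i, ∀ a < k, ε₁ a ≠ g i) (hg₂ : ∀ i, ∀ a < k, ε₂ a ≠ g i)
    (hγB : ∀ i, 4 * γ ≤ #(B (g i))) (hlz : ∀ i, 16 * #(neighborsIn G z (B (g i))) ≤ #(B (g i)))
    (hl₁ : ∀ i, ∀ a < k, ∀ u ∈ B (ε₁ a), 16 * #(neighborsIn G u (B (g i))) ≤ #(B (g i)))
    (hl₂ : ∀ i, ∀ a < k, ∀ u ∈ B (ε₂ a), 16 * #(neighborsIn G u (B (g i))) ≤ #(B (g i))) :
    ∃ (m b : κ) (r₁ r₂ : ℕ) (Y : κ → Finset V), m ≠ b ∧ r₁ ≤ k + 1 ∧ r₂ ≤ k + 1 ∧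
      (∀ i, Y i ⊆ B (g i)) ∧ (∀ i, #(B (g i)) ≤ 8 * (k + 1) * #(Y i)) ∧
      (∀ w ∈ Y m, ∃ P : RainbowWalk G B z w i₀ (g m) r₁, (∀ u ∈ P.interior, ∃ a < k, ε₁ a = u.2) ∧
        ∀ u ∈ insert (z, i₀) P.interior, ∀ i ∉ ({m, b} : Set κ), ∀ y ∈ Y i, ¬ G.Adj u.1 y) ∧
      ∀ x ∈ Y b, ∃ P : RainbowWalk G B z x i₀ (g b) r₂, (∀ u ∈ P.interior, ∃ a < k, ε₂ a = u.2) ∧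
        ∀ u ∈ insert (z, i₀) P.interior, ∀ i ∉ ({m, b} : Set κ), ∀ y ∈ Y i, ¬ G.Adj u.1 y := by
  classical
  obtain ⟨m, r₁, Y₁, -, hr₁, hY₁, hhalf₁, hm, hP₁⟩ := exists_hub_walks hγ hG hB hε₁
    (fun _ _ => Subset.rfl) hi₁ hz hlayer₁ hg₀ hg₁ (fun i => Subset.rfl)
    (fun i => by linarith [hγB i])
    (fun i => by linarith [hlz i]) (fun a ha u hu i => by linarith [hl₁ i a ha u hu])
  have hlink₁ {u : V} {i : κ} (hi : i ≠ m)
      (h : 16 * #(neighborsIn G u (B (g i))) ≤ #(B (g i))) :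
      8 * #(neighborsIn G u (Y₁ i)) ≤ #(Y₁ i) :=
    card_neighborsIn_le_of_card_le_two_mul h (hY₁ i) (hhalf₁ i hi)
  obtain ⟨i₁, hi₁⟩ := exists_ne m
  have : Nonempty {i // i ≠ m} := ⟨⟨i₁, hi₁⟩⟩
  obtain ⟨b, r₂, Y₂, -, hr₂, hY₂, hhalf₂, hb, hP₂⟩ := exists_hub_walks (κ := {i // i ≠ m})
    (A := fun i => Y₁ i) hγ hG hB hε₂ (fun _ _ => Subset.rfl) hi₂ hz hlayer₂ (fun i => hg₀ i)
    (fun i => hg₂ i)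
    (fun i => hY₁ i) (fun i => by
      have h : (#(B (g i)) : ℝ) ≤ 2 * #(Y₁ i) := mod_cast hhalf₁ i i.2
      linarith [hγB i])
    (fun i => hlink₁ i.2 (hlz i)) (fun a ha u hu i => hlink₁ i.2 (hl₂ i a ha u hu))
  obtain ⟨Y, hYm, hYne⟩ : ∃ Y : κ → Finset V, Y m = Y₁ m ∧ ∀ i : {i // i ≠ m}, Y i = Y₂ i :=
    ⟨fun i => if h : i ≠ m then Y₂ ⟨i, h⟩ else Y₁ i, by simp, fun i => by simp [i.2]⟩
  have hYY₁ : ∀ i, Y i ⊆ Y₁ i := fun i => by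
    rcases eq_or_ne i m with rfl | hi
    · exact hYm.subset
    · exact (hYne ⟨i, hi⟩).trans_subset (hY₂ _)
  refine ⟨m, b, r₁, r₂, Y, b.2.symm, hr₁, hr₂, fun i => (hYY₁ i).trans (hY₁ i), fun i => ?_,
    fun w hw => ?_, fun x hx => ?_⟩
  · rcases eq_or_ne i m with rfl | hi
    · rw [hYm]
      exact hm.trans (by gcongr; norm_num)
    · rw [hYne ⟨i, hi⟩]
      refine (hhalf₁ i hi).trans ?_
      rw [show 8 * (k + 1) = 2 * (4 * (k + 1)) by ring, mul_assoc]
      gcongr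
      rcases eq_or_ne (⟨i, hi⟩ : {i // i ≠ m}) b with rfl | hib
      · exact hb
      · exact (hhalf₂ ⟨i, hi⟩ hib).trans (by gcongr; omega)
  · obtain ⟨P, -, hP, hPY⟩ := hP₁ w (hYm ▸ hw)
    exact ⟨P, fun u hu => (hP u hu).imp fun _ h => ⟨h.1, h.2.2⟩, fun u hu i hi y hy =>
      hPY u hu i (fun h => hi (.inl h)) y (hYY₁ i hy)⟩
  · obtain ⟨P, -, hP, hPY⟩ := hP₂ x (hYne b ▸ hx)
    refine ⟨P, fun u hu => (hP u hu).imp fun _ h => ⟨h.1, h.2.2⟩, fun u hu i hi y hy => ?_⟩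
    obtain ⟨him, hib⟩ := not_or.1 hi
    exact hPY u hu ⟨i, him⟩ (fun h => hib (congrArg Subtype.val h)) y (hYne ⟨i, him⟩ ▸ hy)

theorem exists_double_hub (hγ : 0 < γ) (hG : IsCoherent G γ γ) (ht : ⌈γ⌉₊ ≤ (t + 1) ^ k)
    [Nontrivial κ] (hB : Pairwise (Function.onFun Disjoint B)) {e : ℕ → ι}
    (he : Set.InjOn e (Set.Iic (2 * k))) (g : κ ↪ ι) (hge : ∀ i, ∀ a ≤ 2 * k, e a ≠ g i)
    (hwide : ∀ i, (t + 2) * ⌈γ⌉₊ ≤ #(B i)) (hγB : ∀ i, 4 * γ ≤ #(B i))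
    (hlink : ∀ i, ∀ a ≤ 2 * k, ∀ u ∈ B (e a), 16 * #(neighborsIn G u (B (g i))) ≤ #(B (g i))) :
    ∃ (m b : κ) (Y : κ → Finset V), (∀ i, Y i ⊆ B (g i)) ∧
      (∀ i, #(B (g i)) ≤ 8 * (k + 1) * #(Y i)) ∧
      ∀ x ∈ Y b, ∀ w ∈ Y m, ∃ r ≤ 2 * k + 2,
        ∃ P : RainbowWalk G B x w (g b) (g m) r, P.Avoids g Y {m, b} := by
  obtain ⟨ε₁, hε₁⟩ : ∃ ε₁ : ℕ → ι, ∀ a, ε₁ a = e (a + 1) := ⟨_, fun _ => rfl⟩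
  obtain ⟨ε₂, hε₂⟩ : ∃ ε₂ : ℕ → ι, ∀ a, ε₂ a = e (k + 1 + a) := ⟨_, fun _ => rfl⟩
  have hinj₁ : Set.InjOn ε₁ (Set.Iio k) := fun a ha b hb hab => by
    simp only [Set.mem_Iio] at ha hb
    grind [he.eq_iff]
  have hinj₂ : Set.InjOn ε₂ (Set.Iio k) := fun a ha b hb hab => by
    simp only [Set.mem_Iio] at ha hb
    grind [he.eq_iff]
  have hne₁ : ∀ a < k, ε₁ a ≠ e 0 := by grind [he.eq_iff]
  have hne₂ : ∀ a < k, ε₂ a ≠ e 0 := by grind [he.eq_iff]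
  have hne₁₂ : ∀ a < k, ∀ b < k, ε₁ a ≠ ε₂ b := by grind [he.eq_iff]
  have hg₁ : ∀ i, ∀ a < k, ε₁ a ≠ g i := fun i a ha => hε₁ a ▸ hge i _ (by omega)
  have hg₂ : ∀ i, ∀ a < k, ε₂ a ≠ g i := fun i a ha => hε₂ a ▸ hge i _ (by omega)
  obtain ⟨z, hz, hz₁, hz₂⟩ := exists_le_card_two_layers hγ hG ht (D := B (e 0))
    (by linarith [hγB (e 0)]) (C₁ := B ∘ ε₁) (C₂ := B ∘ ε₂) (fun a _ => hwide _)
    (fun a _ => hwide _) (fun a ha => hB (hne₁ a ha).symm) (fun a ha => hB (hne₂ a ha).symm)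
    (fun a ha b hb hab => hB (hinj₁.ne ha hb hab)) (fun a ha b hb hab => hB (hinj₂.ne ha hb hab))
  obtain ⟨m, b, r₁, r₂, Y, hmb, hr₁, hr₂, hYB, hY, hm, hb⟩ := exists_two_hubs hγ hG hB hinj₁ hinj₂
    hne₁ hne₂ hz hz₁ hz₂ (fun i => hge i 0 (Nat.zero_le _)) hg₁ hg₂ (fun i => hγB _)
    (fun i => hlink i 0 (Nat.zero_le _) z hz)
    (fun i a ha u hu => hlink i (a + 1) (by omega) u (hε₁ a ▸ hu))
    (fun i a ha u hu => hlink i (k + 1 + a) (by omega) u (hε₂ a ▸ hu))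
  refine ⟨m, b, Y, hYB, hY, fun x hx w hw => ?_⟩
  obtain ⟨P₁, hP₁, hPY₁⟩ := hm w hw
  obtain ⟨P₂, hP₂, hPY₂⟩ := hb x hx
  obtain ⟨P, hP⟩ := P₂.exists_append_reverse P₁ (g.injective.ne hmb.symm)
    (fun v hv h => (hP₁ v hv).elim fun a ha => hg₁ b a ha.1 (ha.2.trans h))
    (fun u hu h => (hP₂ u hu).elim fun a ha => hg₂ m a ha.1 (ha.2.trans h))
    (fun u hu v hv h => by
      obtain ⟨a, ha, hau⟩ := hP₂ u hu
      obtain ⟨a', ha', hav⟩ := hP₁ v hv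
      exact hne₁₂ a' ha' a ha (hav.trans (h.symm.trans hau.symm)))
  refine ⟨r₂ + r₁, by omega, P, fun u hu => ?_⟩
  rcases hP hu with rfl | hu | hu
  · exact ⟨fun i => hge i 0 (Nat.zero_le _), hPY₁ _ (Set.mem_insert _ _)⟩
  · obtain ⟨a, ha, hau⟩ := hP₂ u hu
    exact ⟨fun i => hau ▸ hg₂ i a ha, hPY₂ u (Set.mem_insert_of_mem _ hu)⟩
  · obtain ⟨a, ha, hau⟩ := hP₁ u hu
    exact ⟨fun i => hau ▸ hg₁ i a ha, hPY₁ u (Set.mem_insert_of_mem _ hu)⟩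

end HubWalks

section Joined

theorem exists_injOn_and_embedding {ι : Type*} [Fintype ι] (r s : ℕ)
    (h : r + 1 + s ≤ Fintype.card ι) :
    ∃ (e : ℕ → ι) (g : Fin s ↪ ι), Set.InjOn e (Set.Iic r) ∧ ∀ i, ∀ a ≤ r, e a ≠ g i := by
  obtain ⟨E⟩ : Nonempty (Fin (r + 1) ⊕ Fin s ↪ ι) :=
    Function.Embedding.nonempty_of_card_le (by simpa using h)
  refine ⟨fun a => E (.inl (Fin.ofNat (r + 1) a)), .trans .inr E, fun a ha b hb hab => ?_,
    fun i a _ => E.injective.ne Sum.inl_ne_inr⟩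
  have h := congrArg Fin.val (Sum.inl_injective (E.injective hab))
  rwa [Fin.val_ofNat, Fin.val_ofNat, Nat.mod_eq_of_lt (Nat.lt_succ_of_le ha),
    Nat.mod_eq_of_lt (Nat.lt_succ_of_le hb)] at h

variable {V ι ι' κ : Type*} {G : SimpleGraph V} {B : ι → Finset V}

/-- The subset `D` of `B b` is joined to the sets `B' i ⊆ B (φ i)`: its vertices have few
neighbours in these sets, and reach all of their vertices by induced paths of length less than `T`
which avoid the family `B'`. -/
structure IsJoined (G : SimpleGraph V) (B : ι → Finset V) (φ : ι' → ι) (B' : ι' → Finset V) (b : ι)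
    (D : Finset V) (T : ℕ) : Prop where
  subset : D ⊆ B b
  ne : ∀ i, φ i ≠ b
  light : ∀ x ∈ D, ∀ i, 8 * #(neighborsIn G x (B' i)) ≤ #(B' i)
  path : ∀ x ∈ D, ∀ i, ∀ v ∈ B' i, ∃ r < T, ∃ P : RainbowWalk G B x v b (φ i) r,
    IsInducedPath G P.vertex r ∧ P.Avoids φ B' {i}

theorem isJoined_of_walks (hB : Pairwise (Function.onFun Disjoint B)) {g : κ ↪ ι}
    {Y : κ → Finset V} (hY : ∀ i, Y i ⊆ B (g i)) {m b : κ} {T : ℕ}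
    (hwalk : ∀ x ∈ Y b, ∀ w ∈ Y m, ∃ r < T,
      ∃ P : RainbowWalk G B x w (g b) (g m) r, P.Avoids g Y {m, b})
    {φ : ι' ↪ κ} (hφ : ∀ i, φ i ≠ m ∧ φ i ≠ b) {B' : ι' → Finset V} (hB' : ∀ i, B' i ⊆ Y (φ i))
    (hpriv : ∀ i, ∀ v ∈ B' i, ∃ w ∈ Y m, G.Adj w v ∧ ∀ j ≠ i, ∀ u ∈ B' j, ¬ G.Adj w u)
    {D : Finset V} (hD : D ⊆ Y b)
    (hlight : ∀ x ∈ D, ∀ i, 8 * #(neighborsIn G x (B' i)) ≤ #(B' i)) :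
    IsJoined G B (φ.trans g) B' (g b) D (T + 1) where
  subset := hD.trans (hY b)
  ne i := g.injective.ne (hφ i).2
  light := hlight
  path x hx i v hv := by
    obtain ⟨w, hw, hwv, hwB'⟩ := hpriv i v hv
    obtain ⟨r, hr, P, hP⟩ := hwalk x (hD hx) w hw
    obtain ⟨s, hs, Q, hQ, hQP⟩ := P.exists_isInducedPath_of_adj (l := g (φ i)) hB hwv
      (hY _ (hB' i hv)) (g.injective.ne (hφ i).2.symm) (g.injective.ne (hφ i).1.symm)
      (fun u hu => (hP u hu).1 _)
    refine ⟨s, by omega, Q, hQ, fun u hu => ?_⟩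
    rcases hQP hu with rfl | hu
    · exact ⟨fun j => g.injective.ne (hφ j).1.symm, hwB'⟩
    · exact ⟨fun j => (hP u hu).1 _, fun j _ y hy =>
        (hP u hu).2 (φ j) (not_or.2 (hφ j)) y (hB' j hy)⟩

theorem IsBlockade.nonempty [Fintype V] [Nonempty V] {σ lam : ℝ} (h : IsBlockade G σ lam B)
    (i : ι) : (B i).Nonempty :=
  card_pos.1 <| Nat.cast_pos.1 <|
    (Real.rpow_pos_of_pos (mod_cast Fintype.card_pos) _).trans_le (h.le_card i)

theorem eventually_exists_double_hub {c : ℝ} (hc1 : c < 1) {k : ℕ} (hk : 1 < (k + 1) * c) {s : ℕ}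
    (hs : 2 ≤ s) {σ lam : ℝ} (hσ : 0 < σ) (hlam : 0 < lam) :
    ∀ᶠ F : GraphWithFamily.{u} in goodBlockades c,
      ∃ (g : Fin s ↪ F.ι) (m b : Fin s) (Y : Fin s → Finset F.V), (∀ i, Y i ⊆ F.B (g i)) ∧
        IsBlockade F.G σ lam Y ∧ ∀ x ∈ Y b, ∀ w ∈ Y m, ∃ r < 2 * k + 3,
          ∃ P : RainbowWalk F.G F.B x w (g b) (g m) r, P.Avoids g Y {m, b} := by
  have : Nontrivial (Fin s) := Fin.nontrivial_iff_two_le.2 hs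
  obtain ⟨σ₀, hσ₀, hσ₀c, hchain⟩ := exists_chain_parameter hc1 hk
  have hR : (0 : ℝ) < 8 * (k + 1) := by positivity
  filter_upwards [eventually_isCoherent,
    eventually_isBlockade (σ := min (σ / 2) σ₀) (lam := min (lam / (8 * (k + 1))) (1 / 16))
      (by positivity) (by positivity),
    eventually_le_card_indices (2 * k + 1 + s),
    tendsto_card_goodBlockades.eventually_gt_atTop 0,
    tendsto_card_goodBlockades.eventually hchain,
    tendsto_card_goodBlockades.eventually
      (eventually_mul_rpow_le (by linarith : 1 - c < 1 - σ₀) 4),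
    tendsto_card_goodBlockades.eventually
      (eventually_mul_rpow_le (by linarith : 1 - σ < 1 - σ / 2) (8 * (k + 1)))]
    with F hG hB hι hN hchain hγ hR'
  have : Nonempty F.V := Fintype.card_pos_iff.1 hN
  have hB₀ := hB.mono (min_le_right _ _) (min_le_right _ _)
  obtain ⟨t, ht, htk⟩ := hchain
  obtain ⟨e, g, he, hge⟩ := exists_injOn_and_embedding (2 * k) s hι
  obtain ⟨m, b, Y, hYB, hYcard, hwalk⟩ := exists_double_hub (by positivity) hG htk hB.disjoint
    he g hge (fun i => by exact_mod_cast ht.trans (hB₀.le_card i))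
    (fun i => hγ.trans (hB₀.le_card i)) (fun i a ha u hu => by
      have := hB₀.hasLinkage (e a) (g i) (hge i a ha) u hu
      have : (16 : ℝ) * #(neighborsIn F.G u (F.B (g i))) ≤ #(F.B (g i)) := by linarith
      exact_mod_cast this)
  refine ⟨g, m, b, Y, hYB, ?_, fun x hx w hw => ?_⟩
  · have := (hB.mono (min_le_left _ _) (min_le_left _ _)).shrink g hYB (by positivity) hR
      (fun i => mod_cast hYcard i) hR'
    rwa [mul_div_cancel₀ _ hR.ne'] at this
  · obtain ⟨r, hr, P, hP⟩ := hwalk x hx w hw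
    exact ⟨r, by omega, P, hP⟩

theorem eventually_exists_isJoined {c : ℝ} (hc1 : c < 1) {k : ℕ} (hk : 1 < (k + 1) * c)
    (ι' : Type*) [Finite ι'] {σ' lam' : ℝ} (hσ' : 0 < σ') (hlam' : 0 < lam') :
    ∀ᶠ F : GraphWithFamily.{u} in goodBlockades c,
      ∃ (φ : ι' ↪ F.ι) (B' : ι' → Finset F.V) (b : F.ι) (D : Finset F.V),
        (∀ i, B' i ⊆ F.B (φ i)) ∧ IsBlockade F.G σ' lam' B' ∧
        (Fintype.card F.V : ℝ) ^ (1 - σ') ≤ #D ∧ IsJoined F.G F.B φ B' b D (2 * k + 4) := by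
  have := Fintype.ofFinite ι'
  obtain ⟨K₂, σ₂, lam₂, hσ₂, hlam₂, hpriv⟩ := exists_eventually_forall_isBlockade <|
    eventually_exists_private_neighbors.{u} (pos_of_one_lt_succ_mul hk) ι' hσ' hlam'
  obtain ⟨lamY, hlamY, hlamY₂, hlamY'⟩ :
      ∃ lamY, 0 < lamY ∧ lamY ≤ lam₂ ∧ Fintype.card ι' * lamY ≤ 1 / 16 := by
    refine ⟨min lam₂ (1 / (16 * (Fintype.card ι' + 1))), by positivity, min_le_left _ _, ?_⟩
    have hmin := (le_div_iff₀ (by positivity)).1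
      (min_le_right lam₂ (1 / (16 * ((Fintype.card ι' : ℝ) + 1))))
    have : 0 < min lam₂ (1 / (16 * ((Fintype.card ι' : ℝ) + 1))) := by positivity
    linarith
  filter_upwards [hpriv, eventually_isBlockade one_pos one_pos,
    tendsto_card_goodBlockades.eventually_gt_atTop 0,
    eventually_exists_double_hub hc1 hk (le_add_self : 2 ≤ K₂ + 2)
      (by positivity : 0 < min σ₂ (σ' / 2)) hlamY,
    tendsto_card_goodBlockades.eventually
      (eventually_mul_rpow_le (by linarith : 1 - σ' < 1 - σ' / 2) 2)]
    with F hpriv hB hN hhub hσ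
  have : Nonempty F.V := Fintype.card_pos_iff.1 hN
  obtain ⟨g, m, b, Y, hYB, hY, hwalk⟩ := hhub
  obtain ⟨φ, B', hB'Y, hB', hφ, hw⟩ := hpriv (Fin (K₂ + 2)) Y (by simp)
    (hY.mono (min_le_left _ _) hlamY₂) m b
  obtain ⟨D, hDY, hD, hlight⟩ := hY.hasLinkage.exists_subset_card_neighborsIn_le hlamY'
    (fun i => (hφ i).2) hB'Y hB'.nonempty
  refine ⟨φ.trans g, B', g b, D, fun i => (hB'Y i).trans (hYB _), hB', ?_,
    isJoined_of_walks hB.disjoint hYB hwalk hφ hB'Y hw hDY hlight⟩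
  have hYb := hσ.trans ((hY.mono (min_le_right _ _) le_rfl).le_card b)
  have hD' : (#(Y b) : ℝ) ≤ 2 * #D := mod_cast hD
  linarith

end Joined

section Linked

variable {V ι ι₁ ι₂ ι' κ : Type*} {G : SimpleGraph V} {B : ι → Finset V} {ℓ : ℕ}

/-- Any two vertices in distinct members of the family `B'` are joined by a walk of length `ℓ` that
is induced up to the adjacency of its ends and whose interior avoids the other members of `B'`. -/
def IsLinked (ℓ : ℕ) (G : SimpleGraph V) (B : ι → Finset V) (φ : ι' → ι) (B' : ι' → Finset V) :
    Prop :=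
  ∀ i j, i ≠ j → ∀ v ∈ B' i, ∀ v' ∈ B' j, ∃ P : RainbowWalk G B v v' (φ i) (φ j) ℓ,
    IsInducedUpToEnds G P.vertex ℓ ∧ P.Avoids φ B' {i, j}

theorem IsLinked.restrict {φ₁ : ι₁ → ι} {B₁ : ι₁ → Finset V} (h : IsLinked ℓ G B φ₁ B₁)
    (φ₂ : ι₂ ↪ ι₁) {B₂ : ι₂ → Finset V} (hB₂ : ∀ i, B₂ i ⊆ B₁ (φ₂ i)) :
    IsLinked ℓ G B (φ₁ ∘ φ₂) B₂ := fun i j hij v hv v' hv' => by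
  obtain ⟨P, hP, hPB⟩ := h _ _ (φ₂.injective.ne hij) v (hB₂ i hv) v' (hB₂ j hv')
  refine ⟨P, hP, fun u hu => ⟨fun l => (hPB u hu).1 _, fun l hl y hy =>
    (hPB u hu).2 (φ₂ l) ?_ y (hB₂ l hy)⟩⟩
  simpa using hl

theorem IsLinked.extend (hℓ : 2 ≤ ℓ) (hB : Pairwise (Function.onFun Disjoint B)) {φ₁ : ι₁ ↪ ι}
    {B₁ : ι₁ → Finset V} (hB₁ : ∀ i, B₁ i ⊆ B (φ₁ i)) (h : IsLinked ℓ G B φ₁ B₁) (φ₂ : ι₂ ↪ ι₁)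
    {B₂ : ι₂ → Finset V} (hB₂ : ∀ i, B₂ i ⊆ B₁ (φ₂ i)) {m : ι₁} (hm : ∀ i, φ₂ i ≠ m)
    (hpriv : ∀ i, ∀ v ∈ B₂ i, ∃ w ∈ B₁ m, G.Adj w v ∧ ∀ j ≠ i, ∀ u ∈ B₂ j, ¬ G.Adj w u) :
    IsLinked (1 + ℓ) G B (φ₁ ∘ φ₂) B₂ := fun i j hij v hv v' hv' => by
  obtain ⟨w, hwm, hwv, hw⟩ := hpriv i v hv
  obtain ⟨P, hP, hPB⟩ := h m (φ₂ j) (hm j).symm w hwm v' (hB₂ j hv')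
  have hPB₂ : ∀ u ∈ P.interior, ∀ l ≠ j, ∀ y ∈ B₂ l, ¬ G.Adj u.1 y := fun u hu l hl y hy =>
    (hPB u hu).2 (φ₂ l) (by simp [hm, hl]) y (hB₂ l hy)
  have hcompat : (RainbowWalk.ofAdj (hB₁ _ (hB₂ i hv)) P.start_mem
      (φ₁.injective.ne (hm i)) hwv.symm).Compatible P :=
    ⟨φ₁.injective.ne (φ₂.injective.ne hij), fun u hu => (hPB u hu).1 _,
      by simp [RainbowWalk.interior_ofAdj], by simp [RainbowWalk.interior_ofAdj]⟩
  refine ⟨_, RainbowWalk.isInducedUpToEnds_append hcompat (RainbowWalk.isInducedPath_ofAdj _ _ _ _)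
    (P.isInducedPath hB hP (hw j hij.symm v' hv') (by omega))
    (fun u hu h => hPB₂ u hu i hij v hv h.symm) (by simp [RainbowWalk.interior_ofAdj])
    (by simp [RainbowWalk.interior_ofAdj]), fun u hu => ?_⟩
  have hu := RainbowWalk.interior_append_subset hcompat hu
  simp only [RainbowWalk.interior_ofAdj, Set.empty_union] at hu
  rcases hu with rfl | hu
  · exact ⟨fun l => φ₁.injective.ne (hm l).symm, fun l hl => hw l fun h => hl (.inl h)⟩
  · exact ⟨fun l => (hPB u hu).1 _, fun l hl => hPB₂ u hu l fun h => hl (.inr h)⟩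

theorem exists_uniform_length [Fintype κ] (Y : κ → Finset V) {P : κ → V → ℕ → Prop} {T s : ℕ}
    (hP : ∀ i, ∀ v ∈ Y i, ∃ r < T, P i v r) (hT : 0 < T) (hs : T * s ≤ Fintype.card κ) :
    ∃ (r : ℕ) (S : Finset κ) (Z : κ → Finset V), r < T ∧ s ≤ #S ∧
      (∀ i, Z i ⊆ Y i ∧ #(Y i) ≤ T * #(Z i)) ∧ ∀ i ∈ S, ∀ v ∈ Z i, P i v r := by
  classical
  have hT' : (range T).Nonempty := ⟨0, mem_range.2 hT⟩
  choose! f hf hPf using hP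
  have hfiber (i : κ) : ∃ r ∈ range T, #(Y i) ≤ #(range T) * #{v ∈ Y i | f i v = r} :=
    exists_card_le_mul_card_fiber (fun v hv => mem_range.2 (hf i v hv)) hT'
  choose ρ hρ hρY using hfiber
  obtain ⟨r, hr, hcard⟩ := exists_card_le_mul_card_fiber (s := univ) (fun i _ => hρ i) hT'
  simp only [card_range] at hρY hcard
  refine ⟨r, univ.filter (ρ · = r), fun i => {v ∈ Y i | f i v = ρ i}, mem_range.1 hr,
    Nat.le_of_mul_le_mul_left (hs.trans hcard) hT, fun i => ⟨filter_subset _ _, hρY i⟩,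
    fun i hi v hv => ?_⟩
  obtain ⟨hv, hfv⟩ := mem_filter.1 hv
  exact (mem_filter.1 hi).2 ▸ hfv ▸ hPf i v hv

theorem isLinked_of_walks (φ₁ : ι₁ ↪ ι) {B₁ : ι₁ → Finset V} (ψ : ι' ↪ ι₁) {B' : ι' → Finset V}
    (hB' : ∀ i, B' i ⊆ B₁ (ψ i)) {b : ι} (hb : ∀ i, φ₁ i ≠ b) {x : V}
    (hx : ∀ i, ∀ y ∈ B' i, ¬ G.Adj x y) {r s : ℕ}
    (hP : ∀ i, ∀ v ∈ B' i, ∃ P : RainbowWalk G B x v b (φ₁ (ψ i)) r,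
      IsInducedPath G P.vertex r ∧ P.Avoids φ₁ B₁ {ψ i})
    (hQ : ∀ j, ∀ v ∈ B' j, ∃ Q : RainbowWalk G B x v b (φ₁ (ψ j)) s,
      IsInducedPath G Q.vertex s ∧ ∀ u ∈ Q.interior,
        (∃ l, u.1 ∈ B₁ l ∧ φ₁ l = u.2 ∧ ∀ i, l ≠ ψ i) ∧ ∀ i ≠ j, ∀ y ∈ B' i, ¬ G.Adj u.1 y) :
    IsLinked (r + s) G B (φ₁ ∘ ψ) B' := fun i j hij v hv v' hv' => by
  obtain ⟨P, hP, hPB₁⟩ := hP i v hv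
  obtain ⟨Q, hQ, hQB'⟩ := hQ j v' hv'
  have hPB' {u : V × ι} (hu : u ∈ P.interior) (l : ι') (hl : l ≠ i) : ∀ y ∈ B' l, ¬ G.Adj u.1 y :=
    fun y hy => (hPB₁ u hu).2 _ (ψ.injective.ne hl) y (hB' l hy)
  have hQψ {u : V × ι} (hu : u ∈ Q.interior) (l : ι') : u.2 ≠ φ₁ (ψ l) := by
    obtain ⟨⟨a, -, hau, ha⟩, -⟩ := hQB' u hu
    exact hau ▸ φ₁.injective.ne (ha l)
  have hcompat : P.reverse.Compatible Q := by
    refine ⟨φ₁.injective.ne (ψ.injective.ne hij), fun u hu => hQψ hu i, ?_, ?_⟩ <;>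
      rw [P.interior_reverse]
    · exact fun u hu => (hPB₁ u hu).1 _
    · rintro u hu u' hu'
      obtain ⟨⟨a, -, hau', -⟩, -⟩ := hQB' u' hu'
      exact hau' ▸ (hPB₁ u hu).1 a
  refine ⟨_, RainbowWalk.isInducedUpToEnds_append hcompat (P.isInducedPath_reverse hP) hQ
    (fun u hu h => (hQB' u hu).2 i hij v hv h.symm) ?_ ?_, fun u hu => ?_⟩
  · rw [P.interior_reverse]
    exact fun u hu => hPB' hu j hij.symm v' hv'
  · rw [P.interior_reverse]
    intro u hu u' hu'
    obtain ⟨⟨a, hau', -, ha⟩, -⟩ := hQB' u' hu'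
    exact (hPB₁ u hu).2 a (ha i) _ hau'
  have hu := RainbowWalk.interior_append_subset hcompat hu
  rw [P.interior_reverse] at hu
  rcases hu with rfl | hu | hu
  · exact ⟨fun l => (hb _).symm, fun l _ => hx l⟩
  · exact ⟨fun l => (hPB₁ u hu).1 _, fun l hl => hPB' hu l fun h => hl (.inl h)⟩
  · exact ⟨hQψ hu, fun l hl => (hQB' u hu).2 l fun h => hl (.inr h)⟩

/-- Every vertex of the hub `Y m` is reached from the vertex `x` of `B b` by an induced path of
length `s` whose interior lies in members of the family `B₁` not indexed by `g`. The path has no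
neighbours in the other members of `Y`, except possibly for those of its last vertex. -/
def IsHub (G : SimpleGraph V) (B : ι → Finset V) (φ₁ : ι₁ → ι) (B₁ : ι₁ → Finset V) (g : κ → ι₁)
    (Y : κ → Finset V) (x : V) (b : ι) (m : κ) (s : ℕ) : Prop :=
  ∀ w ∈ Y m, ∃ P : RainbowWalk G B x w b (φ₁ (g m)) s, IsInducedPath G P.vertex s ∧
    (∀ u ∈ P.interior, ∃ l, u.1 ∈ B₁ l ∧ φ₁ l = u.2 ∧ ∀ i, l ≠ g i) ∧
    ∀ u ∈ insert (x, b) P.interior, ∀ i ≠ m, ∀ y ∈ Y i, ¬ G.Adj u.1 y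

theorem IsJoined.exists_isHub {γ : ℝ} {k t T : ℕ} (hγ : 0 < γ) (hG : IsCoherent G γ γ)
    (ht : ⌈γ⌉₊ ≤ (t + 1) ^ k) (hB : Pairwise (Function.onFun Disjoint B)) {φ₁ : ι₁ ↪ ι}
    {B₁ : ι₁ → Finset V} (hB₁ : ∀ i, B₁ i ⊆ B (φ₁ i)) {b : ι} {D : Finset V}
    (hJ : IsJoined G B φ₁ B₁ b D T) (hD : 2 * γ ≤ #D) (hγB₁ : ∀ i, 2 * γ ≤ #(B₁ i))
    (htB₁ : ∀ i, (t + 2) * ⌈γ⌉₊ ≤ #(B₁ i)) {e : ℕ → ι₁} (he : Set.InjOn e (Set.Iic k))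
    [Nonempty κ] {g : κ ↪ ι₁} (hge : ∀ i, ∀ a ≤ k, e a ≠ g i)
    (hlight : ∀ i j, i ≠ j → ∀ u ∈ B₁ i, 8 * #(neighborsIn G u (B₁ j)) ≤ #(B₁ j)) :
    ∃ x ∈ D, ∃ (m : κ) (s : ℕ) (Y : κ → Finset V), 0 < s ∧ s ≤ k + 1 ∧
      (∀ i, Y i ⊆ B₁ (g i) ∧ #(B₁ (g i)) ≤ 4 * (k + 1) * #(Y i)) ∧
      IsHub G B φ₁ B₁ g Y x b m s := by
  have hB₁' : Pairwise (Function.onFun Disjoint B₁) := fun i j hij =>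
    (hB (φ₁.injective.ne hij)).mono (hB₁ i) (hB₁ j)
  obtain ⟨x, hx, hlayer⟩ := exists_le_card_layer_singleton hγ hG ht (C := B₁ ∘ e)
    (by linarith : γ ≤ #D) (fun a _ => htB₁ _)
    (fun a _ => (hB (hJ.ne _).symm).mono hJ.subset (hB₁ _))
    (fun a ha a' ha' haa' => hB₁' (he.ne (Set.mem_Iio.1 ha).le (Set.mem_Iio.1 ha').le haa'))
  obtain ⟨m, s, Y, hs, hsk, hY, hhalf, hm, hwalk⟩ := exists_hub_walks (g := φ₁ ∘ g)
    (ε := φ₁ ∘ e) hγ hG hB (fun a ha a' ha' haa' => he (Set.mem_Iio.1 ha).le (Set.mem_Iio.1 ha').le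
      (φ₁.injective haa')) (fun a _ => hB₁ _) (fun a _ => hJ.ne _) (hJ.subset hx) hlayer
    (fun i => (hJ.ne _).symm) (fun i a ha => φ₁.injective.ne (hge i a ha.le))
    (A := fun i => B₁ (g i)) (fun i => hB₁ _) (fun i => hγB₁ _) (fun i => hJ.light x hx _)
    (fun a ha u hu i => hlight _ _ (hge i a ha.le) u hu)
  refine ⟨x, hx, m, s, Y, hs, hsk, fun i => ⟨hY i, ?_⟩, fun w hw => ?_⟩
  · rcases eq_or_ne i m with rfl | hi
    · exact hm
    · exact (hhalf i hi).trans (by gcongr; omega)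
  · obtain ⟨P, hP, hlabel, hPY⟩ := hwalk w hw
    refine ⟨P, hP, fun u hu => ?_, hPY⟩
    obtain ⟨a, ha, hua, hau⟩ := hlabel u hu
    exact ⟨e a, hua, hau, fun i => hge i a ha.le⟩

theorem IsHub.exists_walk_of_adj (hB : Pairwise (Function.onFun Disjoint B)) {φ₁ : ι₁ ↪ ι}
    {B₁ : ι₁ → Finset V} (hB₁ : ∀ i, B₁ i ⊆ B (φ₁ i)) {b : ι} (hb : ∀ i, φ₁ i ≠ b) {x : V}
    {g : κ ↪ ι₁} {Y : κ → Finset V} (hY : ∀ i, Y i ⊆ B₁ (g i)) {m : κ} {s : ℕ}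
    (h : IsHub G B φ₁ B₁ g Y x b m s)
    {φ : ι' ↪ κ} (hφ : ∀ i, φ i ≠ m) {B' : ι' → Finset V} (hB' : ∀ i, B' i ⊆ Y (φ i)) {j : ι'}
    {v w : V} (hv : v ∈ B' j) (hw : w ∈ Y m) (hwv : G.Adj w v)
    (hwB' : ∀ i ≠ j, ∀ u ∈ B' i, ¬ G.Adj w u) :
    ∃ Q : RainbowWalk G B x v b (φ₁ (g (φ j))) (s + 1),
      IsInducedPath G Q.vertex (s + 1) ∧ ∀ u ∈ Q.interior,
        (∃ l, u.1 ∈ B₁ l ∧ φ₁ l = u.2 ∧ ∀ i, l ≠ g (φ i)) ∧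
          ∀ i ≠ j, ∀ y ∈ B' i, ¬ G.Adj u.1 y := by
  obtain ⟨P, hP, hlabel, hPY⟩ := h w hw
  have hgm (i : ι') : g (φ i) ≠ g m := g.injective.ne (hφ i)
  obtain ⟨Q, hQ, hQP⟩ := P.exists_isInducedPath_append_adj hB hP (hb _).symm
    (hB₁ _ (hY _ (hB' j hv))) (hb _).symm (φ₁.injective.ne (hgm j).symm) (fun u hu => by
      obtain ⟨l, -, hlu, hl⟩ := hlabel u hu
      exact hlu ▸ φ₁.injective.ne (hl _)) hwv (fun u hu => hPY u hu _ (hφ j) v (hB' j hv))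
  refine ⟨Q, hQ, fun u hu => ?_⟩
  rcases hQP hu with rfl | hu
  · exact ⟨⟨g m, hY m hw, rfl, fun i => (hgm i).symm⟩, hwB'⟩
  · obtain ⟨l, hul, hlu, hl⟩ := hlabel u hu
    exact ⟨⟨l, hul, hlu, fun i => hl _⟩, fun i _ y hy =>
      hPY u (.inr hu) _ (hφ i) y (hB' i hy)⟩

end Linked

section LinkedBlockades

variable {c : ℝ} {k : ℕ} {σ σ' lam lam' : ℝ}

theorem eventually_exists_isHub (hc1 : c < 1) (hk : 1 < (k + 1) * c) {n : ℕ} (hn : 0 < n)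
    (hσ : 0 < σ) (hlam : 0 < lam) :
    ∀ᶠ F : GraphWithFamily.{u} in goodBlockades c,
      ∃ (φ : Fin (k + 1 + n) ↪ F.ι) (B : Fin (k + 1 + n) → Finset F.V) (b : F.ι) (D : Finset F.V)
        (g : Fin n ↪ Fin (k + 1 + n)) (Y : Fin n → Finset F.V), (∀ i, B i ⊆ F.B (φ i)) ∧
        (∀ i, Y i ⊆ B (g i)) ∧ IsBlockade F.G σ lam Y ∧ IsJoined F.G F.B φ B b D (2 * k + 4) ∧
        ∃ x ∈ D, ∃ m s, 0 < s ∧ s ≤ k + 1 ∧ IsHub F.G F.B φ B g Y x b m s := by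
  obtain ⟨σ₀, hσ₀, hσ₀c, hchain⟩ := exists_chain_parameter hc1 hk
  have hR : (0 : ℝ) < 4 * (k + 1) := by positivity
  filter_upwards [eventually_isCoherent, eventually_isBlockade one_pos one_pos,
    tendsto_card_goodBlockades.eventually_gt_atTop 0,
    eventually_exists_isJoined hc1 hk (Fin (k + 1 + n)) (σ' := min (σ / 2) σ₀)
      (lam' := min (lam / (4 * (k + 1))) (1 / 8)) (by positivity) (by positivity),
    tendsto_card_goodBlockades.eventually hchain,
    tendsto_card_goodBlockades.eventually
      (eventually_mul_rpow_le (by linarith : 1 - c < 1 - σ₀) 2),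
    tendsto_card_goodBlockades.eventually
      (eventually_mul_rpow_le (by linarith : 1 - σ < 1 - σ / 2) (4 * (k + 1)))]
    with F hG hFB hN ⟨φ, B, b, D, hBF, hB, hD, hJ⟩ ⟨t, ht, htk⟩ hγ hR'
  have : Nonempty F.V := Fintype.card_pos_iff.1 hN
  have hB₀ := hB.mono (min_le_right _ _) (min_le_right _ _)
  obtain ⟨e, g, he, hge⟩ := exists_injOn_and_embedding (ι := Fin (k + 1 + n)) k n (by simp)
  have : Nonempty (Fin n) := ⟨⟨0, hn⟩⟩
  obtain ⟨x, hx, m, s, Y, hs, hsk, hY, hub⟩ := hJ.exists_isHub (by positivity) hG htk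
    hFB.disjoint hBF (hγ.trans (hD.trans' (Real.rpow_le_rpow_of_exponent_le
      (mod_cast hN) (by linarith [min_le_right (σ / 2) σ₀]))))
    (fun i => hγ.trans (hB₀.le_card i))
    (fun i => mod_cast ht.trans (hB₀.le_card i)) he hge (fun i j hij u hu => by
      have := hB₀.hasLinkage i j hij u hu
      have : (8 : ℝ) * #(neighborsIn F.G u (B j)) ≤ #(B j) := by linarith
      exact_mod_cast this)
  refine ⟨φ, B, b, D, g, Y, hBF, fun i => (hY i).1, ?_, hJ, x, hx, m, s, hs, hsk, hub⟩
  have := (hB.mono (min_le_left _ _) (min_le_left _ _)).shrink g (fun i => (hY i).1)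
    (by positivity) hR (fun i => mod_cast (hY i).2) hR'
  rwa [mul_div_cancel₀ _ hR.ne'] at this

theorem eventually_exists_isLinked_le (hc1 : c < 1) (hk : 1 < (k + 1) * c) (ι' : Type*) [Finite ι']
    (hσ' : 0 < σ') (hlam' : 0 < lam') :
    ∀ᶠ F : GraphWithFamily.{u} in goodBlockades c,
      ∃ (φ : ι' ↪ F.ι) (B' : ι' → Finset F.V), (∀ i, B' i ⊆ F.B (φ i)) ∧
        IsBlockade F.G σ' lam' B' ∧ ∃ ℓ, 2 ≤ ℓ ∧ ℓ ≤ 3 * k + 5 ∧ IsLinked ℓ F.G F.B φ B' := by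
  obtain ⟨K, σ, lam, hσ, hlam, hpriv⟩ := exists_eventually_forall_isBlockade <|
    eventually_exists_private_neighbors.{u} (pos_of_one_lt_succ_mul hk) ι' hσ' hlam'
  have hT : (0 : ℝ) < 2 * k + 4 := by positivity
  filter_upwards [hpriv, eventually_isBlockade one_pos one_pos,
    eventually_exists_isHub hc1 hk (n := (2 * k + 4) * (K + 1)) (by positivity) (half_pos hσ)
      (by positivity : 0 < lam / (2 * k + 4)),
    tendsto_card_goodBlockades.eventually
      (eventually_mul_rpow_le (by linarith : 1 - σ < 1 - σ / 2) (2 * k + 4))]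
    with F hpriv hB ⟨φ₁, B₁, b, D, g, Y, hB₁, hYB₁, hY, hJ, x, hx, m, s, hs, hsk, hub⟩ hR
  obtain ⟨r, S, Z, hr, hS, hZ, hP⟩ := exists_uniform_length Y
    (P := fun i v r => ∃ P : RainbowWalk F.G F.B x v b (φ₁ (g i)) r,
      IsInducedPath F.G P.vertex r ∧ P.Avoids φ₁ B₁ {g i})
    (fun i v hv => hJ.path x hx (g i) v (hYB₁ i hv)) (by positivity)
    (Fintype.card_fin ((2 * k + 4) * (K + 1))).ge
  have hZ' : IsBlockade F.G σ lam fun i : {i // i ∈ insert m S} => Z i := by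
    have := hY.shrink (.subtype (· ∈ insert m S)) (fun i => (hZ i).1) (by positivity) hT
      (fun i => mod_cast (hZ i).2) hR
    rwa [mul_div_cancel₀ _ hT.ne'] at this
  obtain ⟨φ, B', hB'Z, hB', hφ, hw⟩ := hpriv {i // i ∈ insert m S} (fun i => Z i)
    (by rw [Fintype.card_coe]; linarith [card_le_card (subset_insert m S)]) hZ'
    ⟨m, mem_insert_self _ _⟩ ⟨m, mem_insert_self _ _⟩
  let ψ : ι' ↪ Fin _ := φ.trans (.subtype _)
  have hψm (i : ι') : ψ i ≠ m := fun h => (hφ i).1 (Subtype.ext h)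
  have hψS (i : ι') : ψ i ∈ S := (mem_insert.1 (φ i).2).resolve_left (hψm i)
  have hB'Y (i : ι') : B' i ⊆ Y (ψ i) := (hB'Z i).trans (hZ _).1
  have hB'B₁ (i : ι') : B' i ⊆ B₁ (g (ψ i)) := (hB'Y i).trans (hYB₁ _)
  refine ⟨(ψ.trans g).trans φ₁, B', fun i => (hB'B₁ i).trans (hB₁ _), hB', r + (s + 1), by omega,
    by omega, isLinked_of_walks φ₁ (ψ.trans g) hB'B₁ hJ.ne ?_
      (fun i v hv => hP _ (hψS i) v (hB'Z i hv)) fun j v hv => ?_⟩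
  · intro i y hy
    obtain ⟨w, hwm, -⟩ := hw i y hy
    obtain ⟨_, _, _, hxY⟩ := hub w ((hZ m).1 hwm)
    exact hxY _ (.inl rfl) (ψ i) (hψm i) y (hB'Y i hy)
  · obtain ⟨w, hwm, hwv, hwB'⟩ := hw j v hv
    exact hub.exists_walk_of_adj hB.disjoint hB₁ hJ.ne hYB₁ hψm hB'Y hv ((hZ m).1 hwm) hwv hwB'

theorem eventually_exists_isLinked (hc1 : c < 1) (hk : 1 < (k + 1) * c) (ι' : Type) [Finite ι']
    (hσ' : 0 < σ') (hlam' : 0 < lam') :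
    ∀ᶠ F : GraphWithFamily.{u} in goodBlockades c,
      ∃ (φ : ι' ↪ F.ι) (B' : ι' → Finset F.V), (∀ i, B' i ⊆ F.B (φ i)) ∧
        IsBlockade F.G σ' lam' B' ∧ IsLinked (3 * k + 5) F.G F.B φ B' := by
  suffices key : ∀ s, s + 2 ≤ 3 * k + 5 → ∀ (ι' : Type) [Finite ι'] {σ' lam' : ℝ}, 0 < σ' →
      0 < lam' → ∀ᶠ F : GraphWithFamily.{u} in goodBlockades c,
        ∃ (φ : ι' ↪ F.ι) (B' : ι' → Finset F.V), (∀ i, B' i ⊆ F.B (φ i)) ∧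
          IsBlockade F.G σ' lam' B' ∧
          ∃ ℓ, s + 2 ≤ ℓ ∧ ℓ ≤ 3 * k + 5 ∧ IsLinked ℓ F.G F.B φ B' by
    filter_upwards [key (3 * k + 3) le_rfl ι' hσ' hlam']
      with F ⟨φ, B', hB'F, hB', ℓ, hℓ, hℓ', h⟩
    exact ⟨φ, B', hB'F, hB', (by omega : ℓ = 3 * k + 5) ▸ h⟩
  intro s
  induction s with
  | zero => exact fun _ ι' _ _ _ hσ' hlam' => eventually_exists_isLinked_le hc1 hk ι' hσ' hlam'
  | succ s ih =>
    intro hs ι' _ σ' lam' hσ' hlam'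
    obtain ⟨K, σ, lam, hσ, hlam, hpriv⟩ := exists_eventually_forall_isBlockade <|
      eventually_exists_private_neighbors.{u} (pos_of_one_lt_succ_mul hk) ι' hσ' hlam'
    filter_upwards [hpriv, eventually_isBlockade one_pos one_pos,
      ih (by omega) (Fin (K + 1)) hσ hlam]
      with F hpriv hB ⟨φ₁, B₁, hB₁F, hB₁, ℓ, hsℓ, hℓ, h⟩
    obtain ⟨φ₂, B₂, hB₂B₁, hB₂, hm, hw⟩ := hpriv (Fin (K + 1)) B₁ (by simp) hB₁ 0 0
    refine ⟨φ₂.trans φ₁, B₂, fun i => (hB₂B₁ i).trans (hB₁F _), hB₂, ?_⟩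
    rcases hℓ.lt_or_eq with hlt | heq
    · exact ⟨1 + ℓ, by omega, by omega,
        h.extend (by omega) hB.disjoint hB₁F φ₂ hB₂B₁ (fun i => (hm i).1) hw⟩
    · exact ⟨ℓ, by omega, hℓ, h.restrict φ₂ hB₂B₁⟩

end LinkedBlockades

section Ears

variable {W : Type*} {H : SimpleGraph W} {S T : Finset W} {d : ℝ} {L : ℕ}

/-- The graph `H[S]` has congestion at most `d`. The edges of the induced subgraphs `H[T]` are
counted by half the degree sum. -/
def HasCongestionLE (H : SimpleGraph W) (d : ℝ) (S : Finset W) : Prop :=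
  ∀ T ⊆ S, T.Nonempty → (1 - d) * ∑ v ∈ T, (#(neighborsIn H v T) : ℝ) ≤ 2 * (#T - 1)

theorem HasCongestionLE.mono (h : HasCongestionLE H d S) (hTS : T ⊆ S) : HasCongestionLE H d T :=
  fun T' hT' => h T' (hT'.trans hTS)

theorem HasCongestionLE.one_le_mul_card (h : HasCongestionLE H d S) (hd : d ≤ 1)
    (hS : S.Nonempty) (hdeg : ∀ v ∈ S, 2 ≤ #(neighborsIn H v S)) : 1 ≤ d * #S := by
  have hsum : (#S : ℝ) * 2 ≤ ∑ v ∈ S, (#(neighborsIn H v S) : ℝ) := by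
    rw [← nsmul_eq_mul]
    exact card_nsmul_le_sum _ _ _ fun v hv => mod_cast hdeg v hv
  have : (1 - d) * (#S * 2) ≤ (1 - d) * ∑ v ∈ S, (#(neighborsIn H v S) : ℝ) := by
    gcongr
  linarith [h S subset_rfl hS]

/-- `p` is an infinite walk in `H[S]` that never immediately returns along an edge. -/
structure IsNonbacktracking (H : SimpleGraph W) (S : Finset W) (p : ℕ → W) : Prop where
  mem : ∀ n, p n ∈ S
  adj : ∀ n, H.Adj (p n) (p (n + 1))
  ne : ∀ n, p n ≠ p (n + 2)

/-- The vertices `q 0, …, q L` form a path in `H[S]` whose interior vertices have no neighbours in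
`S` outside the path. -/
structure IsEar (H : SimpleGraph W) (S : Finset W) (q : ℕ → W) (L : ℕ) : Prop where
  mem : ∀ a ≤ L, q a ∈ S
  injOn : Set.InjOn q (Set.Iic L)
  adj : ∀ a < L, H.Adj (q a) (q (a + 1))
  eq_or_eq : ∀ a, a + 1 < L → ∀ u ∈ S, H.Adj (q (a + 1)) u → u = q a ∨ u = q (a + 2)

theorem two_le_card_neighborsIn {v x y : W} (hx : x ∈ S) (hy : y ∈ S) (hxy : x ≠ y)
    (hvx : H.Adj v x) (hvy : H.Adj v y) : 2 ≤ #(neighborsIn H v S) :=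
  one_lt_card.2 ⟨x, mem_neighborsIn.2 ⟨hx, hvx⟩, y, mem_neighborsIn.2 ⟨hy, hvy⟩, hxy⟩

namespace IsNonbacktracking

variable {p p' : ℕ → W}

theorem shift (h : IsNonbacktracking H S p) (i : ℕ) : IsNonbacktracking H S fun n => p (i + n) :=
  ⟨fun _ => h.mem _, fun _ => h.adj _, fun _ => h.ne _⟩

theorem eq_or_eq (h : IsNonbacktracking H S p) {n : ℕ} (hn : #(neighborsIn H (p (n + 1)) S) < 3)
    {u : W} (hu : u ∈ S) (hadj : H.Adj (p (n + 1)) u) : u = p n ∨ u = p (n + 2) := by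
  by_contra! hne
  exact hn.not_ge <| two_lt_card.2 ⟨u, mem_neighborsIn.2 ⟨hu, hadj⟩,
    p n, mem_neighborsIn.2 ⟨h.mem n, (h.adj n).symm⟩,
    p (n + 2), mem_neighborsIn.2 ⟨h.mem _, h.adj (n + 1)⟩, hne.1, hne.2, h.ne n⟩

theorem eq_of_eq_of_card_lt (h : IsNonbacktracking H S p) (h' : IsNonbacktracking H S p') {i : ℕ}
    (hdeg : ∀ a < i, #(neighborsIn H (p (a + 1)) S) < 3) (hi : p i = p' i)
    (hi' : p (i + 1) = p' (i + 1)) : p 0 = p' 0 ∧ p 1 = p' 1 := by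
  induction i with
  | zero => exact ⟨hi, hi'⟩
  | succ i ih =>
    refine ih (fun a ha => hdeg a (ha.trans i.lt_succ_self)) ?_ hi
    have hadj : H.Adj (p (i + 1)) (p' i) := hi ▸ (h'.adj i).symm
    exact ((h.eq_or_eq (hdeg i i.lt_succ_self) (h'.mem i) hadj).resolve_right
      fun heq => h'.ne i (heq.trans hi')).symm

theorem exists_of_closed (h : IsNonbacktracking H S p) {g : ℕ} (hg : 0 < g) (hpg : p 0 = p g)
    (hinj : Set.InjOn p (Set.Iio g)) :
    ∃ T ⊆ S, T.Nonempty ∧ #T ≤ g ∧ ∀ v ∈ T, 2 ≤ #(neighborsIn H v T) := by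
  classical
  have hmem : ∀ a ≤ g, p a ∈ (range g).image p := fun a ha => by
    rcases ha.lt_or_eq with ha | rfl
    · exact mem_image_of_mem p (mem_range.2 ha)
    · exact hpg ▸ mem_image_of_mem p (mem_range.2 hg)
  refine ⟨(range g).image p, image_subset_iff.2 fun _ _ => h.mem _, ⟨p 0, hmem 0 hg.le⟩,
    card_image_le.trans (card_range g).le, forall_mem_image.2 fun a ha => ?_⟩
  have ha := mem_range.1 ha
  cases a with
  | zero =>
    obtain ⟨g, rfl⟩ := Nat.exists_eq_add_one.2 hg
    have hg0 : g ≠ 0 := by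
      rintro rfl
      exact (h.adj 0).ne hpg
    have hg1 : g ≠ 1 := by
      rintro rfl
      exact h.ne 0 hpg
    exact two_le_card_neighborsIn (hmem 1 (by omega)) (hmem g (by omega))
      (hinj.ne (Set.mem_Iio.2 (by omega)) (Set.mem_Iio.2 (by omega)) hg1.symm) (h.adj 0)
      (hpg ▸ (h.adj g).symm)
  | succ a =>
    exact two_le_card_neighborsIn (hmem a (by omega)) (hmem (a + 2) (by omega)) (h.ne a)
      (h.adj a).symm (h.adj (a + 1))

theorem exists_of_not_injOn (h : IsNonbacktracking H S p) (hinj : ¬ Set.InjOn p (Set.Iic L)) :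
    ∃ T ⊆ S, T.Nonempty ∧ #T ≤ L ∧ ∀ v ∈ T, 2 ≤ #(neighborsIn H v T) := by
  classical
  have hex : ∃ g, 0 < g ∧ ∃ i, i + g ≤ L ∧ p i = p (i + g) := by
    obtain ⟨a, b, hab, hb, hpab⟩ : ∃ a b, a < b ∧ b ≤ L ∧ p a = p b := by
      simp only [Set.InjOn, not_forall] at hinj
      obtain ⟨a, ha, b, hb, hpab, hne⟩ := hinj
      rcases lt_or_gt_of_ne hne with hab | hba
      exacts [⟨a, b, hab, hb, hpab⟩, ⟨b, a, hba, ha, hpab.symm⟩]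
    exact ⟨b - a, by omega, a, by omega, by rwa [Nat.add_sub_of_le hab.le]⟩
  obtain ⟨hg, i, hi, hpi⟩ := Nat.find_spec hex
  have hmin : ∀ a b, a < b → b < Nat.find hex → p (i + a) ≠ p (i + b) := fun a b hab hb hpab =>
    Nat.find_min hex (by omega : b - a < Nat.find hex)
      ⟨by omega, i + a, by omega, by rwa [add_assoc, Nat.add_sub_of_le hab.le]⟩
  obtain ⟨T, hTS, hT, hcard, hdeg⟩ := (h.shift i).exists_of_closed hg hpi fun a ha b hb hab => by
    by_contra hne
    rcases lt_or_gt_of_ne hne with hlt | hlt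
    exacts [hmin a b hlt hb hab, hmin b a hlt ha hab.symm]
  exact ⟨T, hTS, hT, by omega, hdeg⟩

theorem isEar (h : IsNonbacktracking H S p) (hinj : Set.InjOn p (Set.Iic L))
    (hdeg : ∀ a, a + 1 < L → #(neighborsIn H (p (a + 1)) S) < 3) : IsEar H S p L where
  mem a _ := h.mem a
  injOn := hinj
  adj a _ := h.adj a
  eq_or_eq a ha _ hu hadj := h.eq_or_eq (hdeg a ha) hu hadj

end IsNonbacktracking

theorem exists_isNonbacktracking (hdeg : ∀ v ∈ S, 2 ≤ #(neighborsIn H v S)) {v w : W} (hv : v ∈ S)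
    (hw : w ∈ neighborsIn H v S) : ∃ p, IsNonbacktracking H S p ∧ p 0 = v ∧ p 1 = w := by
  have hnext (a b : W) (hb : b ∈ S) : ∃ c ∈ neighborsIn H b S, c ≠ a :=
    exists_mem_ne (hdeg b hb) a
  choose! o ho hoa using hnext
  let step (x : W × W) : W × W := (x.2, o x.1 x.2)
  have hsucc (n : ℕ) : step^[n + 1] (v, w) = step (step^[n] (v, w)) :=
    Function.iterate_succ_apply' _ _ _
  have hiter (n : ℕ) : (step^[n] (v, w)).1 ∈ S ∧
      (step^[n] (v, w)).2 ∈ neighborsIn H (step^[n] (v, w)).1 S := by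
    induction n with
    | zero => exact ⟨hv, hw⟩
    | succ n ih =>
      have := (mem_neighborsIn.1 ih.2).1
      exact hsucc n ▸ ⟨this, ho _ _ this⟩
  refine ⟨fun n => (step^[n] (v, w)).1, ⟨fun n => (hiter n).1, fun n => ?_, fun n => ?_⟩, rfl, rfl⟩
  · rw [hsucc]
    exact (mem_neighborsIn.1 (hiter n).2).2
  · rw [hsucc, hsucc]
    exact (hoa _ _ (mem_neighborsIn.1 (hiter n).2).1).symm

theorem sum_card_neighborsIn_le_of_forall_exists_branch
    (hdeg : ∀ v ∈ S, 2 ≤ #(neighborsIn H v S))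
    (hbranch : ∀ p, IsNonbacktracking H S p → ∃ a, a + 1 < L ∧ 3 ≤ #(neighborsIn H (p (a + 1)) S)) :
    ∑ v ∈ S, #(neighborsIn H v S) ≤
      (L - 1) * ∑ v ∈ S with 3 ≤ #(neighborsIn H v S), #(neighborsIn H v S) := by
  classical
  rcases S.eq_empty_or_nonempty with rfl | hS
  · simp
  have : Nonempty W := hS.to_type
  have hwalk (x : Σ _ : W, W) (hx : x ∈ S.sigma fun v => neighborsIn H v S) :
      ∃ p a, IsNonbacktracking H S p ∧ p 0 = x.1 ∧ p 1 = x.2 ∧ a + 1 < L ∧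
        3 ≤ #(neighborsIn H (p (a + 1)) S) ∧ ∀ b < a, #(neighborsIn H (p (b + 1)) S) < 3 := by
    obtain ⟨hv, hw⟩ := mem_sigma.1 hx
    obtain ⟨p, hp, hp0, hp1⟩ := exists_isNonbacktracking hdeg hv hw
    obtain ⟨haL, ha⟩ := Nat.find_spec (hbranch p hp)
    refine ⟨p, _, hp, hp0, hp1, haL, ha, fun b hb => ?_⟩
    by_contra! h
    exact Nat.find_min (hbranch p hp) hb ⟨by omega, h⟩
  choose! p a hp hp0 hp1 haL ha hmin using hwalk
  -- Read backwards from its first branch vertex, a walk is determined by that vertex, its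
  -- predecessor and the number of steps.
  rw [← card_sigma, ← card_sigma, ← card_range (L - 1), ← card_product]
  refine card_le_card_of_injOn (fun x => (a x, ⟨p x (a x + 1), p x (a x)⟩)) (fun x hx => ?_) ?_
  · simp only [coe_product, Set.mem_prod, mem_coe, mem_range, mem_sigma, mem_filter,
      mem_neighborsIn]
    have := haL x hx
    exact ⟨by omega, ⟨(hp x hx).mem _, ha x hx⟩, (hp x hx).mem _, ((hp x hx).adj _).symm⟩
  · rintro x hx y hy hxy
    simp only [Prod.mk.injEq, Sigma.mk.injEq, heq_eq_eq] at hxy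
    obtain ⟨haxy, hxy1, hxy0⟩ := hxy
    rw [← haxy] at hxy0 hxy1
    obtain ⟨h0, h1⟩ := (hp x hx).eq_of_eq_of_card_lt (hp y hy) (hmin x hx) hxy0 hxy1
    rw [hp0 x hx, hp0 y hy] at h0
    rw [hp1 x hx, hp1 y hy] at h1
    exact Sigma.ext h0 (heq_of_eq h1)

theorem sum_card_neighborsIn_filter_add_le (hdeg : ∀ v ∈ S, 2 ≤ #(neighborsIn H v S)) :
    ∑ v ∈ S with 3 ≤ #(neighborsIn H v S), #(neighborsIn H v S) + 6 * #S ≤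
      3 * ∑ v ∈ S, #(neighborsIn H v S) := by
  rw [sum_filter, mul_comm 6, ← smul_eq_mul, ← sum_const, ← sum_add_distrib, mul_sum]
  refine sum_le_sum fun v hv => ?_
  have := hdeg v hv
  split_ifs <;> omega

theorem HasCongestionLE.exists_isEar (h : HasCongestionLE H d S) (hS : S.Nonempty)
    (hdeg : ∀ v ∈ S, 2 ≤ #(neighborsIn H v S)) (hL : 0 < L) (hd : 3 * L * d ≤ 1) :
    ∃ q, IsEar H S q L := by
  by_contra! hno
  have hL1 : (1 : ℝ) ≤ L := mod_cast hL
  have hd1 : d ≤ 1 / 3 := by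
    by_contra! h
    nlinarith
  have hbranch (p : ℕ → W) (hp : IsNonbacktracking H S p) :
      ∃ a, a + 1 < L ∧ 3 ≤ #(neighborsIn H (p (a + 1)) S) := by
    by_contra! hlt
    obtain ⟨T, hTS, hT, hTL, hTdeg⟩ :=
      hp.exists_of_not_injOn fun hinj => hno p (hp.isEar hinj hlt)
    have hdT := (h.mono hTS).one_le_mul_card (by linarith) hT hTdeg
    have hd0 : 0 < d := pos_of_mul_pos_left (one_pos.trans_le hdT) (by positivity)
    have : d * #T ≤ d * L := by gcongr
    linarith
  have hsum := sum_card_neighborsIn_le_of_forall_exists_branch hdeg hbranch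
  have hbig := sum_card_neighborsIn_filter_add_le hdeg
  have hcong := h S subset_rfl hS
  have hd0 : 0 < d := pos_of_mul_pos_left
    (one_pos.trans_le (h.one_le_mul_card (by linarith) hS hdeg)) (by positivity)
  have hS0 := hS.card_pos
  rw [← Nat.cast_sum] at hcong
  generalize ∑ v ∈ S, #(neighborsIn H v S) = E at *
  generalize ∑ v ∈ S with 3 ≤ #(neighborsIn H v S), #(neighborsIn H v S) = E' at *
  have hE : 0 < E := by omega
  rify [hL] at hsum hbig hE
  have hLE : 3 * L * d * E ≤ 1 * E := by gcongr
  have : (E : ℝ) ≤ (L - 1) * (3 * (d * E) - 6) := hsum.trans (by gcongr; linarith)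
  linarith [mul_pos hd0 hE]

end Ears

section RainbowCopies

variable {V W ι ι' : Type*} {G : SimpleGraph V} {B : ι → Finset V} {B' : ι' → Finset V}
  {H : SimpleGraph W} {S T : Finset W} {f g : W → V} {φ ψ : W → ι}

/-- The map `f` embeds `H[S]` in `G` as an induced subgraph, and its vertices lie in distinct
members of the family `B`, given by `φ`. -/
structure IsRainbowCopy (G : SimpleGraph V) (B : ι → Finset V) (H : SimpleGraph W) (S : Finset W)
    (f : W → V) (φ : W → ι) : Prop where
  mem : ∀ x ∈ S, f x ∈ B (φ x)
  injOn : Set.InjOn φ S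
  adj_iff : ∀ x ∈ S, ∀ y ∈ S, G.Adj (f x) (f y) ↔ H.Adj x y

namespace IsRainbowCopy

theorem isIndContained [Fintype W] (h : IsRainbowCopy G B H univ f φ)
    (hB : Pairwise (Function.onFun Disjoint B)) : H.IsIndContained G :=
  ⟨⟨⟨f, fun x y hxy => h.injOn (mem_coe.2 (mem_univ x)) (mem_coe.2 (mem_univ y)) <|
    hB.eq fun hd => disjoint_left.1 hd (h.mem x (mem_univ x)) (hxy ▸ h.mem y (mem_univ y))⟩,
    fun {x y} => h.adj_iff x (mem_univ x) y (mem_univ y)⟩⟩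

theorem of_subset {φ : W → ι'} (h : IsRainbowCopy G B' H S f φ) (φ' : ι' ↪ ι)
    (hB' : ∀ i, B' i ⊆ B (φ' i)) : IsRainbowCopy G B H S f (φ' ∘ φ) where
  mem x hx := hB' _ (h.mem x hx)
  injOn := φ'.injective.comp_injOn h.injOn
  adj_iff := h.adj_iff

theorem union [DecidableEq W] (hf : IsRainbowCopy G B H S f φ) (hg : IsRainbowCopy G B H T g ψ)
    (hφψ : ∀ x ∈ S, ∀ y ∈ T, φ x ≠ ψ y)
    (hadj : ∀ x ∈ S, ∀ y ∈ T, G.Adj (f x) (g y) ↔ H.Adj x y) :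
    IsRainbowCopy G B H (S ∪ T) (S.piecewise f g) (S.piecewise φ ψ) where
  mem x hx := by
    by_cases hxS : x ∈ S
    · simpa only [S.piecewise_eq_of_mem _ _ hxS] using hf.mem x hxS
    · simpa only [S.piecewise_eq_of_notMem _ _ hxS] using
        hg.mem x ((mem_union.1 hx).resolve_left hxS)
  injOn x hx y hy hxy := by
    have hT {z : W} (hz : z ∈ ((S ∪ T : Finset W) : Set W)) (hzS : z ∉ S) : z ∈ T :=
      (mem_union.1 hz).resolve_left hzS
    by_cases hxS : x ∈ S <;> by_cases hyS : y ∈ S <;>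
      simp only [piecewise_eq_of_mem, piecewise_eq_of_notMem, hxS, hyS, not_false_eq_true] at hxy
    · exact hf.injOn hxS hyS hxy
    · exact absurd hxy (hφψ x hxS y (hT hy hyS))
    · exact absurd hxy.symm (hφψ y hyS x (hT hx hxS))
    · exact hg.injOn (hT hx hxS) (hT hy hyS) hxy
  adj_iff x hx y hy := by
    by_cases hxS : x ∈ S <;> by_cases hyS : y ∈ S <;>
      simp only [piecewise_eq_of_mem, piecewise_eq_of_notMem, hxS, hyS, not_false_eq_true]
    · exact hf.adj_iff x hxS y hyS
    · exact hadj x hxS y ((mem_union.1 hy).resolve_left hyS)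
    · rw [G.adj_comm, H.adj_comm]
      exact hadj y hyS x ((mem_union.1 hx).resolve_left hxS)
    · exact hg.adj_iff x ((mem_union.1 hx).resolve_left hxS) y ((mem_union.1 hy).resolve_left hyS)

theorem singleton {x : W} {w : V} {m : ι} (hw : w ∈ B m) :
    IsRainbowCopy G B H {x} (fun _ => w) fun _ => m where
  mem _ _ := hw
  injOn := by simp
  adj_iff := by simp

theorem exists_adj_iff_of_leaf [Fintype ι'] {φ : W → ι'} (h : IsRainbowCopy G B' H S f φ)
    (hS : #S < Fintype.card ι') (hB' : ∀ i, (B' i).Nonempty) {M : Finset V}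
    (hpriv : ∀ i, ∀ v ∈ B' i, ∃ w ∈ M, G.Adj w v ∧ ∀ j ≠ i, ∀ u ∈ B' j, ¬ G.Adj w u) {x : W}
    (hleaf : #(neighborsIn H x S) ≤ 1) : ∃ w ∈ M, ∀ y ∈ S, G.Adj w (f y) ↔ H.Adj x y := by
  classical
  by_cases hx : ∃ y ∈ S, H.Adj x y
  · obtain ⟨y, hy, hxy⟩ := hx
    obtain ⟨w, hwM, hwy, hw⟩ := hpriv (φ y) (f y) (h.mem y hy)
    refine ⟨w, hwM, fun z hz => ?_⟩
    rcases eq_or_ne z y with rfl | hzy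
    · exact iff_of_true hwy hxy
    · exact iff_of_false (hw (φ z) (h.injOn.ne hz hy hzy) _ (h.mem z hz)) fun hxz =>
        hzy (card_le_one.1 hleaf z (mem_neighborsIn.2 ⟨hz, hxz⟩) y (mem_neighborsIn.2 ⟨hy, hxy⟩))
  · push Not at hx
    obtain ⟨j, -, hj⟩ := exists_mem_notMem_of_card_lt_card
      (card_image_le.trans_lt hS : #(S.image φ) < #(univ : Finset ι'))
    obtain ⟨v, hv⟩ := hB' j
    obtain ⟨w, hwM, -, hw⟩ := hpriv j v hv
    exact ⟨w, hwM, fun y hy => iff_of_false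
      (hw (φ y) (fun h => hj (h ▸ mem_image_of_mem φ hy)) _ (h.mem y hy)) (hx y hy)⟩

end IsRainbowCopy

theorem IsInducedUpToEnds.adj_iff_adj {p : ℕ → V} {q : ℕ → W} {r : ℕ}
    (hp : IsInducedUpToEnds G p r) (hq : IsInducedUpToEnds H q r) {a b : ℕ} (ha : a ∈ Set.Ioo 0 r)
    (hb : b ≤ r) : G.Adj (p a) (p b) ↔ H.Adj (q a) (q b) := by
  have ha0 := ha.1
  have har := ha.2
  rcases lt_trichotomy a b with hab | rfl | hba
  · rw [hp a b hab hb (by omega), hq a b hab hb (by omega)]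
  · simp
  · rw [G.adj_comm, H.adj_comm, hp b a hba har.le (by omega), hq b a hba har.le (by omega)]

theorem IsEar.isInducedUpToEnds {q : ℕ → W} {L : ℕ} (hq : IsEar H S q L) :
    IsInducedUpToEnds H q L := by
  refine fun a b hab hb hends => ⟨fun h => ?_, by rintro rfl; exact hq.adj a hb⟩
  rcases a.eq_zero_or_pos with rfl | ha
  · obtain ⟨b, rfl⟩ := Nat.exists_eq_add_one.2 hab
    have hbL : b + 1 < L := lt_of_le_of_ne hb (hends rfl)
    rcases hq.eq_or_eq b hbL _ (hq.mem 0 L.zero_le) h.symm with h | h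
    · rw [hq.injOn L.zero_le (by grind) h]
    · exact absurd (hq.injOn L.zero_le (by grind) h) (by omega)
  · obtain ⟨a, rfl⟩ := Nat.exists_eq_add_one.2 ha
    rcases hq.eq_or_eq a (hab.trans_le hb) _ (hq.mem b hb) h with h | h
    · exact absurd (hq.injOn hb (by grind) h) (by omega)
    · exact hq.injOn hb (by grind) h

theorem RainbowWalk.exists_isRainbowCopy_interior [DecidableEq W] {x y : V} {i j : ι} {r : ℕ}
    (P : RainbowWalk G B x y i j r) (hP : IsInducedUpToEnds G P.vertex r) {q : ℕ → W}
    (hqinj : Set.InjOn q (Set.Iic r)) (hq : IsInducedUpToEnds H q r) :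
    ∃ (g : W → V) (ψ : W → ι), IsRainbowCopy G B H ((Ioo 0 r).image q) g ψ ∧
      ∀ a ∈ Set.Ioo 0 r, g (q a) = P.vertex a ∧ ψ (q a) = P.label a := by
  have hinv : ∀ a ∈ Set.Ioo 0 r, Function.invFunOn q (Set.Iic r) (q a) = a := fun a ha =>
    hqinj.leftInvOn_invFunOn ha.2.le
  refine ⟨P.vertex ∘ Function.invFunOn q (Set.Iic r), P.label ∘ Function.invFunOn q (Set.Iic r),
    ⟨?_, ?_, ?_⟩, fun a ha => by simp only [Function.comp_apply, hinv a ha, and_self]⟩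
  · refine forall_mem_image.2 fun a ha => ?_
    have ha := mem_Ioo.1 ha
    simpa only [Function.comp_apply, hinv a ha] using P.mem a ha.2.le
  · rw [coe_image, coe_Ioo]
    rintro _ ⟨a, ha, rfl⟩ _ ⟨b, hb, rfl⟩ hab
    simp only [Function.comp_apply, hinv a ha, hinv b hb] at hab
    rw [P.injOn_label ha.2.le hb.2.le hab]
  · refine forall_mem_image.2 fun a ha => forall_mem_image.2 fun b hb => ?_
    have ha := mem_Ioo.1 ha
    have hb := mem_Ioo.1 hb
    simpa only [Function.comp_apply, hinv a ha, hinv b hb] using hP.adj_iff_adj hq ha hb.2.le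

theorem IsEar.image_interior_subset [DecidableEq W] {q : ℕ → W} {L : ℕ} (hq : IsEar H S q L) :
    (Ioo 0 L).image q ⊆ S :=
  image_subset_iff.2 fun a ha => hq.mem a (mem_Ioo.1 ha).2.le

theorem IsEar.mem_sdiff_interior [DecidableEq W] {q : ℕ → W} {L a : ℕ} (hq : IsEar H S q L)
    (ha : a ≤ L) (haL : a ∉ Set.Ioo 0 L) : q a ∈ S \ (Ioo 0 L).image q := by
  refine mem_sdiff.2 ⟨hq.mem a ha, fun h => ?_⟩
  obtain ⟨b, hb, hba⟩ := mem_image.1 h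
  have hb := mem_Ioo.1 hb
  exact haL (hq.injOn hb.2.le ha hba ▸ hb)

theorem IsEar.not_adj [DecidableEq W] {q : ℕ → W} {L a : ℕ} (hq : IsEar H S q L)
    (ha : a ∈ Set.Ioo 0 L) {x : W} (hx : x ∈ S \ (Ioo 0 L).image q) (hx0 : x ≠ q 0)
    (hxL : x ≠ q L) : ¬ H.Adj x (q a) := fun h => by
  have hne {b : ℕ} (hb : b ≤ L) : x ≠ q b := by
    rcases eq_or_ne b 0 with rfl | hb0
    · exact hx0
    rcases eq_or_ne b L with rfl | hbL
    · exact hxL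
    · rintro rfl
      exact (mem_sdiff.1 hx).2 (mem_image_of_mem q (mem_Ioo.2 (by omega)))
  obtain ⟨b, rfl⟩ := Nat.exists_eq_add_one.2 ha.1
  have hb := ha.2
  rcases hq.eq_or_eq b hb x (mem_sdiff.1 hx).1 h.symm with h | h
  · exact hne (by omega) h
  · exact hne (by omega) h

theorem IsRainbowCopy.exists_of_isEar [DecidableEq W] {q : ℕ → W} {L : ℕ} (hq : IsEar H S q L)
    {φ : W → ι'} (h : IsRainbowCopy G B' H (S \ (Ioo 0 L).image q) f φ) (φ' : ι' ↪ ι)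
    (hB' : ∀ i, B' i ⊆ B (φ' i))
    (P : RainbowWalk G B (f (q 0)) (f (q L)) (φ' (φ (q 0))) (φ' (φ (q L))) L)
    (hP : IsInducedUpToEnds G P.vertex L) (hPB' : P.Avoids φ' B' {φ (q 0), φ (q L)}) :
    ∃ f φ, IsRainbowCopy G B H S f φ := by
  have hq' := hq.isInducedUpToEnds
  obtain ⟨g, ψ, hg, hgψ⟩ := P.exists_isRainbowCopy_interior hP hq.injOn hq'
  have hq0 := hq.mem_sdiff_interior L.zero_le fun h => h.1.ne rfl
  have hqL := hq.mem_sdiff_interior le_rfl fun h => h.2.ne rfl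
  rw [← sdiff_union_of_subset hq.image_interior_subset]
  refine ⟨_, _, (h.of_subset φ' hB').union hg (fun x _ => forall_mem_image.2 fun a ha => ?_)
    fun x hx => forall_mem_image.2 fun a ha => ?_⟩
  · rw [(hgψ a (mem_Ioo.1 ha)).2]
    exact ((hPB' _ (P.mem_interior (mem_Ioo.1 ha))).1 _).symm
  · have ha := mem_Ioo.1 ha
    rw [(hgψ a ha).1, G.adj_comm, H.adj_comm]
    rcases eq_or_ne x (q 0) with rfl | hx0
    · simpa only [P.vertex_zero] using hP.adj_iff_adj hq' ha L.zero_le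
    rcases eq_or_ne x (q L) with rfl | hxL
    · simpa only [P.vertex_length] using hP.adj_iff_adj hq' ha le_rfl
    · refine iff_of_false ((hPB' _ (P.mem_interior ha)).2 (φ x) ?_ _ (h.mem x hx)) fun hadj =>
        hq.not_adj ha hx hx0 hxL hadj.symm
      simp only [Set.mem_insert_iff, Set.mem_singleton_iff, not_or]
      exact ⟨h.injOn.ne hx hq0 hx0, h.injOn.ne hx hqL hxL⟩

end RainbowCopies

section Forcing

variable {W : Type*} {H : SimpleGraph W} {S : Finset W} {c : ℝ}

/-- All sufficiently good blockades contain a rainbow copy of `H[S]`. -/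
def IsForced (c : ℝ) (H : SimpleGraph W) (S : Finset W) : Prop :=
  ∀ᶠ F : GraphWithFamily.{u} in goodBlockades c, ∃ f φ, IsRainbowCopy F.G F.B H S f φ

theorem isForced_empty (c : ℝ) (H : SimpleGraph W) : IsForced.{u} c H ∅ := by
  filter_upwards [tendsto_card_goodBlockades.eventually_gt_atTop 0, eventually_le_card_indices 1]
    with F hV hι
  obtain ⟨v⟩ := Fintype.card_pos_iff.1 hV
  obtain ⟨m⟩ := Fintype.card_pos_iff.1 hι
  exact ⟨fun _ => v, fun _ => m, by simp, by simp, by simp⟩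

theorem IsForced.of_leaf [DecidableEq W] (hc : 0 < c) {x : W} (hx : x ∈ S)
    (hleaf : #(neighborsIn H x S) ≤ 1) (h : IsForced.{u} c H (S.erase x)) :
    IsForced.{u} c H S := by
  obtain ⟨K, σ, lam, hσ, hlam, hcopy⟩ := exists_eventually_forall_isBlockade h
  filter_upwards [hcopy, tendsto_card_goodBlockades.eventually_gt_atTop 0,
    eventually_le_card_indices 1,
    eventually_exists_private_neighbors hc (Fin (K + #S)) hσ hlam] with F hcopy hV hι hpriv
  have : Nonempty F.V := Fintype.card_pos_iff.1 hV
  obtain ⟨m⟩ := Fintype.card_pos_iff.1 hι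
  obtain ⟨φ', B', hB'F, hB', hm, hB'priv⟩ := hpriv m m
  obtain ⟨f, φ, hf⟩ := hcopy _ B' (by simp) hB'
  have hcard : #(S.erase x) < Fintype.card (Fin (K + #S)) := by
    rw [Fintype.card_fin]
    exact (card_erase_lt_of_mem hx).trans_le (Nat.le_add_left _ _)
  obtain ⟨w, hwm, hw⟩ := hf.exists_adj_iff_of_leaf hcard hB'.nonempty hB'priv
    ((card_le_card (neighborsIn_mono H x (erase_subset x S))).trans hleaf)
  rw [← insert_erase hx, insert_eq]
  exact ⟨_, _, (IsRainbowCopy.singleton hwm).union (hf.of_subset φ' hB'F)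
    (fun _ _ y _ => (hm (φ y)).1.symm) (by simpa using hw)⟩

theorem IsForced.of_isEar [DecidableEq W] (hc1 : c < 1) {k : ℕ} (hk : 1 < (k + 1) * c)
    {q : ℕ → W} (hq : IsEar H S q (3 * k + 5))
    (h : IsForced.{u} c H (S \ (Ioo 0 (3 * k + 5)).image q)) : IsForced.{u} c H S := by
  obtain ⟨K, σ, lam, hσ, hlam, hcopy⟩ := exists_eventually_forall_isBlockade h
  filter_upwards [hcopy, eventually_exists_isLinked hc1 hk (Fin K) hσ hlam]
    with F hcopy ⟨φ', B', hB'F, hB', hlinked⟩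
  obtain ⟨f, φ, hf⟩ := hcopy _ B' (by simp) hB'
  have hq0 := hq.mem_sdiff_interior (Nat.zero_le _) fun h => h.1.ne rfl
  have hqL := hq.mem_sdiff_interior le_rfl fun h => h.2.ne rfl
  have hends : φ (q 0) ≠ φ (q (3 * k + 5)) :=
    hf.injOn.ne hq0 hqL (hq.injOn.ne (Nat.zero_le _) Set.self_mem_Iic (by omega))
  obtain ⟨P, hP, hPB'⟩ := hlinked _ _ hends _ (hf.mem _ hq0) _ (hf.mem _ hqL)
  exact hf.exists_of_isEar hq φ' hB'F P hP hPB'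

theorem HasCongestionLE.isForced (hc1 : c < 1) {k : ℕ} (hk : 1 < (k + 1) * c) {d : ℝ}
    (hd : 3 * ((3 * k + 5 : ℕ) : ℝ) * d ≤ 1) (h : HasCongestionLE H d S) :
    IsForced.{u} c H S := by
  classical
  induction S using Finset.strongInduction with
  | H S ih =>
    rcases S.eq_empty_or_nonempty with rfl | hS
    · exact isForced_empty c H
    by_cases hdeg : ∀ v ∈ S, 2 ≤ #(neighborsIn H v S)
    · obtain ⟨q, hq⟩ := h.exists_isEar hS hdeg (by omega) hd
      refine .of_isEar hc1 hk hq (ih _ (sdiff_ssubset hq.image_interior_subset ?_)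
        (h.mono sdiff_subset))
      exact ⟨q 1, mem_image_of_mem q (mem_Ioo.2 (by omega))⟩
    · push Not at hdeg
      obtain ⟨x, hx, hleaf⟩ := hdeg
      exact .of_leaf (pos_of_one_lt_succ_mul hk) hx (Nat.le_of_lt_succ hleaf)
        (ih _ (erase_ssubset hx) (h.mono (erase_subset x S)))

end Forcing

section Congestion

variable {W : Type*} [Finite W] {H : SimpleGraph W} {d : ℝ}

theorem sum_card_neighborsIn_eq_two_mul_ncard_edgeSet (H : SimpleGraph W) (T : Finset W) :
    ∑ v ∈ T, #(neighborsIn H v T) = 2 * ((⊤ : H.Subgraph).induce (T : Set W)).edgeSet.ncard := by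
  classical
  have := Fintype.ofFinite W
  set J := (⊤ : H.Subgraph).induce (T : Set W)
  have hdeg (v : W) : J.spanningCoe.degree v = if v ∈ T then #(neighborsIn H v T) else 0 := by
    rw [← SimpleGraph.card_neighborFinset_eq_degree]
    split_ifs with hv
    · congr 1
      ext w
      simp [J, mem_neighborsIn, hv]
    · rw [card_eq_zero]
      ext w
      simp [J, hv]
  calc ∑ v ∈ T, #(neighborsIn H v T) = ∑ v, J.spanningCoe.degree v := by
        simp only [hdeg, sum_ite_mem, univ_inter]
    _ = 2 * #J.spanningCoe.edgeFinset := J.spanningCoe.sum_degrees_eq_twice_card_edges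
    _ = 2 * J.edgeSet.ncard := by
        rw [← Set.ncard_coe_finset, SimpleGraph.coe_edgeFinset,
          SimpleGraph.Subgraph.edgeSet_spanningCoe]

theorem hasCongestionLE_of_congestion_le (hd : congestion H ≤ d) (S : Finset W) :
    HasCongestionLE H d S := fun T _ hT => by
  set J := (⊤ : H.Subgraph).induce (T : Set W) with hJ
  have hsum : ∑ v ∈ T, (#(neighborsIn H v T) : ℝ) = 2 * J.edgeSet.ncard :=
    mod_cast sum_card_neighborsIn_eq_two_mul_ncard_edgeSet H T
  have hverts : J.verts.ncard = #T := by
    rw [hJ, SimpleGraph.Subgraph.induce_verts, Set.ncard_coe_finset]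
  have hT1 : (1 : ℝ) ≤ #T := mod_cast hT.card_pos
  rw [hsum]
  rcases J.edgeSet.eq_empty_or_nonempty with hE | hE
  · rw [hE, Set.ncard_empty, Nat.cast_zero]
    linarith
  have hE0 : (0 : ℝ) < J.edgeSet.ncard := mod_cast (Set.ncard_pos (Set.toFinite _)).2 hE
  have hcong : 1 - ((#T : ℝ) - 1) / J.edgeSet.ncard ≤ d :=
    ((isGreatest_congestion H (hE.mono J.edgeSet_subset)).2 ⟨J, hE, by rw [hverts]⟩).trans hd
  have := (le_div_iff₀ hE0).1 (sub_le_comm.1 hcong)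
  linarith

end Congestion

section SparseGraphs

variable {V : Type*} [Fintype V] {G : SimpleGraph V} {ε γ σ lam : ℝ} {K : ℕ}

theorem exists_pairwise_disjoint_card_eq {n s : ℕ} (h : n * s ≤ Fintype.card V) :
    ∃ B : Fin n → Finset V, Pairwise (Function.onFun Disjoint B) ∧ ∀ i, #(B i) = s := by
  obtain ⟨e⟩ : Nonempty (Fin n × Fin s ↪ V) :=
    Function.Embedding.nonempty_of_card_le (by simpa using h)
  refine ⟨fun i => ({i} ×ˢ univ).map e, fun i j hij => ?_, fun i => by simp⟩
  exact (disjoint_map e).2 (disjoint_product.2 (.inl (disjoint_singleton.2 hij)))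

theorem IsSparse.exists_isBlockade (hG : IsSparse G ε) (hK : 0 < K) (hε : ε * (2 * K) ≤ lam)
    (hV : 2 * K * (Fintype.card V : ℝ) ^ (1 - σ) ≤ Fintype.card V) (hKV : K ≤ Fintype.card V) :
    ∃ B : Fin K → Finset V, IsBlockade G σ lam B := by
  obtain ⟨B, hB, hcard⟩ :=
    exists_pairwise_disjoint_card_eq (Nat.mul_div_le (Fintype.card V) K)
  have hwide : (Fintype.card V : ℝ) ≤ 2 * K * ↑(Fintype.card V / K) := by
    have hs : 1 ≤ Fintype.card V / K := (Nat.one_le_div_iff hK).2 hKV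
    have hlt : Fintype.card V < K * (Fintype.card V / K + 1) := Nat.lt_mul_div_succ _ hK
    exact_mod_cast (by nlinarith : Fintype.card V ≤ 2 * K * (Fintype.card V / K))
  refine ⟨B, hB, fun i => ?_, fun i j _ v _ => ?_⟩
  · rw [hcard]
    exact le_of_mul_le_mul_left (hV.trans hwide) (by positivity)
  · have hε0 : 0 ≤ ε :=
      (pos_of_mul_pos_left ((Nat.cast_nonneg _).trans_lt (hG v)) (Nat.cast_nonneg _)).le
    rw [hcard]
    calc (#(neighborsIn G v (B j)) : ℝ) ≤ (G.neighborSet v).ncard := by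
          rw [← Set.ncard_coe_finset]
          exact_mod_cast Set.ncard_le_ncard (fun w hw => (mem_neighborsIn.1 hw).2)
      _ ≤ ε * Fintype.card V := (hG v).le
      _ ≤ ε * (2 * K * ↑(Fintype.card V / K)) := by gcongr
      _ ≤ lam * ↑(Fintype.card V / K) := by rw [← mul_assoc]; gcongr

theorem IsSparse.one_lt_of_isCoherent (hG : IsSparse G ε) (hV : 1 < Fintype.card V)
    (hε : ε ≤ 1 / 2) (h : IsCoherent G γ γ) : 1 < γ := by
  classical
  by_contra! hγ
  have hadj : ∀ v w, v ≠ w → G.Adj v w := by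
    by_contra! ⟨v, w, hvw, hnadj⟩
    exact h ⟨{v}, {w}, ⟨by simpa using hvw, by simpa using hnadj⟩, by simpa using hγ,
      by simpa using hγ⟩
  obtain ⟨v⟩ : Nonempty V := Fintype.card_pos_iff.1 (by omega)
  have hneighbors : G.neighborSet v = ((univ.erase v : Finset V) : Set V) := by
    ext w
    simpa using ⟨fun h => h.ne', fun h => hadj v w (Ne.symm h)⟩
  have hdeg := hG v
  rw [hneighbors, Set.ncard_coe_finset, card_erase_of_mem (mem_univ v), card_univ,
    Nat.cast_pred (by omega)] at hdeg
  have : (2 : ℝ) ≤ Fintype.card V := mod_cast hV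
  nlinarith

theorem IsSparse.one_lt_mul_card {c : ℝ} (hG : IsSparse G ε) (hc : 0 < c)
    (hV : 1 < Fintype.card V) (hε : ε ≤ 1 / 2)
    (h : IsCoherent G (ε * (Fintype.card V : ℝ) ^ (1 - c)) (ε * (Fintype.card V : ℝ) ^ (1 - c))) :
    1 < ε * Fintype.card V := by
  have hγ := hG.one_lt_of_isCoherent hV hε h
  have hpow : (Fintype.card V : ℝ) ^ (1 - c) ≤ Fintype.card V :=
    Real.rpow_le_self_of_one_le (mod_cast hV.le) (by linarith)
  have hε0 : 0 < ε := pos_of_mul_pos_left (one_pos.trans hγ) (by positivity)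
  exact hγ.trans_le (by gcongr)

theorem IsSparse.lt_one {c : ℝ} (hG : IsSparse G (1 / 2)) (hV : 1 < Fintype.card V)
    (h : IsCoherent G (1 / 2 * (Fintype.card V : ℝ) ^ (1 - c))
      (1 / 2 * (Fintype.card V : ℝ) ^ (1 - c))) : c < 1 := by
  by_contra! hc
  have hpow : (Fintype.card V : ℝ) ^ (1 - c) ≤ 1 :=
    Real.rpow_le_one_of_one_le_of_nonpos (mod_cast hV.le) (by linarith)
  linarith [hG.one_lt_of_isCoherent hV le_rfl h]

theorem exists_isGoodBlockade {c : ℝ} (hc : 0 < c) (K : ℕ) :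
    ∃ ε : ℝ, 0 < ε ∧ ∀ {V : Type u} [Fintype V] (G : SimpleGraph V), 1 < Fintype.card V →
      IsSparse G ε →
      IsCoherent G (ε * (Fintype.card V : ℝ) ^ (1 - c)) (ε * (Fintype.card V : ℝ) ^ (1 - c)) →
      ∃ B : Fin (K + 1) → Finset V, IsGoodBlockade c K ⟨V, G, Fin (K + 1), B⟩ := by
  set lam : ℝ := 1 / (K + 1) with hlam
  have hlam0 : 0 < lam := by positivity
  obtain ⟨n₀, hn₀⟩ := eventually_atTop.1 <| (eventually_gt_atTop K).and <|
    eventually_mul_rpow_le (by linarith : 1 - lam < 1) (2 * (K + 1 : ℕ))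
  obtain ⟨ε, hε0, hε⟩ := exists_pos_mul_lt one_pos (2 + n₀ + 2 * (K + 1) * (K + 1) : ℝ)
  rw [add_mul, add_mul] at hε
  have hn₀ε : 0 ≤ n₀ * ε := by positivity
  have hKε : 0 ≤ 2 * (K + 1) * (K + 1) * ε := by positivity
  have hεK : ε * (2 * (K + 1 : ℕ)) ≤ lam := by
    rw [hlam, le_div_iff₀ (by positivity)]
    push_cast
    linarith
  refine ⟨ε, hε0, fun {V} _ G hV hG hcoh => ?_⟩
  have hn : n₀ ≤ Fintype.card V := by
    have := (by linarith : ε * n₀ ≤ 1).trans_lt (hG.one_lt_mul_card hc hV (by linarith) hcoh)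
    exact_mod_cast (lt_of_mul_lt_mul_left this hε0.le).le
  obtain ⟨hKV, hwide⟩ := hn₀ _ hn
  rw [Real.rpow_one] at hwide
  obtain ⟨B, hB⟩ := hG.exists_isBlockade K.succ_pos hεK hwide hKV
  have hcoh' : ε * (Fintype.card V : ℝ) ^ (1 - c) ≤ (Fintype.card V : ℝ) ^ (1 - c) :=
    mul_le_of_le_one_left (by positivity) (by linarith)
  exact ⟨B, hKV, by simp, hcoh.mono hcoh' hcoh', hB⟩

end SparseGraphs

theorem exists_linkage_length {c : ℝ} (hc : 0 < c) :
    ∃ k : ℕ, 1 < (k + 1) * c ∧ 3 * ((3 * k + 5 : ℕ) : ℝ) * (c / (9 + 15 * c)) ≤ 1 := by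
  refine ⟨⌊1 / c⌋₊, (div_lt_iff₀ hc).1 (Nat.lt_floor_add_one _), ?_⟩
  have hk : ⌊1 / c⌋₊ * c ≤ 1 := (le_div_iff₀ hc).1 (Nat.floor_le (by positivity))
  rw [mul_div_assoc', div_le_one (by positivity)]
  push_cast
  linarith

end PurePairs

theorem theorem2p3 {W : Type*} [Fintype W] (H : SimpleGraph W) (c : ℝ) (hc : 0 < c)
    (hH : PurePairs.congestion H ≤ c / (9 + 15 * c)) :
    ∃ ε : ℝ, 0 < ε ∧ ∀ {V : Type*} [Fintype V] (G : SimpleGraph V),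
      1 < Fintype.card V →
      PurePairs.IsSparse G ε →
      PurePairs.IsCoherent G (ε * (Fintype.card V : ℝ) ^ (1 - c))
        (ε * (Fintype.card V : ℝ) ^ (1 - c)) →
      H.IsIndContained G := by
  rcases le_or_gt 1 c with hc1 | hc1
  · exact ⟨1 / 2, by norm_num, fun G hV hG hcoh => absurd (hG.lt_one hV hcoh) hc1.not_gt⟩
  obtain ⟨k, hk, hd⟩ := PurePairs.exists_linkage_length hc
  have hforced : PurePairs.IsForced c H Finset.univ :=
    (PurePairs.hasCongestionLE_of_congestion_le hH _).isForced hc1 hk hd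
  obtain ⟨K, hK⟩ := PurePairs.eventually_goodBlockades_iff.1 hforced
  obtain ⟨ε, hε, hblockade⟩ := PurePairs.exists_isGoodBlockade hc K
  refine ⟨ε, hε, fun G hV hG hcoh => ?_⟩
  obtain ⟨B, hB⟩ := hblockade G hV hG hcoh
  obtain ⟨f, φ, hf⟩ := hK _ hB
  exact hf.isIndContained hB.isBlockade.disjoint
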